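/- Let $-\infty<a<b<\infty$, $\ell=b-a$, $1<p<\infty$, $\frac1p+\frac1{p'}=1$, $0\le\lambda<1$. For measurable $f:[a,b]\to\mathbb C$ put $$\|f\|_{p,\lambda}=\sup_{x\in[a,b],\,r>0}\Big(\frac1{r^\lambda}\int_{[a,b]\cap(x-r,x+r)}|f(y)|^p\,dy\Big)^{1/p},$$ and for a weight $\varrho$ let $\mathcal L^{p,\lambda}([a,b],\varrho)$ be the space of measurable $f$ with $\|\varrho f\|_{p,\lambda}<\infty$, normed by $\|\varrho f\|_{p,\lambda}$. Let $$Sf(x)=\frac1\pi\,\mathrm{p.v.}\!\int_a^b\frac{f(t)\,dt}{t-x}.$$ Classes of functions. $W$ is the class of continuous positive functions on $(0,\ell]$. A function $\varphi$ is almost increasing if $\varphi(x)\le C\varphi(y)$ for all $0<x\le y\le\ell$, with some constant $C>0$. $W_0$ is the class of almost increasing $\varphi\in W$ with $\lim_{x\to0}\varphi(x)=0$. $\widetilde W$ is the class of $\varphi\in W$ such that $x^\alpha\varphi(x)\in W_0$ for some $\alpha>0$. With $x_+=\max(x,y)$ and $x_-=\min(x,y)$, $V_{++}$ and $V_{-+}$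 are the classes of $\varphi\in W$ such that, for some constant $C$ and all $x\ne y$ in $(0,\ell]$, $$\Big|\frac{\varphi(x)-\varphi(y)}{x-y}\Big|\le C\frac{\varphi(x_+)}{x_+},\qquad\text{respectively}\qquad \Big|\frac{\varphi(x)-\varphi(y)}{x-y}\Big|\le C\frac{\varphi(x_-)}{x_+}.$$ For $\beta,\gamma\in\mathbb R$, the condition $\varphi\in\mathbb Z^\beta_\gamma$ means that, for some constant $c$ and all $0<h\le\ell$, $$\int_0^h\frac{\varphi(x)}{x^{1+\beta}}\,dx\le c\,\frac{\varphi(h)}{h^\beta}\qquad\text{and}\qquad \int_h^\ell\frac{\varphi(x)}{x^{1+\gamma}}\,dx\le c\,\frac{\varphi(h)}{h^\gamma}.$$ The Matuszewska–Orlicz indices are, with values in $[-\infty,\infty]$ and with $\Phi(x)=\limsup_{h\to0+}\frac{\varphi(hx)}{\varphi(h)}$, $$m(\varphi)=\sup_{0<x<1}\frac{\ln\Phi(x)}{\ln x},\qquad M(\varphi)=\lim_{x\to\infty}\frac{\ln\Phi(x)}{\ln x}.$$ Theorem. Let $x_1,\dots,x_N\in[a,b]$ be distinct, let $\varphi_k\in\widetilde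 W\cap(V_{++}\cup V_{-+})$ for $k=1,\dots,N$, and let $\varrho(x)=\prod_{k=1}^N\varphi_k(|x-x_k|)$. If $$\varphi_k\in\mathbb Z^{\frac{\lambda-1}p}_{\frac\lambda p+\frac1{p'}},\qquad k=1,\dots,N,$$ then $S$ is bounded in $\mathcal L^{p,\lambda}([a,b],\varrho)$: for every $f$ in this space the principal value $Sf(x)$ exists for almost every $x\in[a,b]$, $Sf$ belongs to the space, and $\|\varrho Sf\|_{p,\lambda}\le C\|\varrho f\|_{p,\lambda}$ with $C$ independent of $f$. Moreover, for each $k$ the condition on $\varphi_k$ is equivalent to $$\frac{\lambda-1}p<m(\varphi_k)\le M(\varphi_k)<\frac\lambda p+\frac1{p'}.$$ -/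

import Mathlib

open Set Filter Topology MeasureTheory
open scoped ENNReal NNReal

noncomputable section

namespace WeightedMorrey

/-! ### Admissible weight functions on `(0, ℓ]`

A weight function is a map `φ : ℝ → ℝ` of which only the values on `(0, ℓ]` matter. -/

/-- The class `W`: continuous and positive on `(0, ℓ]`. -/
def ClassW (ℓ : ℝ) (φ : ℝ → ℝ) : Prop :=
  ContinuousOn φ (Ioc 0 ℓ) ∧ ∀ x ∈ Ioc 0 ℓ, 0 < φ x

/-- Almost increasing on `(0, ℓ]`: `φ x ≤ C φ y` for `x ≤ y`, with a constant `C > 0`. -/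
def AlmostIncreasing (ℓ : ℝ) (φ : ℝ → ℝ) : Prop :=
  ∃ C : ℝ, 0 < C ∧ ∀ x ∈ Ioc 0 ℓ, ∀ y ∈ Ioc 0 ℓ, x ≤ y → φ x ≤ C * φ y

/-- The class `W₀`: functions in `W` that are almost increasing and tend to `0` at `0+`. -/
def ClassW0 (ℓ : ℝ) (φ : ℝ → ℝ) : Prop :=
  ClassW ℓ φ ∧ Tendsto φ (𝓝[>] 0) (𝓝 0) ∧ AlmostIncreasing ℓ φ

/-- The class `W̃`: functions in `W` such that `x ^ α * φ x` is in `W₀` for some `α > 0`. -/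
def ClassWTilde (ℓ : ℝ) (φ : ℝ → ℝ) : Prop :=
  ClassW ℓ φ ∧ ∃ α : ℝ, 0 < α ∧ ClassW0 ℓ (fun x => x ^ α * φ x)

/-- The class `V₊₊`. -/
def ClassVpp (ℓ : ℝ) (φ : ℝ → ℝ) : Prop :=
  ClassW ℓ φ ∧ ∃ C : ℝ, 0 < C ∧ ∀ x ∈ Ioc 0 ℓ, ∀ y ∈ Ioc 0 ℓ, x ≠ y →
    |(φ x - φ y) / (x - y)| ≤ C * (φ (max x y) / max x y)

/-- The class `V₋₊`. -/
def ClassVmp (ℓ : ℝ) (φ : ℝ → ℝ) : Prop :=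
  ClassW ℓ φ ∧ ∃ C : ℝ, 0 < C ∧ ∀ x ∈ Ioc 0 ℓ, ∀ y ∈ Ioc 0 ℓ, x ≠ y →
    |(φ x - φ y) / (x - y)| ≤ C * (φ (min x y) / max x y)

/-! ### Zygmund classes

The integrals are those of nonnegative functions, so the inequalities include convergence. -/

/-- The condition `Z^β`: `∫₀ʰ φ(x) / x^(1+β) dx ≤ c φ(h) / h^β` for `0 < h ≤ ℓ`. -/
def ZygmundUpper (ℓ β : ℝ) (φ : ℝ → ℝ) : Prop :=
  ∃ c : ℝ, 0 < c ∧ ∀ h ∈ Ioc 0 ℓ,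
    ∫⁻ x in Ioc 0 h, ENNReal.ofReal (φ x / x ^ (1 + β)) ≤ ENNReal.ofReal (c * (φ h / h ^ β))

/-- The condition `Z_γ`: `∫ₕ^ℓ φ(x) / x^(1+γ) dx ≤ c φ(h) / h^γ` for `0 < h ≤ ℓ`. -/
def ZygmundLower (ℓ γ : ℝ) (φ : ℝ → ℝ) : Prop :=
  ∃ c : ℝ, 0 < c ∧ ∀ h ∈ Ioc 0 ℓ,
    ∫⁻ x in Ioc h ℓ, ENNReal.ofReal (φ x / x ^ (1 + γ)) ≤ ENNReal.ofReal (c * (φ h / h ^ γ))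

/-- The Bari-Stechkin-Zygmund condition `Z^β_γ`. -/
def Zygmund (ℓ β γ : ℝ) (φ : ℝ → ℝ) : Prop :=
  ZygmundUpper ℓ β φ ∧ ZygmundLower ℓ γ φ

/-! ### Matuszewska-Orlicz indices -/

/-- `ln (limsup_{h → 0+} φ(hx) / φ(h)) / ln x`, with values in `[-∞, ∞]`. -/
def indexQuotient (φ : ℝ → ℝ) (x : ℝ) : EReal :=
  ENNReal.log (limsup (fun h : ℝ => ENNReal.ofReal (φ (h * x) / φ h)) (𝓝[>] 0)) /
    ((Real.log x : ℝ) : EReal)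

/-- The lower index `m(φ) = sup_{0 < x < 1} indexQuotient φ x`. -/
def lowerIndex (φ : ℝ → ℝ) : EReal := ⨆ x ∈ Ioo (0 : ℝ) 1, indexQuotient φ x

/-- The upper index `M(φ) = lim_{x → ∞} indexQuotient φ x`. The inner `limsup` is submultiplicative
in `x`, so the limit exists for the functions considered here; it is written as an upper limit. -/
def upperIndex (φ : ℝ → ℝ) : EReal := limsup (indexQuotient φ) atTop

/-! ### Weighted Morrey spaces on `[a, b]` -/

/-- The Morrey norm
`sup_{x ∈ [a, b], r > 0} (r^(-λ) ∫_{B(x, r) ∩ [a, b]} |f|^p)^(1/p)`. -/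
def morreyNorm (a b p lam : ℝ) (f : ℝ → ℂ) : ℝ≥0∞ :=
  ⨆ x ∈ Icc a b, ⨆ r ∈ Ioi (0 : ℝ),
    ((∫⁻ y in Metric.ball x r ∩ Icc a b, ‖f y‖ₑ ^ p) / ENNReal.ofReal (r ^ lam)) ^ (1 / p)

/-- The norm of the weighted Morrey space: the Morrey norm of `ρ f`. -/
def weightedMorreyNorm (a b p lam : ℝ) (ρ : ℝ → ℝ) (f : ℝ → ℂ) : ℝ≥0∞ :=
  morreyNorm a b p lam (fun x => (ρ x : ℂ) * f x)

/-- Membership in the weighted Morrey space over `[a, b]`. -/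
def MemWeightedMorrey (a b p lam : ℝ) (ρ : ℝ → ℝ) (f : ℝ → ℂ) : Prop :=
  AEStronglyMeasurable f (volume.restrict (Icc a b)) ∧ weightedMorreyNorm a b p lam ρ f < ∞

/-! ### The singular operator on `[a, b]` -/

/-- The truncated integral `(1/π) ∫_{t ∈ [a, b], |t - x| > ε} f(t) / (t - x) dt`. -/
def truncatedSingular (a b : ℝ) (f : ℝ → ℂ) (x ε : ℝ) : ℂ :=
  (1 / (Real.pi : ℂ)) * ∫ t in Icc a b \ Metric.closedBall x ε, f t / ((t : ℂ) - (x : ℂ))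

/-- The singular operator: `S f (x)` is the principal value
`(1/π) lim_{ε → 0+} ∫_{t ∈ [a, b], |t - x| > ε} f(t) / (t - x) dt`. -/
def singularOp (a b : ℝ) (f : ℝ → ℂ) (x : ℝ) : ℂ :=
  limUnder (𝓝[>] (0 : ℝ)) (truncatedSingular a b f x)

/-- The principal value defining `S f (x)` exists: the truncated integrals converge absolutely and
have a limit, which then is `S f (x)`. -/
def SingularExistsAt (a b : ℝ) (f : ℝ → ℂ) (x : ℝ) : Prop :=
  (∀ ε > 0, IntegrableOn (fun t => f t / ((t : ℂ) - (x : ℂ))) (Icc a b \ Metric.closedBall x ε)) ∧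
    Tendsto (truncatedSingular a b f x) (𝓝[>] (0 : ℝ)) (𝓝 (singularOp a b f x))

/-- `S` is a bounded operator in the weighted Morrey space: for every `f` of the space, `S f`
exists almost everywhere, belongs to the space, and its norm is at most a constant times that
of `f`. -/
def SingularOpBounded (a b p lam : ℝ) (ρ : ℝ → ℝ) : Prop :=
  ∃ C : ℝ≥0, ∀ f : ℝ → ℂ, MemWeightedMorrey a b p lam ρ f →
    (∀ᵐ x ∂(volume.restrict (Icc a b)), SingularExistsAt a b f x) ∧
    MemWeightedMorrey a b p lam ρ (singularOp a b f) ∧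
    weightedMorreyNorm a b p lam ρ (singularOp a b f) ≤ C * weightedMorreyNorm a b p lam ρ f

end WeightedMorrey

end

noncomputable section

namespace WeightedMorrey

/-! ### Auxiliary estimates: dyadic shells and Hölder's inequality. -/

/-! ### Integrals of powers against measures of power growth -/

/-! Write β = (λ-1)/p and γ = λ/p + 1/p', so that γ = β + 1. All information on the weights passes
through the power estimates `PowerUpper` and `PowerLower`. Membership in W̃ together with a V
condition makes φ doubling. For doubling φ, the condition Z^β_γ amounts to φ(x) ≤ C (x/y)^(β+ε) φ(y)
and φ(y) ≤ C (y/x)^(γ-δ) φ(x) for x ≤ y, with some ε, δ > 0. Indeed a Zygmund integral is controlled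
by its own dyadic increments, hence decays geometrically, and this self-improvement produces ε and δ
(`ZygmundUpper.powerUpper`, `ZygmundLower.powerLower`). The strict inequalities for the indices
express the same power estimates, which gives `zygmund_iff_index`.

For the boundedness put w = ρf and write π ρ(x) Sf(x) = p.v.∫ w(t)/(t-x) dt + ∫
(ρ(x)-ρ(t))/(ρ(t)(t-x)) w(t) dt. Both operators acting on w have to be bounded in the unweighted
Morrey space.

The kernel of the second one is dominated by a sum over the nodes of Hardy kernels, homogeneous of
degree -1 about the node, plus a product of a function of x and a function of t
(`exists_weight_kernel_bounds`). A Hardy operator is a superposition of dilations; the dilation by s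
acts on the Morrey norm with the factor |s|^β, and the resulting integral over s converges when the
exponents satisfy b > β and g < γ (`MorreyBound.hardy`). In the product term, |x-z|^b lies in the
Morrey space of the interval, and |t-z|^(-g) is integrable against every Morrey function.

The first operator is treated on each ball by splitting w into a near and a far part
(`hilbert_morrey`), which rests on the L^p theorem of M. Riesz (`hilbert_real`). For f ≥ 0 of
compact support, not almost everywhere zero, the function F(z) = -i∫ f(t)/(t-z) dt has positive real
part in the upper half-plane, and the integral of F^p over any horizontal line there is zero.
Combined with |Im w|^p ≤ A (Re w)^p - B Re(w^p) for 1 < p ≤ 2, this bounds the conjugate Poisson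
integral by the Poisson integral in L^p, uniformly in the height; duality gives p ≥ 2. Conjugate
Poisson integrals converge in L^1 of the Poisson measure to a function h as the height tends to 0
along a sequence. The semigroup property makes each of them a Poisson integral of h, so they
converge to h at Lebesgue points of h; truncated singular integrals differ from them by a quantity
that vanishes at Lebesgue points of f. -/

theorem rpow_neg_le_of_mem_shell (a : ℝ) {R T : ℝ} (hR : 0 < R) (h1 : R / 2 ≤ T) (h2 : T ≤ R) :
    T ^ (-a) ≤ 2 ^ |a| * R ^ (-a) := by
  have hT : 0 < T := by linarith
  rcases le_total 0 a with ha | ha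
  · rw [abs_of_nonneg ha]
    calc T ^ (-a) ≤ (R / 2) ^ (-a) :=
          Real.rpow_le_rpow_of_nonpos (by positivity) h1 (by linarith)
      _ = 2 ^ a * R ^ (-a) := by
          rw [Real.div_rpow hR.le (by norm_num), Real.rpow_neg (by norm_num : (0 : ℝ) ≤ 2)]
          field_simp
  · calc T ^ (-a) ≤ R ^ (-a) := Real.rpow_le_rpow hT.le h2 (by linarith)
      _ ≤ 2 ^ |a| * R ^ (-a) := le_mul_of_one_le_left (by positivity)
          (Real.one_le_rpow (by norm_num) (abs_nonneg a))

theorem lintegral_shell_le {s : ℝ} (a : ℝ) {μ : Measure ℝ} {c : ℝ} {G : ℝ≥0∞}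
    (hμ : ∀ R > 0, μ (Metric.closedBall c R) ≤ G * ENNReal.ofReal (R ^ s)) {R : ℝ} (hR : 0 < R) :
    ∫⁻ t in {t | R / 2 ≤ |t - c| ∧ |t - c| ≤ R}, ENNReal.ofReal (|t - c| ^ (-a)) ∂μ ≤
      ENNReal.ofReal (2 ^ |a|) * G * ENNReal.ofReal (R ^ (s - a)) := by
  have hm : MeasurableSet {t : ℝ | R / 2 ≤ |t - c| ∧ |t - c| ≤ R} := by
    have hc : Measurable fun t : ℝ => |t - c| := by fun_prop
    exact (measurableSet_le measurable_const hc).inter (measurableSet_le hc measurable_const)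
  calc ∫⁻ t in {t | R / 2 ≤ |t - c| ∧ |t - c| ≤ R}, ENNReal.ofReal (|t - c| ^ (-a)) ∂μ
      ≤ ∫⁻ t in {t | R / 2 ≤ |t - c| ∧ |t - c| ≤ R}, ENNReal.ofReal (2 ^ |a| * R ^ (-a)) ∂μ := by
        apply setLIntegral_mono' hm
        intro t ht
        exact ENNReal.ofReal_le_ofReal (rpow_neg_le_of_mem_shell a hR ht.1 ht.2)
    _ ≤ ENNReal.ofReal (2 ^ |a| * R ^ (-a)) * μ (Metric.closedBall c R) := by
        rw [setLIntegral_const]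
        gcongr
        intro t ht
        rw [Metric.mem_closedBall, Real.dist_eq]
        exact ht.2
    _ ≤ ENNReal.ofReal (2 ^ |a| * R ^ (-a)) * (G * ENNReal.ofReal (R ^ s)) := by
        gcongr
        exact hμ R hR
    _ = _ := by
        rw [ENNReal.ofReal_mul (by positivity), sub_eq_neg_add, Real.rpow_add hR,
          ENNReal.ofReal_mul (by positivity)]
        ring

theorem tsum_geometric_rpow {e X : ℝ} (he : 0 < e) (hX : 0 < X) :
    ∑' n : ℕ, ENNReal.ofReal ((X * ((1 / 2 : ℝ) ^ n)) ^ e) =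
      ENNReal.ofReal (1 / (1 - (1 / 2 : ℝ) ^ e)) * ENNReal.ofReal (X ^ e) := by
  have h1 : (1 / 2 : ℝ) ^ e < 1 := Real.rpow_lt_one (by norm_num) (by norm_num) he
  have h0 : (0 : ℝ) ≤ (1 / 2 : ℝ) ^ e := by positivity
  have hs := hasSum_geometric_of_lt_one h0 h1
  have hs2 := hs.mul_right (X ^ e)
  have : ∀ n : ℕ, (X * ((1 / 2 : ℝ) ^ n)) ^ e = ((1 / 2 : ℝ) ^ e) ^ n * X ^ e := by
    intro n
    rw [Real.mul_rpow hX.le (by positivity), mul_comm, ← Real.rpow_natCast, ← Real.rpow_natCast,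
      ← Real.rpow_mul (by norm_num), ← Real.rpow_mul (by norm_num), mul_comm e]
  simp_rw [this]
  rw [← ENNReal.ofReal_tsum_of_nonneg (fun n => by positivity) hs2.summable, hs2.tsum_eq,
    ENNReal.ofReal_mul (by
      have : 0 < 1 - (1 / 2 : ℝ) ^ e := by linarith
      positivity), one_div (1 - (1 / 2 : ℝ) ^ e)]

/-- The shell of radius X 2^(-n) contributes at most a constant times G (X 2^(-n))^(s-a), a
convergent geometric series as a < s. Assuming only growth of the measure lets the estimate serve
both Lebesgue measure (s = 1) and measures with a Morrey function as density. The centre lies in no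
shell and is excluded. -/
theorem lintegral_inner_of_growth {s a : ℝ} (h : a < s) :
    ∃ C : ℝ≥0, ∀ (μ : Measure ℝ) (c : ℝ) (G : ℝ≥0∞),
      (∀ R > 0, μ (Metric.closedBall c R) ≤ G * ENNReal.ofReal (R ^ s)) → ∀ X > 0,
      ∫⁻ t in {t | 0 < |t - c| ∧ |t - c| ≤ X}, ENNReal.ofReal (|t - c| ^ (-a)) ∂μ ≤
        C * G * ENNReal.ofReal (X ^ (s - a)) := by
  refine ⟨Real.toNNReal (2 ^ |a|) * Real.toNNReal (1 / (1 - (1 / 2 : ℝ) ^ (s - a))),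
    fun μ c G hμ X hX => ?_⟩
  have hsub : {t : ℝ | 0 < |t - c| ∧ |t - c| ≤ X} ⊆
      ⋃ n : ℕ, {t | X * (1 / 2) ^ n / 2 ≤ |t - c| ∧ |t - c| ≤ X * (1 / 2) ^ n} := by
    rintro t ⟨h0, h1⟩
    have hy : |t - c| / X ≤ 1 := by rw [div_le_one hX]; exact h1
    obtain ⟨n, hn1, hn2⟩ := exists_nat_pow_near_of_lt_one (x := |t - c| / X)
      (y := (1 / 2 : ℝ)) (by positivity) hy (by norm_num) (by norm_num)
    refine mem_iUnion.2 ⟨n, ?_, ?_⟩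
    · rw [lt_div_iff₀ hX, pow_succ] at hn1
      linarith
    · rw [div_le_iff₀ hX] at hn2
      linarith
  calc _ ≤ ∫⁻ t in ⋃ n : ℕ, {t | X * (1 / 2) ^ n / 2 ≤ |t - c| ∧ |t - c| ≤ X * (1 / 2) ^ n},
        ENNReal.ofReal (|t - c| ^ (-a)) ∂μ := lintegral_mono_set hsub
    _ ≤ ∑' n : ℕ, _ := lintegral_iUnion_le _ _
    _ ≤ ∑' n : ℕ, ENNReal.ofReal (2 ^ |a|) * G *
          ENNReal.ofReal ((X * ((1 / 2 : ℝ) ^ n)) ^ (s - a)) :=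
        ENNReal.tsum_le_tsum fun n => lintegral_shell_le a hμ (by positivity)
    _ = _ := by
        rw [ENNReal.tsum_mul_left, tsum_geometric_rpow (by linarith) hX]
        push_cast
        simp only [ENNReal.ofReal]
        ring

theorem lintegral_outer_of_growth {s a : ℝ} (h : s < a) :
    ∃ C : ℝ≥0, ∀ (μ : Measure ℝ) (c : ℝ) (G : ℝ≥0∞),
      (∀ R > 0, μ (Metric.closedBall c R) ≤ G * ENNReal.ofReal (R ^ s)) → ∀ X > 0,
      ∫⁻ t in {t | X ≤ |t - c|}, ENNReal.ofReal (|t - c| ^ (-a)) ∂μ ≤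
        C * G * ENNReal.ofReal (X ^ (s - a)) := by
  refine ⟨Real.toNNReal (2 ^ |a|) * Real.toNNReal (1 / (1 - (1 / 2 : ℝ) ^ (a - s))) *
    Real.toNNReal (2 ^ (s - a)), fun μ c G hμ X hX => ?_⟩
  have hsub : {t : ℝ | X ≤ |t - c|} ⊆
      ⋃ n : ℕ, {t | 2 * X * 2 ^ n / 2 ≤ |t - c| ∧ |t - c| ≤ 2 * X * 2 ^ n} := by
    rintro t h1
    have hy : 1 ≤ |t - c| / X := by rw [le_div_iff₀ hX]; simpa using h1
    obtain ⟨n, hn1, hn2⟩ := exists_nat_pow_near (x := |t - c| / X)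
      (y := (2 : ℝ)) hy (by norm_num)
    refine mem_iUnion.2 ⟨n, ?_, ?_⟩
    · rw [le_div_iff₀ hX] at hn1
      linarith
    · rw [div_lt_iff₀ hX, pow_succ] at hn2
      linarith
  -- Passing to reciprocals turns the growing radii with negative exponent s-a into shrinking ones
  -- with positive exponent, so the same geometric series applies.
  have hpow : ∀ n : ℕ, (2 * X * 2 ^ n) ^ (s - a) = ((2 * X)⁻¹ * (1 / 2 : ℝ) ^ n) ^ (a - s) := by
    intro n
    rw [← neg_sub a s, Real.rpow_neg (by positivity), ← Real.inv_rpow (by positivity)]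
    congr 1
    rw [mul_inv, one_div, inv_pow]
  calc _ ≤ ∫⁻ t in ⋃ n : ℕ, {t | 2 * X * 2 ^ n / 2 ≤ |t - c| ∧ |t - c| ≤ 2 * X * 2 ^ n},
        ENNReal.ofReal (|t - c| ^ (-a)) ∂μ := lintegral_mono_set hsub
    _ ≤ ∑' n : ℕ, _ := lintegral_iUnion_le _ _
    _ ≤ ∑' n : ℕ, ENNReal.ofReal (2 ^ |a|) * G *
          ENNReal.ofReal (((2 * X)⁻¹ * ((1 / 2 : ℝ) ^ n)) ^ (a - s)) :=
        ENNReal.tsum_le_tsum fun n => by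
          rw [← hpow]; exact lintegral_shell_le a hμ (by positivity)
    _ = _ := by
        rw [ENNReal.tsum_mul_left, tsum_geometric_rpow (by linarith) (by positivity),
          Real.inv_rpow (by positivity), ← Real.rpow_neg (by positivity), neg_sub,
          Real.mul_rpow (by norm_num) hX.le, ENNReal.ofReal_mul (by positivity)]
        push_cast
        simp only [ENNReal.ofReal]
        ring

theorem volume_closedBall_growth (c R : ℝ) :
    volume (Metric.closedBall c R) ≤ 2 * ENNReal.ofReal (R ^ (1 : ℝ)) := by
  rw [Real.volume_closedBall, Real.rpow_one, ENNReal.ofReal_mul (by norm_num)]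
  simp

/-! ### Hölder's inequality for a kernel -/

/-- Hölder applied to the splitting k g = (k^(1/p) g) · k^(1-1/p). This replaces Minkowski's
integral inequality in the estimates of positive operators below. -/
theorem lintegral_mul_rpow_le {α : Type*} [MeasurableSpace α] {μ : Measure α} {p : ℝ} (hp : 1 < p)
    {k g : α → ℝ≥0∞} (hk : AEMeasurable k μ) (hg : AEMeasurable g μ) :
    (∫⁻ t, k t * g t ∂μ) ^ p ≤ (∫⁻ t, k t ∂μ) ^ (p - 1) * ∫⁻ t, k t * g t ^ p ∂μ := by
  have hpq := Real.HolderConjugate.conjExponent hp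
  have hp0 : 0 < p := by linarith
  have hinv : 0 ≤ 1 - 1 / p := by
    rw [sub_nonneg, div_le_one hp0]; exact hp.le
  have h := ENNReal.lintegral_mul_le_Lp_mul_Lq μ hpq (f := fun t => k t ^ (1 / p) * g t)
    (g := fun t => k t ^ (1 - 1 / p)) ((hk.pow_const _).mul hg) (hk.pow_const _)
  have e1 : ∀ t, ((fun t => k t ^ (1 / p) * g t) * fun t => k t ^ (1 - 1 / p)) t = k t * g t := by
    intro t
    simp only [Pi.mul_apply]
    rw [mul_right_comm, ← ENNReal.rpow_add_of_nonneg _ _ (by positivity) hinv]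
    simp
  have e2 : ∀ t, (k t ^ (1 / p) * g t) ^ p = k t * g t ^ p := by
    intro t
    rw [ENNReal.mul_rpow_of_nonneg _ _ hp0.le, ← ENNReal.rpow_mul, one_div,
      inv_mul_cancel₀ hp0.ne', ENNReal.rpow_one]
  have hq1 : 1 / p.conjExponent = 1 - 1 / p := by
    have := hpq.inv_add_inv_eq_one
    rw [one_div, one_div]; linarith
  have e3 : ∀ t, (k t ^ (1 - 1 / p)) ^ p.conjExponent = k t := by
    intro t
    rw [← ENNReal.rpow_mul, ← hq1, one_div, inv_mul_cancel₀ hpq.symm.pos.ne', ENNReal.rpow_one]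
  simp_rw [e1, e2, e3, hq1] at h
  calc _ ≤ ((∫⁻ t, k t * g t ^ p ∂μ) ^ (1 / p) * (∫⁻ t, k t ∂μ) ^ (1 - 1 / p)) ^ p := by gcongr
    _ = _ := by
      rw [ENNReal.mul_rpow_of_nonneg _ _ hp0.le, ← ENNReal.rpow_mul, ← ENNReal.rpow_mul, one_div,
        inv_mul_cancel₀ hp0.ne', ENNReal.rpow_one, mul_comm]
      congr 2
      field_simp

/-! ### Weights: doubling, Zygmund conditions, indices. -/

/-! ### Doubling weight functions -/

/-- Values at points of comparable size are comparable. -/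
def Doubling (ℓ : ℝ) (φ : ℝ → ℝ) : Prop :=
  ∃ K : ℝ, 1 ≤ K ∧ ∀ y ∈ Ioc 0 ℓ, ∀ x, y / 2 ≤ x → x ≤ y → φ x ≤ K * φ y ∧ φ y ≤ K * φ x

/-- `φ x ≤ C (x / y) ^ b φ y` for `x ≤ y`. -/
def PowerUpper (ℓ b : ℝ) (φ : ℝ → ℝ) : Prop :=
  ∃ C : ℝ, 0 < C ∧ ∀ x y, 0 < x → x ≤ y → y ≤ ℓ → φ x ≤ C * (x / y) ^ b * φ y

/-- `φ y ≤ C (y / x) ^ b φ x` for `x ≤ y`. -/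
def PowerLower (ℓ b : ℝ) (φ : ℝ → ℝ) : Prop :=
  ∃ C : ℝ, 0 < C ∧ ∀ x y, 0 < x → x ≤ y → y ≤ ℓ → φ y ≤ C * (y / x) ^ b * φ x

theorem PowerUpper.mono {ℓ b b' : ℝ} {φ : ℝ → ℝ} (hW : ClassW ℓ φ) (h : PowerUpper ℓ b φ)
    (hb : b' ≤ b) : PowerUpper ℓ b' φ := by
  obtain ⟨C, hC, h⟩ := h
  refine ⟨C, hC, fun x y hx hxy hy => (h x y hx hxy hy).trans ?_⟩
  have hy0 : 0 < y := hx.trans_le hxy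
  have := hW.2 y ⟨hy0, hy⟩
  gcongr C * ?_ * φ y
  exact Real.rpow_le_rpow_of_exponent_ge (by positivity) ((div_le_one hy0).2 hxy) hb

theorem PowerLower.mono {ℓ b b' : ℝ} {φ : ℝ → ℝ} (hW : ClassW ℓ φ) (h : PowerLower ℓ b φ)
    (hb : b ≤ b') : PowerLower ℓ b' φ := by
  obtain ⟨C, hC, h⟩ := h
  refine ⟨C, hC, fun x y hx hxy hy => (h x y hx hxy hy).trans ?_⟩
  have := hW.2 x ⟨hx, hxy.trans hy⟩
  gcongr C * ?_ * φ x
  exact Real.rpow_le_rpow_of_exponent_le ((one_le_div hx).2 hxy) hb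

/-- A one-step comparison down to the ratio q is chained n times. The factor K + 1 instead of K is
at least 1, so a bound for fewer steps is also a bound for more. -/
theorem Doubling.iterate {ℓ : ℝ} {φ : ℝ → ℝ} (hW : ClassW ℓ φ) {q K : ℝ} (hq0 : 0 < q) (hq1 : q < 1)
    (hK : 0 ≤ K) (h : ∀ y ∈ Ioc 0 ℓ, ∀ x, q * y ≤ x → x ≤ y → φ y ≤ K * φ x) (n : ℕ) :
    ∀ y ∈ Ioc 0 ℓ, ∀ x, q ^ n * y ≤ x → x ≤ y → φ y ≤ (K + 1) ^ n * φ x := by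
  induction n with
  | zero =>
    intro y hy x h1 h2
    have : x = y := le_antisymm h2 (by simpa using h1)
    simp [this]
  | succ n ih =>
    intro y hy x h1 h2
    have hx0 : 0 < x := lt_of_lt_of_le (mul_pos (pow_pos hq0 _) hy.1) h1
    have hφx := hW.2 x ⟨hx0, h2.trans hy.2⟩
    rcases le_total (q ^ n * y) x with h3 | h3
    · refine (ih y hy x h3 h2).trans ?_
      gcongr
      · linarith
      · omega
    · have hqn : q ^ n * y ≤ y := mul_le_of_le_one_left hy.1.le (pow_le_one₀ hq0.le hq1.le)
      have h4 := ih y hy (q ^ n * y) le_rfl hqn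
      have h5 := h (q ^ n * y) ⟨mul_pos (pow_pos hq0 _) hy.1, hqn.trans hy.2⟩ x
        (by rw [← mul_assoc, ← pow_succ']; exact h1) h3
      calc φ y ≤ (K + 1) ^ n * φ (q ^ n * y) := h4
        _ ≤ (K + 1) ^ n * (K * φ x) := by gcongr
        _ ≤ (K + 1) ^ n * ((K + 1) * φ x) := by gcongr; linarith
        _ = _ := by ring

/-- The reversed inequality is the previous one for 1/φ. -/
theorem Doubling.iterate' {ℓ : ℝ} {φ : ℝ → ℝ} (hW : ClassW ℓ φ) {q K : ℝ} (hq0 : 0 < q) (hq1 : q < 1)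
    (hK : 0 ≤ K) (h : ∀ y ∈ Ioc 0 ℓ, ∀ x, q * y ≤ x → x ≤ y → φ x ≤ K * φ y) (n : ℕ) :
    ∀ y ∈ Ioc 0 ℓ, ∀ x, q ^ n * y ≤ x → x ≤ y → φ x ≤ (K + 1) ^ n * φ y := by
  have hW' : ClassW ℓ (fun x => (φ x)⁻¹) :=
    ⟨hW.1.inv₀ fun x hx => (hW.2 x hx).ne', fun x hx => inv_pos.2 (hW.2 x hx)⟩
  intro y hy x h1 h2
  have hx0 : 0 < x := lt_of_lt_of_le (mul_pos (pow_pos hq0 _) hy.1) h1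
  have hφx := hW.2 x ⟨hx0, h2.trans hy.2⟩
  have hφy := hW.2 y hy
  have := Doubling.iterate hW' hq0 hq1 hK (fun y hy x h1 h2 => by
    have hx0 : 0 < x := lt_of_lt_of_le (mul_pos hq0 hy.1) h1
    have hφx := hW.2 x ⟨hx0, h2.trans hy.2⟩
    have hφy := hW.2 y hy
    rw [← div_eq_mul_inv, le_div_iff₀ hφx, inv_mul_le_iff₀ hφy, mul_comm]
    exact h y hy x h1 h2) n y hy x h1 h2
  rwa [← div_eq_mul_inv, le_div_iff₀ hφx, inv_mul_le_iff₀ hφy, mul_comm] at this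

theorem Doubling.comparable {ℓ : ℝ} {φ : ℝ → ℝ} (hW : ClassW ℓ φ) (hD : Doubling ℓ φ) {η : ℝ}
    (hη : 0 < η) : ∃ K : ℝ, 1 ≤ K ∧ ∀ y ∈ Ioc 0 ℓ, ∀ x, η * y ≤ x → x ≤ y →
      φ x ≤ K * φ y ∧ φ y ≤ K * φ x := by
  obtain ⟨K, hK, h⟩ := hD
  obtain ⟨n, hn⟩ := exists_pow_lt_of_lt_one hη (by norm_num : (1 / 2 : ℝ) < 1)
  refine ⟨(K + 1) ^ n, one_le_pow₀ (by linarith), fun y hy x h1 h2 => ⟨?_, ?_⟩⟩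
  · exact Doubling.iterate' hW (by norm_num) (by norm_num) (by linarith)
      (fun y hy x h1 h2 => (h y hy x (by linarith) h2).1) n y hy x
      ((mul_le_mul_of_nonneg_right hn.le hy.1.le).trans h1) h2
  · exact Doubling.iterate hW (by norm_num) (by norm_num) (by linarith)
      (fun y hy x h1 h2 => (h y hy x (by linarith) h2).2) n y hy x
      ((mul_le_mul_of_nonneg_right hn.le hy.1.le).trans h1) h2

/-- V₊₊ bounds the difference by the value at the larger point y. This gives φ(x) ≤ (1 + C) φ(y) at
once. In the other direction the difference can be absorbed only when y - x is a small fraction of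
y, so the ratio 1/2 is reached by iterating short steps. -/
theorem ClassVpp.doubling {ℓ : ℝ} {φ : ℝ → ℝ} (h : ClassVpp ℓ φ) : Doubling ℓ φ := by
  obtain ⟨hW, C, hC, h⟩ := h
  have key : ∀ y ∈ Ioc 0 ℓ, ∀ x, 0 < x → x ≤ y → |φ y - φ x| ≤ C * (φ y / y) * (y - x) := by
    intro y hy x hx hxy
    rcases eq_or_lt_of_le hxy with rfl | hlt
    · simp
    have := h y hy x ⟨hx, hxy.trans hy.2⟩ hlt.ne'
    rwa [max_eq_left hxy, abs_div, abs_of_pos (sub_pos.2 hlt), div_le_iff₀ (sub_pos.2 hlt)] at this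
  -- With this q one has C (1 - q) ≤ 1/2, so over one step the difference is at most φ(y)/2.
  set q : ℝ := 1 - 1 / (2 * (C + 1)) with hq
  have hq2 : 1 / (2 * (C + 1)) < 1 := by rw [div_lt_one (by positivity)]; linarith
  have hq3 : 0 < 1 / (2 * (C + 1)) := by positivity
  have hq0 : 0 < q := by linarith
  have hq1 : q < 1 := by linarith
  obtain ⟨n, hn⟩ := exists_pow_lt_of_lt_one (by norm_num : (0 : ℝ) < 1 / 2) hq1
  have hstep : ∀ y ∈ Ioc 0 ℓ, ∀ x, q * y ≤ x → x ≤ y → φ y ≤ 2 * φ x := by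
    intro y hy x h1 h2
    have hy0 := hy.1
    have hφy := hW.2 y hy
    have h3 := (abs_le.1 (key y hy x (lt_of_lt_of_le (by positivity) h1) h2)).2
    have h4 : y - x ≤ 1 / (2 * (C + 1)) * y := by rw [hq] at h1; linarith
    have h5 : C * (φ y / y) * (y - x) ≤ C * (φ y / y) * (1 / (2 * (C + 1)) * y) := by gcongr
    have h6 : C * (φ y / y) * (1 / (2 * (C + 1)) * y) = C / (C + 1) * (φ y / 2) := by
      field_simp
    have h7 : C / (C + 1) * (φ y / 2) ≤ 1 * (φ y / 2) := by
      gcongr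
      rw [div_le_one (by positivity)]; linarith
    linarith
  refine ⟨max (1 + C) ((2 + 1) ^ n), le_max_of_le_left (by linarith), fun y hy x h1 h2 => ?_⟩
  have hy0 := hy.1
  have hφy := hW.2 y hy
  have hφx := hW.2 x ⟨by linarith, h2.trans hy.2⟩
  constructor
  · refine le_trans ?_ (mul_le_mul_of_nonneg_right (le_max_left _ _) hφy.le)
    have h3 := (abs_le.1 (key y hy x (by linarith) h2)).1
    have h5 : C * (φ y / y) * (y - x) ≤ C * (φ y / y) * y := by gcongr; linarith
    have h6 : C * (φ y / y) * y = C * φ y := by field_simp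
    linarith
  · refine le_trans ?_ (mul_le_mul_of_nonneg_right (le_max_right _ _) hφx.le)
    exact Doubling.iterate hW hq0 hq1 (by norm_num) hstep n y hy x
      (le_trans (mul_le_mul_of_nonneg_right hn.le hy0.le) (by linarith)) h2

/-- V₋₊ bounds the difference by the value at the smaller point, which gives φ(y) ≤ (1 + C) φ(x).
The opposite inequality comes from the almost monotonicity of x^α φ(x). -/
theorem ClassVmp.doubling {ℓ : ℝ} {φ : ℝ → ℝ} (h : ClassVmp ℓ φ) (hT : ClassWTilde ℓ φ) :
    Doubling ℓ φ := by
  obtain ⟨hW, C, hC, h⟩ := h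
  obtain ⟨-, α, hα, -, -, D, hD, hT⟩ := hT
  refine ⟨max (1 + C) (D * 2 ^ α), le_max_of_le_left (by linarith), fun y hy x h1 h2 => ?_⟩
  have hy0 := hy.1
  have hx0 : 0 < x := by linarith
  have hφy := hW.2 y hy
  have hφx := hW.2 x ⟨hx0, h2.trans hy.2⟩
  constructor
  · refine le_trans ?_ (mul_le_mul_of_nonneg_right (le_max_right _ _) hφy.le)
    have h3 := hT x ⟨hx0, h2.trans hy.2⟩ y hy h2
    have h4 : y ^ α ≤ 2 ^ α * x ^ α := by
      rw [← Real.mul_rpow (by norm_num) hx0.le]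
      exact Real.rpow_le_rpow hy0.le (by linarith) hα.le
    have hxα : 0 < x ^ α := by positivity
    have h5 : x ^ α * φ x ≤ x ^ α * (D * 2 ^ α * φ y) := by
      calc _ ≤ D * (y ^ α * φ y) := h3
        _ ≤ D * ((2 ^ α * x ^ α) * φ y) := by gcongr
        _ = _ := by ring
    exact le_of_mul_le_mul_left h5 hxα
  · refine le_trans ?_ (mul_le_mul_of_nonneg_right (le_max_left _ _) hφx.le)
    rcases eq_or_lt_of_le h2 with rfl | hlt
    · nlinarith
    have h3 := h y hy x ⟨hx0, h2.trans hy.2⟩ hlt.ne'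
    rw [min_eq_right h2, max_eq_left h2, abs_div, abs_of_pos (sub_pos.2 hlt),
      div_le_iff₀ (sub_pos.2 hlt)] at h3
    have h4 := (abs_le.1 h3).2
    have h5 : C * (φ x / y) * (y - x) ≤ C * (φ x / y) * y := by gcongr; linarith
    have h6 : C * (φ x / y) * y = C * φ x := by field_simp
    linarith

theorem doubling_of_classV {ℓ : ℝ} {φ : ℝ → ℝ} (hT : ClassWTilde ℓ φ)
    (h : ClassVpp ℓ φ ∨ ClassVmp ℓ φ) : Doubling ℓ φ :=
  h.elim (fun h => h.doubling) fun h => h.doubling hT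

/-- Either of the `V` conditions gives a Lipschitz estimate at comparable points. -/
theorem lipschitz_of_classV {ℓ : ℝ} {φ : ℝ → ℝ} (hT : ClassWTilde ℓ φ)
    (h : ClassVpp ℓ φ ∨ ClassVmp ℓ φ) : ∃ C : ℝ, 0 < C ∧ ∀ x ∈ Ioc 0 ℓ, ∀ y ∈ Ioc 0 ℓ,
      x / 2 ≤ y → y ≤ 2 * x → |φ x - φ y| ≤ C * φ y * (|x - y| / x) := by
  obtain ⟨K, hK, hD⟩ := doubling_of_classV hT h
  -- Both V conditions imply this symmetric form: the value of φ at the larger or smaller point is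
  -- at most the sum of both values, and max x y ≥ x.
  have hV : ∃ C : ℝ, 0 < C ∧ ∀ x ∈ Ioc 0 ℓ, ∀ y ∈ Ioc 0 ℓ, x ≠ y →
      |φ x - φ y| ≤ C * (φ x + φ y) * (|x - y| / x) := by
    rcases h with ⟨hW, C, hC, h⟩ | ⟨hW, C, hC, h⟩
    all_goals
      refine ⟨C, hC, fun x hx y hy hne => ?_⟩
      have h1 := h x hx y hy hne
      have hpos : 0 < |x - y| := abs_pos.2 (sub_ne_zero.2 hne)
      rw [abs_div, div_le_iff₀ hpos] at h1
      refine h1.trans ?_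
      have hφx := hW.2 x hx
      have hφy := hW.2 y hy
      have hx0 := hx.1
      have hy0 := hy.1
      rw [mul_assoc, mul_assoc, mul_div_assoc', div_mul_eq_mul_div]
      gcongr
      · rcases le_total x y with hxy | hxy <;> simp [hxy] <;> linarith
      · exact le_max_left _ _
  obtain ⟨C, hC, hV⟩ := hV
  have hW := hT.1
  refine ⟨C * (K + 1), by positivity, fun x hx y hy h1 h2 => ?_⟩
  have hφx := hW.2 x hx
  have hφy := hW.2 y hy
  have hx0 := hx.1
  rcases eq_or_ne x y with rfl | hne
  · simp
  refine (hV x hx y hy hne).trans ?_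
  have : φ x ≤ K * φ y := by
    rcases le_total x y with hxy | hxy
    · exact (hD y hy x (by linarith) hxy).1
    · exact (hD x hx y h1 hxy).2
  have h3 : φ x + φ y ≤ (K + 1) * φ y := by linarith
  calc _ ≤ C * ((K + 1) * φ y) * (|x - y| / x) := by gcongr
    _ = _ := by ring

/-- Multiplication by h₀/ℓ carries (0, ℓ] onto (0, h₀] and keeps the ratio x/y, while doubling makes
the values of φ before and after comparable. -/
theorem powerUpper_of_near_zero {ℓ b : ℝ} {φ : ℝ → ℝ} (hW : ClassW ℓ φ) (hD : Doubling ℓ φ)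
    {h₀ C : ℝ} (hC : 0 ≤ C) (h0 : 0 < h₀) (h0ℓ : h₀ ≤ ℓ)
    (h : ∀ x y, 0 < x → x ≤ y → y ≤ h₀ → φ x ≤ C * (x / y) ^ b * φ y) : PowerUpper ℓ b φ := by
  have hℓ : 0 < ℓ := h0.trans_le h0ℓ
  set η := h₀ / ℓ with hη
  have hη0 : 0 < η := by positivity
  have hη1 : η ≤ 1 := (div_le_one hℓ).2 h0ℓ
  obtain ⟨K, hK, hc⟩ := hD.comparable hW hη0
  refine ⟨K * (C + 1) * K, by positivity, fun x y hx hxy hy => ?_⟩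
  have hy0 := hx.trans_le hxy
  have hφy := hW.2 y ⟨hy0, hy⟩
  have h1 := (hc x ⟨hx, hxy.trans hy⟩ (η * x) le_rfl (mul_le_of_le_one_left hx.le hη1)).2
  have h2 := h (η * x) (η * y) (by positivity) (by gcongr) (by
    calc η * y ≤ η * ℓ := by gcongr
      _ = h₀ := by rw [hη]; field_simp)
  have h3 := (hc y ⟨hy0, hy⟩ (η * y) le_rfl (mul_le_of_le_one_left hy0.le hη1)).1
  rw [mul_div_mul_left _ _ hη0.ne'] at h2
  calc φ x ≤ K * φ (η * x) := h1
    _ ≤ K * (C * (x / y) ^ b * φ (η * y)) := by gcongr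
    _ ≤ K * (C * (x / y) ^ b * (K * φ y)) := by gcongr
    _ ≤ K * ((C + 1) * (x / y) ^ b * (K * φ y)) := by gcongr; linarith
    _ = _ := by ring

theorem powerLower_of_near_zero {ℓ b : ℝ} {φ : ℝ → ℝ} (hW : ClassW ℓ φ) (hD : Doubling ℓ φ)
    {h₀ C : ℝ} (hC : 0 ≤ C) (h0 : 0 < h₀) (h0ℓ : h₀ ≤ ℓ)
    (h : ∀ x y, 0 < x → x ≤ y → y ≤ h₀ → φ y ≤ C * (y / x) ^ b * φ x) : PowerLower ℓ b φ := by
  have hℓ : 0 < ℓ := h0.trans_le h0ℓ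
  set η := h₀ / ℓ with hη
  have hη0 : 0 < η := by positivity
  have hη1 : η ≤ 1 := (div_le_one hℓ).2 h0ℓ
  obtain ⟨K, hK, hc⟩ := hD.comparable hW hη0
  refine ⟨K * (C + 1) * K, by positivity, fun x y hx hxy hy => ?_⟩
  have hy0 := hx.trans_le hxy
  have hφx := hW.2 x ⟨hx, hxy.trans hy⟩
  have h1 := (hc x ⟨hx, hxy.trans hy⟩ (η * x) le_rfl (mul_le_of_le_one_left hx.le hη1)).1
  have h2 := h (η * x) (η * y) (by positivity) (by gcongr) (by
    calc η * y ≤ η * ℓ := by gcongr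
      _ = h₀ := by rw [hη]; field_simp)
  have h3 := (hc y ⟨hy0, hy⟩ (η * y) le_rfl (mul_le_of_le_one_left hy0.le hη1)).2
  rw [mul_div_mul_left _ _ hη0.ne'] at h2
  calc φ y ≤ K * φ (η * y) := h3
    _ ≤ K * (C * (y / x) ^ b * φ (η * x)) := by gcongr
    _ ≤ K * (C * (y / x) ^ b * (K * φ x)) := by gcongr
    _ ≤ K * ((C + 1) * (y / x) ^ b * (K * φ x)) := by gcongr; linarith
    _ = _ := by ring

/-! ### Zygmund conditions and power estimates -/

/-- Iteration gives F(y 2^(-n)) ≤ κ^n F(y), and monotonicity of F covers the points between dyadic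
ones at the cost of a factor κ⁻¹. Since κ = 2^(-ε) for ε = -log₂ κ, this is power decay. -/
theorem rpow_decay_of_halving {ℓ κ : ℝ} {F : ℝ → ℝ} (hκ0 : 0 < κ)
    (hF0 : ∀ h ∈ Ioc 0 ℓ, 0 ≤ F h) (hmono : ∀ x y, 0 < x → x ≤ y → y ≤ ℓ → F x ≤ F y)
    (hF : ∀ h ∈ Ioc 0 ℓ, F (h / 2) ≤ κ * F h) :
    ∀ x y, 0 < x → x ≤ y → y ≤ ℓ → F x ≤ κ⁻¹ * (x / y) ^ (-Real.logb 2 κ) * F y ∨ 1 ≤ κ := by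
  intro x y hx hxy hy
  by_cases hκ1 : 1 ≤ κ
  · exact Or.inr hκ1
  left
  push Not at hκ1
  have hy0 := hx.trans_le hxy
  have hit : ∀ n : ℕ, F (y * (1 / 2) ^ n) ≤ κ ^ n * F y := by
    intro n
    induction n with
    | zero => simp
    | succ n ih =>
      have h1 := hF (y * (1 / 2) ^ n) ⟨by positivity,
        (mul_le_of_le_one_right hy0.le (pow_le_one₀ (by norm_num) (by norm_num))).trans hy⟩
      calc F (y * (1 / 2) ^ (n + 1)) = F (y * (1 / 2) ^ n / 2) := by congr 1; ring
        _ ≤ κ * F (y * (1 / 2) ^ n) := h1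
        _ ≤ κ * (κ ^ n * F y) := by gcongr
        _ = _ := by ring
  obtain ⟨n, hn1, hn2⟩ := exists_nat_pow_near_of_lt_one (x := x / y)
      (y := (1 / 2 : ℝ)) (by positivity) ((div_le_one hy0).2 hxy) (by norm_num) (by norm_num)
  have hFy := hF0 y ⟨hy0, hy⟩
  set ε := -Real.logb 2 κ with hε
  have hε0 : 0 < ε := by
    have := Real.logb_neg (b := 2) (by norm_num) hκ0 hκ1
    linarith
  have hκε : κ = (1 / 2 : ℝ) ^ ε := by
    rw [hε, Real.rpow_neg (by norm_num), one_div, Real.inv_rpow (by norm_num), inv_inv,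
      Real.rpow_logb (by norm_num) (by norm_num) hκ0]
  have hκn : κ ^ n ≤ κ⁻¹ * (x / y) ^ ε := by
    have h1 : κ ^ (n + 1) ≤ (x / y) ^ ε := by
      calc κ ^ (n + 1) = ((1 / 2 : ℝ) ^ (n + 1)) ^ ε := by
            rw [hκε, ← Real.rpow_natCast, ← Real.rpow_natCast, ← Real.rpow_mul (by norm_num),
              ← Real.rpow_mul (by norm_num), mul_comm]
        _ ≤ _ := Real.rpow_le_rpow (by positivity) hn1.le hε0.le
    rw [pow_succ] at h1
    rw [inv_mul_eq_div, le_div_iff₀ hκ0]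
    exact h1
  calc F x ≤ F (y * (1 / 2) ^ n) := by
        rw [div_le_iff₀ hy0] at hn2
        exact hmono _ _ hx (by linarith) ((mul_le_of_le_one_right hy0.le
          (pow_le_one₀ (by norm_num) (by norm_num))).trans hy)
    _ ≤ κ ^ n * F y := hit n
    _ ≤ _ := by gcongr

theorem rpow_decay_of_doubling {ℓ κ : ℝ} {F : ℝ → ℝ} (hκ0 : 0 < κ)
    (hF0 : ∀ h ∈ Ioc 0 ℓ, 0 ≤ F h) (hmono : ∀ x y, 0 < x → x ≤ y → y ≤ ℓ → F y ≤ F x)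
    (hF : ∀ h, 0 < h → 2 * h ≤ ℓ → F (2 * h) ≤ κ * F h) :
    ∀ x y, 0 < x → x ≤ y → y ≤ ℓ → F y ≤ κ⁻¹ * (x / y) ^ (-Real.logb 2 κ) * F x ∨ 1 ≤ κ := by
  intro x y hx hxy hy
  by_cases hκ1 : 1 ≤ κ
  · exact Or.inr hκ1
  left
  push Not at hκ1
  have hy0 := hx.trans_le hxy
  have hit : ∀ n : ℕ, x * 2 ^ n ≤ ℓ → F (x * 2 ^ n) ≤ κ ^ n * F x := by
    intro n
    induction n with
    | zero => simp
    | succ n ih =>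
      intro hn
      have e : x * 2 ^ (n + 1) = 2 * (x * 2 ^ n) := by ring
      have hp : 0 < x * 2 ^ n := by positivity
      have h1 := hF (x * 2 ^ n) hp (by rwa [← e])
      calc F (x * 2 ^ (n + 1)) = F (2 * (x * 2 ^ n)) := by rw [e]
        _ ≤ κ * F (x * 2 ^ n) := h1
        _ ≤ κ * (κ ^ n * F x) := by
          gcongr
          exact ih (by linarith)
        _ = _ := by ring
  obtain ⟨n, hn1, hn2⟩ := exists_nat_pow_near (x := y / x)
      (y := (2 : ℝ)) ((one_le_div hx).2 hxy) (by norm_num)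
  have hFx := hF0 x ⟨hx, hxy.trans hy⟩
  set ε := -Real.logb 2 κ with hε
  have hε0 : 0 < ε := by
    have := Real.logb_neg (b := 2) (by norm_num) hκ0 hκ1
    linarith
  have hκε : κ = (1 / 2 : ℝ) ^ ε := by
    rw [hε, Real.rpow_neg (by norm_num), one_div, Real.inv_rpow (by norm_num), inv_inv,
      Real.rpow_logb (by norm_num) (by norm_num) hκ0]
  have hκn : κ ^ n ≤ κ⁻¹ * (x / y) ^ ε := by
    have h1 : κ ^ (n + 1) ≤ (x / y) ^ ε := by
      calc κ ^ (n + 1) = ((1 / 2 : ℝ) ^ (n + 1)) ^ ε := by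
            rw [hκε, ← Real.rpow_natCast, ← Real.rpow_natCast, ← Real.rpow_mul (by norm_num),
              ← Real.rpow_mul (by norm_num), mul_comm]
        _ ≤ _ := by
          refine Real.rpow_le_rpow (by positivity) ?_ hε0.le
          rw [one_div, inv_pow, ← inv_div]
          exact inv_anti₀ (by positivity) hn2.le
    rw [pow_succ] at h1
    rw [inv_mul_eq_div, le_div_iff₀ hκ0]
    exact h1
  rw [le_div_iff₀ hx] at hn1
  calc F y ≤ F (x * 2 ^ n) := hmono _ _ (by positivity) (by linarith) hy
    _ ≤ κ ^ n * F x := hit n (by linarith)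
    _ ≤ _ := by gcongr

/-- The lower bound of the Zygmund integrals over one dyadic interval. -/
theorem exists_le_lintegral_dyadic {ℓ : ℝ} {φ : ℝ → ℝ} (hW : ClassW ℓ φ) (hD : Doubling ℓ φ)
    (β : ℝ) : ∃ c : ℝ, 0 < c ∧ ∀ h ∈ Ioc 0 ℓ,
      ENNReal.ofReal (c * (φ h / h ^ β)) ≤
        ∫⁻ x in Ioc (h / 2) h, ENNReal.ofReal (φ x / x ^ (1 + β)) := by
  obtain ⟨K, hK, hD⟩ := hD
  refine ⟨1 / (2 * K * 2 ^ |1 + β|), by positivity, fun h hh => ?_⟩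
  have hh0 := hh.1
  have hφh := hW.2 h hh
  have hlow : ∀ x ∈ Ioc (h / 2) h,
      ENNReal.ofReal (φ h / (K * 2 ^ |1 + β| * h ^ (1 + β))) ≤
        ENNReal.ofReal (φ x / x ^ (1 + β)) := by
    intro x hx
    have hx0 : 0 < x := by linarith [hx.1]
    have hφx := hW.2 x ⟨hx0, hx.2.trans hh.2⟩
    apply ENNReal.ofReal_le_ofReal
    have h1 := (hD h hh x hx.1.le hx.2).2
    have h2 := rpow_neg_le_of_mem_shell (-(1 + β)) hh0 hx.1.le hx.2
    rw [neg_neg, abs_neg] at h2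
    rw [div_le_div_iff₀ (by positivity) (by positivity)]
    calc φ h * x ^ (1 + β) ≤ (K * φ x) * (2 ^ |1 + β| * h ^ (1 + β)) := by gcongr
      _ = _ := by ring
  calc ENNReal.ofReal (1 / (2 * K * 2 ^ |1 + β|) * (φ h / h ^ β))
      = ENNReal.ofReal (φ h / (K * 2 ^ |1 + β| * h ^ (1 + β))) * volume (Ioc (h / 2) h) := by
        rw [Real.volume_Ioc, ← ENNReal.ofReal_mul (by positivity), Real.rpow_add hh0,
          Real.rpow_one]
        congr 1
        field_simp
        ring
    _ = ∫⁻ x in Ioc (h / 2) h, ENNReal.ofReal (φ h / (K * 2 ^ |1 + β| * h ^ (1 + β))) := by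
        rw [setLIntegral_const]
    _ ≤ _ := setLIntegral_mono' measurableSet_Ioc hlow

/-- Let F(h) be the Zygmund integral over (0, h] and ψ(h) = φ(h)/h^β. The hypothesis says F ≤ cψ,
while doubling gives F(h) - F(h/2) ≥ dψ(h). Hence F(h/2) ≤ (1 - d/c) F(h), so F decays like a power;
as F is comparable with ψ, so does ψ up to a constant. -/
theorem ZygmundUpper.powerUpper {ℓ β : ℝ} {φ : ℝ → ℝ} (hW : ClassW ℓ φ) (hD : Doubling ℓ φ)
    (h : ZygmundUpper ℓ β φ) : ∃ ε > 0, PowerUpper ℓ (β + ε) φ := by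
  obtain ⟨c, hc, hZ⟩ := h
  obtain ⟨d, hd, hL⟩ := exists_le_lintegral_dyadic hW hD β
  set F : ℝ → ℝ := fun h => (∫⁻ x in Ioc 0 h, ENNReal.ofReal (φ x / x ^ (1 + β))).toReal with hF
  have hψ : ∀ h ∈ Ioc 0 ℓ, 0 < φ h / h ^ β := fun h hh =>
    div_pos (hW.2 h hh) (Real.rpow_pos_of_pos hh.1 _)
  have hfin : ∀ h ∈ Ioc 0 ℓ, ∫⁻ x in Ioc 0 h, ENNReal.ofReal (φ x / x ^ (1 + β)) ≠ ∞ :=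
    fun h hh => ne_top_of_le_ne_top ENNReal.ofReal_ne_top (hZ h hh)
  have hup : ∀ h ∈ Ioc 0 ℓ, F h ≤ c * (φ h / h ^ β) := fun h hh =>
    ENNReal.toReal_le_of_le_ofReal (mul_nonneg hc.le (hψ h hh).le) (hZ h hh)
  have hsplit : ∀ h ∈ Ioc 0 ℓ, F (h / 2) + d * (φ h / h ^ β) ≤ F h := by
    intro h hh
    have hh2 : h / 2 ∈ Ioc 0 ℓ := ⟨by linarith [hh.1], by linarith [hh.1, hh.2]⟩
    have hu : Ioc 0 h = Ioc 0 (h / 2) ∪ Ioc (h / 2) h :=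
      (Ioc_union_Ioc_eq_Ioc hh2.1.le (by linarith [hh.1])).symm
    have e : ∫⁻ x in Ioc 0 h, ENNReal.ofReal (φ x / x ^ (1 + β)) =
        (∫⁻ x in Ioc 0 (h / 2), ENNReal.ofReal (φ x / x ^ (1 + β))) +
          ∫⁻ x in Ioc (h / 2) h, ENNReal.ofReal (φ x / x ^ (1 + β)) := by
      rw [hu, lintegral_union measurableSet_Ioc
        (Ioc_disjoint_Ioc_of_le le_rfl)]
    have h1 := hfin h hh
    rw [e] at h1
    rw [hF]
    simp only
    rw [e, ENNReal.toReal_add (fun h' => h1 (by simp [h'])) (fun h' => h1 (by simp [h']))]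
    gcongr
    rw [← ENNReal.toReal_ofReal (mul_nonneg hd.le (hψ h hh).le)]
    exact ENNReal.toReal_mono (fun h' => h1 (by simp [h'])) (hL h hh)
  have hF0 : ∀ h, 0 ≤ F h := fun h => ENNReal.toReal_nonneg
  have hmono : ∀ x y, 0 < x → x ≤ y → y ≤ ℓ → F x ≤ F y := fun x y hx hxy hy =>
    ENNReal.toReal_mono (hfin y ⟨hx.trans_le hxy, hy⟩)
      (lintegral_mono_set (Ioc_subset_Ioc_right hxy))
  -- The maximum with 1/2 keeps κ positive, as the logarithm requires.
  set κ := max (1 - d / c) (1 / 2) with hκ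
  have hκ0 : 0 < κ := lt_max_of_lt_right (by norm_num)
  have hκ1 : κ < 1 := max_lt (by have : 0 < d / c := by positivity
                                 linarith) (by norm_num)
  have hstep : ∀ h ∈ Ioc 0 ℓ, F (h / 2) ≤ κ * F h := by
    intro h hh
    have h1 := hsplit h hh
    have h2 := hup h hh
    have h3 : d / c * F h ≤ d * (φ h / h ^ β) := by
      calc d / c * F h ≤ d / c * (c * (φ h / h ^ β)) := by gcongr
        _ = _ := by field_simp
    calc F (h / 2) ≤ (1 - d / c) * F h := by linarith
      _ ≤ κ * F h := mul_le_mul_of_nonneg_right (le_max_left _ _) (hF0 h)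
  have hdec := rpow_decay_of_halving hκ0 (fun h _ => hF0 h) hmono hstep
  refine ⟨-Real.logb 2 κ, by linarith [Real.logb_neg (b := 2) (by norm_num) hκ0 hκ1],
    κ⁻¹ * c / d, by positivity, fun x y hx hxy hy => ?_⟩
  have h1 := (hdec x y hx hxy hy).resolve_right (by linarith)
  have hy0 := hx.trans_le hxy
  have h2 := hup y ⟨hy0, hy⟩
  have h3 := hsplit x ⟨hx, hxy.trans hy⟩
  have h4 : d * (φ x / x ^ β) ≤ κ⁻¹ * (x / y) ^ (-Real.logb 2 κ) * (c * (φ y / y ^ β)) := by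
    calc d * (φ x / x ^ β) ≤ F x := by linarith [hF0 (x / 2)]
      _ ≤ _ := h1
      _ ≤ _ := by gcongr
  have hxβ : 0 < x ^ β := by positivity
  rw [Real.rpow_add (by positivity), Real.div_rpow hx.le hy0.le β]
  calc φ x = d * (φ x / x ^ β) * (x ^ β / d) := by field_simp
    _ ≤ κ⁻¹ * (x / y) ^ (-Real.logb 2 κ) * (c * (φ y / y ^ β)) * (x ^ β / d) := by gcongr
    _ = _ := by ring

/-- The same self-improvement for the tail integral over (h, ℓ]. This integral vanishes at h = ℓ, so
it dominates φ(h)/h^γ only where 2h ≤ ℓ; the estimate is obtained on (0, ℓ/2] and extended by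
doubling. -/
theorem ZygmundLower.powerLower {ℓ γ : ℝ} {φ : ℝ → ℝ} (hℓ : 0 < ℓ) (hW : ClassW ℓ φ)
    (hD : Doubling ℓ φ) (h : ZygmundLower ℓ γ φ) : ∃ ε > 0, PowerLower ℓ (γ - ε) φ := by
  obtain ⟨c, hc, hZ⟩ := h
  obtain ⟨d, hd, hL⟩ := exists_le_lintegral_dyadic hW hD γ
  set F : ℝ → ℝ := fun h => (∫⁻ x in Ioc h ℓ, ENNReal.ofReal (φ x / x ^ (1 + γ))).toReal with hF
  have hψ : ∀ h ∈ Ioc 0 ℓ, 0 < φ h / h ^ γ := fun h hh =>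
    div_pos (hW.2 h hh) (Real.rpow_pos_of_pos hh.1 _)
  have hfin : ∀ h ∈ Ioc 0 ℓ, ∫⁻ x in Ioc h ℓ, ENNReal.ofReal (φ x / x ^ (1 + γ)) ≠ ∞ :=
    fun h hh => ne_top_of_le_ne_top ENNReal.ofReal_ne_top (hZ h hh)
  have hup : ∀ h ∈ Ioc 0 ℓ, F h ≤ c * (φ h / h ^ γ) := fun h hh =>
    ENNReal.toReal_le_of_le_ofReal (mul_nonneg hc.le (hψ h hh).le) (hZ h hh)
  obtain ⟨K, hK, hDK⟩ := id hD
  set d' := d / (K * 2 ^ |γ|) with hd'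
  have hd0 : 0 < d' := by positivity
  -- The dyadic lower bound refers to the right endpoint 2h of (h, 2h]; this moves it to h.
  have hcmp : ∀ h, 0 < h → 2 * h ≤ ℓ → φ h / h ^ γ ≤ K * 2 ^ |γ| * (φ (2 * h) / (2 * h) ^ γ) := by
    intro h h0 h2
    have h1 := (hDK (2 * h) ⟨by linarith, h2⟩ h (by linarith) (by linarith)).1
    have h3 := rpow_neg_le_of_mem_shell γ (R := 2 * h) (T := h) (by linarith) (by linarith)
      (by linarith)
    rw [Real.rpow_neg h0.le, Real.rpow_neg (by linarith)] at h3
    have := hW.2 (2 * h) ⟨by linarith, h2⟩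
    rw [div_eq_mul_inv, div_eq_mul_inv]
    calc φ h * (h ^ γ)⁻¹ ≤ (K * φ (2 * h)) * (2 ^ |γ| * ((2 * h) ^ γ)⁻¹) := by gcongr
      _ = _ := by ring
  have hsplit : ∀ h, 0 < h → 2 * h ≤ ℓ → F (2 * h) + d' * (φ h / h ^ γ) ≤ F h := by
    intro h h0 h2
    have hu : Ioc h ℓ = Ioc h (2 * h) ∪ Ioc (2 * h) ℓ :=
      (Ioc_union_Ioc_eq_Ioc (by linarith) h2).symm
    have e : ∫⁻ x in Ioc h ℓ, ENNReal.ofReal (φ x / x ^ (1 + γ)) =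
        (∫⁻ x in Ioc h (2 * h), ENNReal.ofReal (φ x / x ^ (1 + γ))) +
          ∫⁻ x in Ioc (2 * h) ℓ, ENNReal.ofReal (φ x / x ^ (1 + γ)) := by
      rw [hu, lintegral_union measurableSet_Ioc (Ioc_disjoint_Ioc_of_le le_rfl)]
    have h1 := hfin h ⟨h0, by linarith⟩
    rw [e] at h1
    have hmem : 2 * h ∈ Ioc 0 ℓ := ⟨by linarith, h2⟩
    have h3 := hL (2 * h) hmem
    rw [mul_div_cancel_left₀ h (by norm_num : (2 : ℝ) ≠ 0)] at h3
    rw [hF]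
    simp only
    rw [e, ENNReal.toReal_add (fun h' => h1 (by simp [h'])) (fun h' => h1 (by simp [h'])), add_comm]
    gcongr
    calc d' * (φ h / h ^ γ) ≤ d' * (K * 2 ^ |γ| * (φ (2 * h) / (2 * h) ^ γ)) := by
          gcongr; exact hcmp h h0 h2
      _ = d * (φ (2 * h) / (2 * h) ^ γ) := by rw [hd']; field_simp
      _ = _ := (ENNReal.toReal_ofReal (mul_nonneg hd.le (hψ _ hmem).le)).symm
      _ ≤ _ := ENNReal.toReal_mono (fun h' => h1 (by simp [h'])) h3
  have hF0 : ∀ h, 0 ≤ F h := fun h => ENNReal.toReal_nonneg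
  have hmono : ∀ x y, 0 < x → x ≤ y → y ≤ ℓ → F y ≤ F x := fun x y hx hxy hy =>
    ENNReal.toReal_mono (hfin x ⟨hx, hxy.trans hy⟩)
      (lintegral_mono_set (Ioc_subset_Ioc_left hxy))
  set κ := max (1 - d' / c) (1 / 2) with hκ
  have hκ0 : 0 < κ := lt_max_of_lt_right (by norm_num)
  have hκ1 : κ < 1 := max_lt (by have : 0 < d' / c := by positivity
                                 linarith) (by norm_num)
  have hstep : ∀ h, 0 < h → 2 * h ≤ ℓ → F (2 * h) ≤ κ * F h := by
    intro h h0 hh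
    have h1 := hsplit h h0 hh
    have h2 := hup h ⟨h0, by linarith⟩
    have h3 : d' / c * F h ≤ d' * (φ h / h ^ γ) := by
      calc d' / c * F h ≤ d' / c * (c * (φ h / h ^ γ)) := by gcongr
        _ = _ := by field_simp
    calc F (2 * h) ≤ (1 - d' / c) * F h := by linarith
      _ ≤ κ * F h := mul_le_mul_of_nonneg_right (le_max_left _ _) (hF0 h)
  have hdec := rpow_decay_of_doubling hκ0 (fun h _ => hF0 h) hmono hstep
  refine ⟨-Real.logb 2 κ, by linarith [Real.logb_neg (b := 2) (by norm_num) hκ0 hκ1],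
    powerLower_of_near_zero hW hD (h₀ := ℓ / 2) (C := κ⁻¹ * c / d') (by positivity) (by linarith)
      (by linarith) fun x y hx hxy hy => ?_⟩
  have h1 := (hdec x y hx hxy (by linarith)).resolve_right (by linarith)
  have hy0 := hx.trans_le hxy
  have h2 := hup x ⟨hx, by linarith⟩
  have h3 := hsplit y hy0 (by linarith)
  have h4 : d' * (φ y / y ^ γ) ≤ κ⁻¹ * (x / y) ^ (-Real.logb 2 κ) * (c * (φ x / x ^ γ)) := by
    calc d' * (φ y / y ^ γ) ≤ F y := by linarith [hF0 (2 * y)]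
      _ ≤ _ := h1
      _ ≤ _ := by gcongr
  have hyγ : 0 < y ^ γ := by positivity
  rw [Real.rpow_sub (by positivity), Real.div_rpow hy0.le hx.le γ,
    ← inv_div x y, Real.inv_rpow (by positivity), div_inv_eq_mul]
  calc φ y = d' * (φ y / y ^ γ) * (y ^ γ / d') := by field_simp
    _ ≤ κ⁻¹ * (x / y) ^ (-Real.logb 2 κ) * (c * (φ x / x ^ γ)) * (y ^ γ / d') := by gcongr
    _ = _ := by ring

/-- The integrand is at most a constant times φ(y) y^(-β-ε) x^(ε-1), and ε > 0 makes this integrable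
at 0. -/
theorem PowerUpper.zygmundUpper {ℓ β ε : ℝ} {φ : ℝ → ℝ} (hε : 0 < ε) (hW : ClassW ℓ φ)
    (h : PowerUpper ℓ (β + ε) φ) : ZygmundUpper ℓ β φ := by
  obtain ⟨C, hC, h⟩ := h
  obtain ⟨D, hD⟩ := lintegral_inner_of_growth (s := 1) (a := 1 - ε) (by linarith)
  refine ⟨C * (D * 2 + 1), by positivity, fun y hy => ?_⟩
  have hy0 := hy.1
  have hφy := hW.2 y hy
  have key := hD volume 0 2 (fun R _ => volume_closedBall_growth 0 R) y hy.1
  simp only [sub_zero] at key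
  have hpt : ∀ x ∈ Ioc 0 y, ENNReal.ofReal (φ x / x ^ (1 + β)) ≤
      ENNReal.ofReal (C * φ y / y ^ (β + ε)) * ENNReal.ofReal (|x| ^ (-(1 - ε))) := by
    intro x hx
    have hx0 := hx.1
    rw [← ENNReal.ofReal_mul (by positivity), abs_of_pos hx0]
    apply ENNReal.ofReal_le_ofReal
    rw [div_le_iff₀ (by positivity)]
    refine (h x y hx0 hx.2 hy.2).trans (le_of_eq ?_)
    rw [mul_assoc (_ / _), ← Real.rpow_add hx0, Real.div_rpow hx0.le hy0.le]
    have : -(1 - ε) + (1 + β) = β + ε := by ring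
    rw [this]
    ring
  calc _ ≤ ∫⁻ x in Ioc 0 y, ENNReal.ofReal (C * φ y / y ^ (β + ε)) *
        ENNReal.ofReal (|x| ^ (-(1 - ε))) := setLIntegral_mono' measurableSet_Ioc hpt
    _ = ENNReal.ofReal (C * φ y / y ^ (β + ε)) *
        ∫⁻ x in Ioc 0 y, ENNReal.ofReal (|x| ^ (-(1 - ε))) :=
      lintegral_const_mul' _ _ ENNReal.ofReal_ne_top
    _ ≤ ENNReal.ofReal (C * φ y / y ^ (β + ε)) * (D * 2 * ENNReal.ofReal (y ^ (1 - (1 - ε)))) := by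
      gcongr
      refine le_trans (lintegral_mono_set fun x hx => ?_) key
      exact ⟨abs_pos.2 hx.1.ne', by rw [abs_of_pos hx.1]; exact hx.2⟩
    _ = ENNReal.ofReal (C * φ y / y ^ (β + ε) * (D * 2 * y ^ (1 - (1 - ε)))) := by
      rw [ENNReal.ofReal_mul (by positivity), ENNReal.ofReal_mul (by positivity),
        ENNReal.ofReal_mul (by positivity)]
      simp
    _ ≤ _ := by
      apply ENNReal.ofReal_le_ofReal
      rw [sub_sub_cancel, Real.rpow_add hy0]
      have e : C * φ y / (y ^ β * y ^ ε) * (D * 2 * y ^ ε) = C * (D * 2) * (φ y / y ^ β) := by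
        field_simp
      rw [e]
      gcongr
      linarith

theorem PowerLower.zygmundLower {ℓ γ ε : ℝ} {φ : ℝ → ℝ} (hε : 0 < ε) (hW : ClassW ℓ φ)
    (h : PowerLower ℓ (γ - ε) φ) : ZygmundLower ℓ γ φ := by
  obtain ⟨C, hC, h⟩ := h
  obtain ⟨D, hD⟩ := lintegral_outer_of_growth (s := 1) (a := 1 + ε) (by linarith)
  refine ⟨C * (D * 2 + 1), by positivity, fun y hy => ?_⟩
  have hy0 := hy.1
  have hφy := hW.2 y hy
  have key := hD volume 0 2 (fun R _ => volume_closedBall_growth 0 R) y hy.1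
  simp only [sub_zero] at key
  have hpt : ∀ x ∈ Ioc y ℓ, ENNReal.ofReal (φ x / x ^ (1 + γ)) ≤
      ENNReal.ofReal (C * φ y / y ^ (γ - ε)) * ENNReal.ofReal (|x| ^ (-(1 + ε))) := by
    intro x hx
    have hx0 := hy0.trans hx.1
    rw [← ENNReal.ofReal_mul (by positivity), abs_of_pos hx0]
    apply ENNReal.ofReal_le_ofReal
    rw [div_le_iff₀ (by positivity)]
    refine (h y x hy0 hx.1.le hx.2).trans (le_of_eq ?_)
    rw [mul_assoc (_ / _), ← Real.rpow_add hx0, Real.div_rpow hx0.le hy0.le]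
    have : -(1 + ε) + (1 + γ) = γ - ε := by ring
    rw [this]
    ring
  calc _ ≤ ∫⁻ x in Ioc y ℓ, ENNReal.ofReal (C * φ y / y ^ (γ - ε)) *
        ENNReal.ofReal (|x| ^ (-(1 + ε))) := setLIntegral_mono' measurableSet_Ioc hpt
    _ = ENNReal.ofReal (C * φ y / y ^ (γ - ε)) *
        ∫⁻ x in Ioc y ℓ, ENNReal.ofReal (|x| ^ (-(1 + ε))) :=
      lintegral_const_mul' _ _ ENNReal.ofReal_ne_top
    _ ≤ ENNReal.ofReal (C * φ y / y ^ (γ - ε)) * (D * 2 * ENNReal.ofReal (y ^ (1 - (1 + ε)))) := by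
      gcongr
      refine le_trans (lintegral_mono_set fun x hx => ?_) key
      exact hx.1.le.trans (le_abs_self x)
    _ = ENNReal.ofReal (C * φ y / y ^ (γ - ε) * (D * 2 * y ^ (1 - (1 + ε)))) := by
      rw [ENNReal.ofReal_mul (by positivity), ENNReal.ofReal_mul (by positivity),
        ENNReal.ofReal_mul (by positivity)]
      simp
    _ ≤ _ := by
      apply ENNReal.ofReal_le_ofReal
      have : 1 - (1 + ε) = -ε := by ring
      rw [this, Real.rpow_sub hy0, Real.rpow_neg hy0.le]
      have e : C * φ y / (y ^ γ / y ^ ε) * (D * 2 * (y ^ ε)⁻¹) = C * (D * 2) * (φ y / y ^ γ) := by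
        field_simp
      rw [e]
      gcongr
      linarith

/-! ### Matuszewska-Orlicz indices and power estimates -/

/-- With c in this form, comparing an index quotient with c becomes comparing `upperRatio φ x` with
x^c. The order is reversed for x < 1, where log x is negative. -/
theorem coe_eq_log_div {x : ℝ} (hx : 0 < x) (hx1 : x ≠ 1) (c : ℝ) :
    (c : EReal) = ENNReal.log (ENNReal.ofReal (x ^ c)) / ((Real.log x : ℝ) : EReal) := by
  have hl : Real.log x ≠ 0 := Real.log_ne_zero_of_pos_of_ne_one hx hx1
  rw [ENNReal.log_ofReal_of_pos (by positivity), Real.log_rpow hx, ← EReal.coe_div]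
  congr 1
  field_simp

/-- `limsup_{h → 0+} φ(hx) / φ(h)`. -/
def upperRatio (φ : ℝ → ℝ) (x : ℝ) : ℝ≥0∞ :=
  limsup (fun h : ℝ => ENNReal.ofReal (φ (h * x) / φ h)) (𝓝[>] 0)

theorem lt_indexQuotient_iff {φ : ℝ → ℝ} {x : ℝ} (hx : 0 < x) (hx1 : x < 1) (c : ℝ) :
    (c : EReal) < indexQuotient φ x ↔ upperRatio φ x < ENNReal.ofReal (x ^ c) := by
  have hl : ((Real.log x : ℝ) : EReal) < 0 := by exact_mod_cast Real.log_neg hx hx1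
  rw [coe_eq_log_div hx hx1.ne c, indexQuotient,
    (EReal.strictAnti_div_right_of_neg hl (EReal.coe_ne_bot _)).lt_iff_gt, ENNReal.log_lt_log_iff]
  rfl

theorem le_indexQuotient_iff {φ : ℝ → ℝ} {x : ℝ} (hx : 0 < x) (hx1 : x < 1) (c : ℝ) :
    (c : EReal) ≤ indexQuotient φ x ↔ upperRatio φ x ≤ ENNReal.ofReal (x ^ c) := by
  have hl : ((Real.log x : ℝ) : EReal) < 0 := by exact_mod_cast Real.log_neg hx hx1
  rw [coe_eq_log_div hx hx1.ne c, indexQuotient,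
    (EReal.strictAnti_div_right_of_neg hl (EReal.coe_ne_bot _)).le_iff_ge, ENNReal.log_le_log_iff]
  rfl

theorem indexQuotient_lt_iff {φ : ℝ → ℝ} {x : ℝ} (hx1 : 1 < x) (c : ℝ) :
    indexQuotient φ x < c ↔ upperRatio φ x < ENNReal.ofReal (x ^ c) := by
  have hl : 0 < ((Real.log x : ℝ) : EReal) := by exact_mod_cast Real.log_pos hx1
  rw [coe_eq_log_div (by linarith) hx1.ne' c, indexQuotient,
    (EReal.strictMono_div_right_of_pos hl (EReal.coe_ne_top _)).lt_iff_lt, ENNReal.log_lt_log_iff]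
  rfl

theorem indexQuotient_le_iff {φ : ℝ → ℝ} {x : ℝ} (hx1 : 1 < x) (c : ℝ) :
    indexQuotient φ x ≤ c ↔ upperRatio φ x ≤ ENNReal.ofReal (x ^ c) := by
  have hl : 0 < ((Real.log x : ℝ) : EReal) := by exact_mod_cast Real.log_pos hx1
  rw [coe_eq_log_div (by linarith) hx1.ne' c, indexQuotient,
    (EReal.strictMono_div_right_of_pos hl (EReal.coe_ne_top _)).le_iff_le, ENNReal.log_le_log_iff]
  rfl

theorem eventually_mem_Ioc {ℓ : ℝ} (hℓ : 0 < ℓ) : ∀ᶠ h in 𝓝[>] (0 : ℝ), h ∈ Ioc 0 ℓ :=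
  Ioc_mem_nhdsGT hℓ

theorem PowerUpper.upperRatio_le {ℓ b C : ℝ} {φ : ℝ → ℝ} (hℓ : 0 < ℓ) (hW : ClassW ℓ φ)
    (h : ∀ x y, 0 < x → x ≤ y → y ≤ ℓ → φ x ≤ C * (x / y) ^ b * φ y) {x : ℝ} (hx : 0 < x)
    (hx1 : x ≤ 1) : upperRatio φ x ≤ ENNReal.ofReal (C * x ^ b) := by
  refine limsup_le_of_le (h := ?_)
  filter_upwards [eventually_mem_Ioc hℓ] with y hy
  apply ENNReal.ofReal_le_ofReal
  rw [div_le_iff₀ (hW.2 y hy)]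
  have := h (y * x) y (mul_pos hy.1 hx) (mul_le_of_le_one_right hy.1.le hx1) hy.2
  rwa [mul_div_cancel_left₀ _ hy.1.ne'] at this

theorem PowerLower.upperRatio_le {ℓ b C : ℝ} {φ : ℝ → ℝ} (hℓ : 0 < ℓ) (hW : ClassW ℓ φ)
    (h : ∀ x y, 0 < x → x ≤ y → y ≤ ℓ → φ y ≤ C * (y / x) ^ b * φ x) {x : ℝ} (hx1 : 1 ≤ x) :
    upperRatio φ x ≤ ENNReal.ofReal (C * x ^ b) := by
  have hx : 0 < x := by linarith
  refine limsup_le_of_le (h := ?_)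
  filter_upwards [eventually_mem_Ioc (div_pos hℓ hx), eventually_mem_Ioc hℓ] with y hy hy2
  apply ENNReal.ofReal_le_ofReal
  rw [div_le_iff₀ (hW.2 y hy2)]
  have := h y (y * x) hy.1 (le_mul_of_one_le_right hy.1.le hx1) ((le_div_iff₀ hx).1 hy.2)
  rwa [mul_div_cancel_left₀ _ hy.1.ne'] at this

/-- Half of the gain ε pays for the constant: C x^(ε/2) < 1 for small x, and a single such x
suffices because the lower index is a supremum. -/
theorem PowerUpper.lt_lowerIndex {ℓ β ε : ℝ} {φ : ℝ → ℝ} (hℓ : 0 < ℓ) (hε : 0 < ε)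
    (hW : ClassW ℓ φ) (h : PowerUpper ℓ (β + ε) φ) : (β : EReal) < lowerIndex φ := by
  obtain ⟨C, hC, h⟩ := h
  have h1 : Tendsto (fun x : ℝ => C * x ^ (ε / 2)) (𝓝[>] 0) (𝓝 0) := by
    have := (Real.continuousAt_rpow_const 0 (ε / 2) (Or.inr (by positivity))).tendsto.const_mul C
    rw [Real.zero_rpow (by positivity), mul_zero] at this
    exact this.mono_left nhdsWithin_le_nhds
  obtain ⟨x, hx1, hx⟩ := ((h1.eventually (gt_mem_nhds (zero_lt_one' ℝ))).and
    (Ioo_mem_nhdsGT (zero_lt_one' ℝ))).exists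
  have hq : ((β + ε / 2 : ℝ) : EReal) ≤ indexQuotient φ x := by
    rw [le_indexQuotient_iff hx.1 hx.2]
    refine (PowerUpper.upperRatio_le hℓ hW h hx.1 hx.2.le).trans (ENNReal.ofReal_le_ofReal ?_)
    have e : β + ε = (β + ε / 2) + ε / 2 := by ring
    rw [e, Real.rpow_add hx.1 (β + ε / 2)]
    have := Real.rpow_pos_of_pos hx.1 (β + ε / 2)
    nlinarith
  refine lt_of_lt_of_le (b := ((β + ε / 2 : ℝ) : EReal)) ?_ (hq.trans ?_)
  · exact_mod_cast (by linarith : β < β + ε / 2)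
  · exact le_iSup₂_of_le x hx le_rfl

theorem PowerLower.upperIndex_lt {ℓ γ ε : ℝ} {φ : ℝ → ℝ} (hℓ : 0 < ℓ) (hε : 0 < ε)
    (hW : ClassW ℓ φ) (h : PowerLower ℓ (γ - ε) φ) : upperIndex φ < (γ : EReal) := by
  obtain ⟨C, hC, h⟩ := h
  have h1 : Tendsto (fun x : ℝ => x ^ (ε / 2)) atTop atTop := tendsto_rpow_atTop (by positivity)
  have hle : upperIndex φ ≤ ((γ - ε / 2 : ℝ) : EReal) := by
    refine limsup_le_of_le (h := ?_)
    filter_upwards [h1.eventually_ge_atTop C, eventually_gt_atTop 1] with x hxC hx1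
    have hx : 0 < x := by linarith
    rw [indexQuotient_le_iff hx1]
    refine (PowerLower.upperRatio_le hℓ hW h hx1.le).trans (ENNReal.ofReal_le_ofReal ?_)
    have e : γ - ε / 2 = (γ - ε) + ε / 2 := by ring
    rw [e, Real.rpow_add hx, mul_comm]
    gcongr
  refine hle.trans_lt ?_
  exact_mod_cast (by linarith : γ - ε / 2 < γ)

/-- One q < 1 with limsup φ(qh)/φ(h) < q^β is enough. A number r = q^b strictly between the two
gives b > β and φ(qh) ≤ q^b φ(h) for all small h. Iteration covers the ratios q^n, doubling covers
those in between, and `powerUpper_of_near_zero` covers large h. -/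
theorem powerUpper_of_lt_lowerIndex {ℓ β : ℝ} {φ : ℝ → ℝ} (hℓ : 0 < ℓ) (hW : ClassW ℓ φ)
    (hD : Doubling ℓ φ) (h : (β : EReal) < lowerIndex φ) : ∃ ε > 0, PowerUpper ℓ (β + ε) φ := by
  obtain ⟨q, hq⟩ := lt_iSup_iff.1 h
  obtain ⟨⟨hq0, hq1⟩, hβ⟩ := lt_iSup_iff.1 hq
  rw [lt_indexQuotient_iff hq0 hq1] at hβ
  obtain ⟨r, hr, hr2⟩ := ENNReal.lt_iff_exists_nnreal_btwn.1 hβ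
  have hr0 : (0 : ℝ) < r := by
    have h0 : (0 : ℝ≥0∞) < r := bot_le.trans_lt hr
    exact_mod_cast h0
  have hr1 : (r : ℝ) < q ^ β := by
    rw [ENNReal.ofReal, ENNReal.coe_lt_coe] at hr2
    exact Real.lt_toNNReal_iff_coe_lt.1 hr2
  set b := Real.logb q r with hb
  have hqb : q ^ b = r := Real.rpow_logb hq0 hq1.ne hr0
  have hbβ : β < b := by
    rw [← hqb] at hr1
    exact (Real.rpow_lt_rpow_left_iff_of_base_lt_one hq0 hq1).1 hr1
  have hev := eventually_lt_of_limsup_lt hr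
  obtain ⟨h₀, hh₀, hsub⟩ := (mem_nhdsGT_iff_exists_Ioc_subset).1 hev
  set h₁ := min h₀ ℓ with hh₁
  have h₁0 : 0 < h₁ := lt_min hh₀ hℓ
  have hstep : ∀ y, 0 < y → y ≤ h₁ → φ (y * q) ≤ q ^ b * φ y := by
    intro y hy0 hy
    have h1 : ENNReal.ofReal (φ (y * q) / φ y) < r := hsub ⟨hy0, hy.trans (min_le_left _ _)⟩
    have h2 := hW.2 y ⟨hy0, hy.trans (min_le_right _ _)⟩
    rw [ENNReal.ofReal, ENNReal.coe_lt_coe, Real.toNNReal_lt_iff_lt_coe (by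
      have := hW.2 (y * q) ⟨by positivity, (mul_le_of_le_one_right hy0.le hq1.le).trans
        (hy.trans (min_le_right _ _))⟩
      positivity), div_lt_iff₀ h2] at h1
    rw [hqb]
    exact h1.le
  have hit : ∀ n : ℕ, ∀ y, 0 < y → y ≤ h₁ → φ (y * q ^ n) ≤ (q ^ b) ^ n * φ y := by
    intro n y hy0 hy
    induction n with
    | zero => simp
    | succ n ih =>
      have h1 := hstep (y * q ^ n) (by positivity)
        ((mul_le_of_le_one_right hy0.le (pow_le_one₀ hq0.le hq1.le)).trans hy)
      calc φ (y * q ^ (n + 1)) = φ (y * q ^ n * q) := by congr 1; ring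
        _ ≤ q ^ b * φ (y * q ^ n) := h1
        _ ≤ q ^ b * ((q ^ b) ^ n * φ y) := by gcongr
        _ = _ := by ring
  obtain ⟨K, hK, hc⟩ := hD.comparable hW hq0
  refine ⟨b - β, by linarith, ?_⟩
  rw [add_sub_cancel]
  refine powerUpper_of_near_zero hW hD (C := K * q ^ (-|b|)) (by positivity) h₁0 (min_le_right _ _)
    fun x y hx hxy hy => ?_
  have hy0 := hx.trans_le hxy
  obtain ⟨n, hn1, hn2⟩ := exists_nat_pow_near_of_lt_one (x := x / y)
      (y := q) (by positivity) ((div_le_one hy0).2 hxy) hq0 hq1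
  have hyn : y * q ^ n ≤ y := mul_le_of_le_one_right hy0.le (pow_le_one₀ hq0.le hq1.le)
  have h1 := (hc (y * q ^ n) ⟨by positivity, hyn.trans (hy.trans (min_le_right _ _))⟩ x
    (by rw [lt_div_iff₀ hy0, pow_succ] at hn1; linarith)
    (by rw [div_le_iff₀ hy0] at hn2; linarith)).1
  have hφy := hW.2 y ⟨hy0, hy.trans (min_le_right _ _)⟩
  -- Here b may have either sign; the factor q^(-|b|) covers the passage from q^n to x/y in both
  -- cases.
  have hpow : (q ^ b) ^ n ≤ q ^ (-|b|) * (x / y) ^ b := by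
    rw [← Real.rpow_natCast, ← Real.rpow_mul hq0.le, mul_comm b, Real.rpow_mul hq0.le,
      Real.rpow_natCast]
    rcases le_total 0 b with hb0 | hb0
    · rw [abs_of_nonneg hb0, Real.rpow_neg hq0.le, inv_mul_eq_div,
        le_div_iff₀ (by positivity), ← Real.mul_rpow (by positivity) hq0.le]
      exact Real.rpow_le_rpow (by positivity) (by rw [← pow_succ]; exact hn1.le) hb0
    · have h2 : (q ^ n) ^ b ≤ (x / y) ^ b :=
        Real.rpow_le_rpow_of_nonpos (by positivity) hn2 hb0
      refine h2.trans (le_mul_of_one_le_left (by positivity) ?_)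
      exact Real.one_le_rpow_of_pos_of_le_one_of_nonpos hq0 hq1.le
        (by have := abs_nonneg b; linarith)
  calc φ x ≤ K * φ (y * q ^ n) := h1
    _ ≤ K * ((q ^ b) ^ n * φ y) := by gcongr; exact hit n y hy0 hy
    _ ≤ K * ((q ^ (-|b|) * (x / y) ^ b) * φ y) := by gcongr
    _ = _ := by ring

theorem powerLower_of_upperIndex_lt {ℓ γ : ℝ} {φ : ℝ → ℝ} (hℓ : 0 < ℓ) (hW : ClassW ℓ φ)
    (hD : Doubling ℓ φ) (h : upperIndex φ < (γ : EReal)) : ∃ ε > 0, PowerLower ℓ (γ - ε) φ := by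
  obtain ⟨q, hβ, hq1⟩ := ((eventually_lt_of_limsup_lt h).and (eventually_gt_atTop 1)).exists
  have hq0 : 0 < q := by linarith
  rw [indexQuotient_lt_iff hq1] at hβ
  obtain ⟨r, hr, hr2⟩ := ENNReal.lt_iff_exists_nnreal_btwn.1 hβ
  have hr0 : (0 : ℝ) < r := by
    have h0 : (0 : ℝ≥0∞) < r := bot_le.trans_lt hr
    exact_mod_cast h0
  have hr1 : (r : ℝ) < q ^ γ := by
    rw [ENNReal.ofReal, ENNReal.coe_lt_coe] at hr2
    exact Real.lt_toNNReal_iff_coe_lt.1 hr2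
  set b := Real.logb q r with hb
  have hqb : q ^ b = r := Real.rpow_logb hq0 hq1.ne' hr0
  have hbγ : b < γ := by
    rw [← hqb] at hr1
    exact (Real.rpow_lt_rpow_left_iff hq1).1 hr1
  have hev := eventually_lt_of_limsup_lt hr
  obtain ⟨h₀, hh₀, hsub⟩ := (mem_nhdsGT_iff_exists_Ioc_subset).1 hev
  -- Since q > 1, the bound ℓ/q keeps q y inside (0, ℓ].
  set h₁ := min h₀ (ℓ / q) with hh₁
  have hℓq : ℓ / q ≤ ℓ := div_le_self hℓ.le hq1.le
  have h₁0 : 0 < h₁ := lt_min hh₀ (by positivity)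
  have h₁ℓ : h₁ ≤ ℓ := (min_le_right _ _).trans hℓq
  have hstep : ∀ y, 0 < y → y ≤ h₁ → φ (y * q) ≤ q ^ b * φ y := by
    intro y hy0 hy
    have h1 : ENNReal.ofReal (φ (y * q) / φ y) < r := hsub ⟨hy0, hy.trans (min_le_left _ _)⟩
    have h2 := hW.2 y ⟨hy0, hy.trans h₁ℓ⟩
    rw [ENNReal.ofReal, ENNReal.coe_lt_coe, Real.toNNReal_lt_iff_lt_coe (by
      have := hW.2 (y * q) ⟨by positivity, (le_div_iff₀ hq0).1 (hy.trans (min_le_right _ _))⟩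
      positivity), div_lt_iff₀ h2] at h1
    rw [hqb]
    exact h1.le
  have hit : ∀ n : ℕ, ∀ y, 0 < y → y * q ^ n ≤ h₁ → φ (y * q ^ n) ≤ (q ^ b) ^ n * φ y := by
    intro n y hy0
    induction n with
    | zero => simp
    | succ n ih =>
      intro hy
      have e : y * q ^ (n + 1) = y * q ^ n * q := by ring
      have hle : y * q ^ n ≤ h₁ := by
        refine le_trans ?_ hy
        rw [e]
        exact le_mul_of_one_le_right (by positivity) hq1.le
      calc φ (y * q ^ (n + 1)) = φ (y * q ^ n * q) := by rw [e]
        _ ≤ q ^ b * φ (y * q ^ n) := hstep (y * q ^ n) (by positivity) hle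
        _ ≤ q ^ b * ((q ^ b) ^ n * φ y) := by gcongr; exact ih hle
        _ = _ := by ring
  have hqi : 0 < q⁻¹ := by positivity
  obtain ⟨K, hK, hc⟩ := hD.comparable hW hqi
  refine ⟨γ - b, by linarith, ?_⟩
  rw [sub_sub_cancel]
  refine powerLower_of_near_zero hW hD (C := K * q ^ |b|) (by positivity) h₁0 h₁ℓ
    fun x y hx hxy hy => ?_
  have hy0 := hx.trans_le hxy
  obtain ⟨n, hn1, hn2⟩ := exists_nat_pow_near (x := y / x)
      (y := q) ((one_le_div hx).2 hxy) hq1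
  have hxn : x * q ^ n ≤ y := by rw [le_div_iff₀ hx] at hn1; linarith
  have h1 := (hc y ⟨hy0, hy.trans h₁ℓ⟩ (x * q ^ n)
    (by rw [inv_mul_le_iff₀ hq0]; rw [div_lt_iff₀ hx, pow_succ] at hn2; linarith) hxn).2
  have hφx := hW.2 x ⟨hx, hxy.trans (hy.trans h₁ℓ)⟩
  have hpow : (q ^ b) ^ n ≤ q ^ |b| * (y / x) ^ b := by
    rw [← Real.rpow_natCast, ← Real.rpow_mul hq0.le, mul_comm b, Real.rpow_mul hq0.le,
      Real.rpow_natCast]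
    rcases le_total 0 b with hb0 | hb0
    · have h2 : (q ^ n) ^ b ≤ (y / x) ^ b := Real.rpow_le_rpow (by positivity) hn1 hb0
      refine h2.trans (le_mul_of_one_le_left (by positivity) ?_)
      exact Real.one_le_rpow hq1.le (abs_nonneg b)
    · rw [abs_of_nonpos hb0, Real.rpow_neg hq0.le, inv_mul_eq_div,
        le_div_iff₀ (by positivity), ← Real.mul_rpow (by positivity) hq0.le]
      exact Real.rpow_le_rpow_of_nonpos (by positivity) (by rw [← pow_succ]; exact hn2.le) hb0
  calc φ y ≤ K * φ (x * q ^ n) := h1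
    _ ≤ K * ((q ^ b) ^ n * φ x) := by gcongr; exact hit n x hx (hxn.trans hy)
    _ ≤ K * ((q ^ |b| * (y / x) ^ b) * φ x) := by gcongr
    _ = _ := by ring

/-- A real number c strictly between the indices in the wrong order would give φ(xℓ) ≤ C x^(c+ε)
φ(ℓ) and φ(ℓ) ≤ D x^(δ-c) φ(xℓ), hence 1 ≤ C D x^(ε+δ), which is false for small x. -/
theorem lowerIndex_le_upperIndex {ℓ : ℝ} {φ : ℝ → ℝ} (hℓ : 0 < ℓ) (hW : ClassW ℓ φ)
    (hD : Doubling ℓ φ) : lowerIndex φ ≤ upperIndex φ := by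
  by_contra! hlt
  obtain ⟨c, h1, h2⟩ := EReal.lt_iff_exists_real_btwn.1 hlt
  obtain ⟨ε, hε, C, hC, hU⟩ := powerUpper_of_lt_lowerIndex hℓ hW hD h2
  obtain ⟨δ, hδ, D, hD, hL⟩ := powerLower_of_upperIndex_lt hℓ hW hD h1
  have h3 : Tendsto (fun x : ℝ => C * D * x ^ (ε + δ)) (𝓝[>] 0) (𝓝 0) := by
    have := (Real.continuousAt_rpow_const 0 (ε + δ)
      (Or.inr (by positivity))).tendsto.const_mul (C * D)
    rw [Real.zero_rpow (by positivity), mul_zero] at this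
    exact this.mono_left nhdsWithin_le_nhds
  obtain ⟨x, hx1, hx0, hx⟩ := ((h3.eventually (gt_mem_nhds (zero_lt_one' ℝ))).and
    (Ioc_mem_nhdsGT (zero_lt_one' ℝ))).exists
  have hxℓ : x * ℓ ≤ ℓ := mul_le_of_le_one_left hℓ.le hx
  have h4 := hU (x * ℓ) ℓ (by positivity) hxℓ le_rfl
  have h5 := hL (x * ℓ) ℓ (by positivity) hxℓ le_rfl
  have h6 := hW.2 (x * ℓ) ⟨by positivity, hxℓ⟩
  rw [mul_div_cancel_right₀ _ hℓ.ne'] at h4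
  have e : ℓ / (x * ℓ) = x⁻¹ := by field_simp
  rw [e, Real.inv_rpow hx0.le, ← Real.rpow_neg hx0.le] at h5
  have h7 : φ (x * ℓ) ≤ C * D * x ^ (ε + δ) * φ (x * ℓ) := by
    calc _ ≤ C * x ^ (c + ε) * φ ℓ := h4
      _ ≤ C * x ^ (c + ε) * (D * x ^ (-(c - δ)) * φ (x * ℓ)) := by gcongr
      _ = C * D * (x ^ (c + ε) * x ^ (-(c - δ))) * φ (x * ℓ) := by ring
      _ = _ := by rw [← Real.rpow_add hx0]; ring_nf
  nlinarith

theorem zygmund_iff_index {ℓ : ℝ} (β γ : ℝ) {φ : ℝ → ℝ} (hℓ : 0 < ℓ) (hW : ClassW ℓ φ)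
    (hD : Doubling ℓ φ) : Zygmund ℓ β γ φ ↔
      (β : EReal) < lowerIndex φ ∧ lowerIndex φ ≤ upperIndex φ ∧ upperIndex φ < (γ : EReal) := by
  constructor
  · rintro ⟨hU, hL⟩
    obtain ⟨ε, hε, hU⟩ := hU.powerUpper hW hD
    obtain ⟨δ, hδ, hL⟩ := hL.powerLower hℓ hW hD
    exact ⟨hU.lt_lowerIndex hℓ hε hW, lowerIndex_le_upperIndex hℓ hW hD,
      hL.upperIndex_lt hℓ hδ hW⟩
  · rintro ⟨hU, -, hL⟩
    obtain ⟨ε, hε, hU⟩ := powerUpper_of_lt_lowerIndex hℓ hW hD hU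
    obtain ⟨δ, hδ, hL⟩ := powerLower_of_upperIndex_lt hℓ hW hD hL
    exact ⟨hU.zygmundUpper hε hW, hL.zygmundLower hδ hW⟩

/-! ### The Hilbert transform in L^p of the line, by the method of M. Riesz. -/

/-! ### Integrals of holomorphic functions over horizontal lines -/

theorem integrable_horizontal {G : ℂ → ℂ} {y C q : ℝ} (hq : 1 < q)
    (hd : ∀ z : ℂ, y ≤ z.im → DifferentiableAt ℂ G z)
    (hb : ∀ z : ℂ, y ≤ z.im → ‖G z‖ ≤ C * (1 + ‖z‖) ^ (-q)) :
    Integrable (fun x : ℝ => G (x + y * Complex.I)) := by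
  have hcont : Continuous (fun x : ℝ => G (x + y * Complex.I)) := by
    rw [continuous_iff_continuousAt]
    intro x
    have h1 := (hd (x + y * Complex.I) (by simp)).continuousAt
    exact ContinuousAt.comp (f := fun x : ℝ => (x + y * Complex.I : ℂ)) h1 (by fun_prop)
  have hC : 0 ≤ C := by
    have h1 := (norm_nonneg _).trans (hb (y * Complex.I) (by simp))
    exact nonneg_of_mul_nonneg_left h1 (by positivity)
  refine ((integrable_one_add_norm (E := ℝ) (μ := volume) (r := q) (by simpa)).const_mul C).mono'
    hcont.aestronglyMeasurable (Eventually.of_forall fun x => ?_)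
  refine (hb _ (by simp)).trans ?_
  have h1 : ‖x‖ ≤ ‖(x + y * Complex.I : ℂ)‖ := by
    have := Complex.abs_re_le_norm (x + y * Complex.I)
    simpa using this
  exact mul_le_mul_of_nonneg_left (Real.rpow_le_rpow_of_nonpos (by positivity) (by linarith)
    (by linarith)) hC

/-- Cauchy's theorem on the rectangle [-R, R] × [y, R]. On the other three sides |z| ≥ R and the
length is at most 2R, so they contribute O(R^(1-q)), which tends to 0. -/
theorem integral_horizontal_eq_zero {G : ℂ → ℂ} {y C q : ℝ} (hq : 1 < q)
    (hd : ∀ z : ℂ, y ≤ z.im → DifferentiableAt ℂ G z)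
    (hb : ∀ z : ℂ, y ≤ z.im → ‖G z‖ ≤ C * (1 + ‖z‖) ^ (-q)) :
    ∫ x : ℝ, G (x + y * Complex.I) = 0 := by
  have hint := integrable_horizontal hq hd hb
  have hC : 0 ≤ C := by
    have h1 := (norm_nonneg _).trans (hb (y * Complex.I) (by simp))
    exact nonneg_of_mul_nonneg_left h1 (by positivity)
  have hlim := intervalIntegral_tendsto_integral hint tendsto_neg_atTop_atBot tendsto_id
  refine tendsto_nhds_unique hlim ?_
  simp only [id]
  have hbound : ∀ R : ℝ, |y| < R →
      ‖∫ x in (-R)..R, G (x + y * Complex.I)‖ ≤ 6 * C * R ^ (1 - q) := by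
    intro R hR
    have hR0 : 0 < R := (abs_nonneg y).trans_lt hR
    have hyR : y ≤ R := (le_abs_self y).trans hR.le
    have hyR' : -R ≤ y := (abs_le.1 hR.le).1
    have hpt : ∀ z : ℂ, y ≤ z.im → R ≤ ‖z‖ → ‖G z‖ ≤ C * R ^ (-q) := by
      intro z hz hzR
      refine (hb z hz).trans (mul_le_mul_of_nonneg_left (Real.rpow_le_rpow_of_nonpos hR0
        (by linarith) (by linarith)) hC)
    have hrect := Complex.integral_boundary_rect_eq_zero_of_differentiableOn G
      (-R + y * Complex.I) (R + R * Complex.I) (by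
        intro z hz
        refine (hd z ?_).differentiableWithinAt
        have := hz.2
        simp only [mem_preimage] at this
        simp at this
        rw [uIcc_of_le hyR] at this
        exact this.1)
    simp only [Complex.add_re, Complex.neg_re, Complex.ofReal_re, Complex.mul_re, Complex.I_re,
      mul_zero, Complex.ofReal_im, Complex.I_im, mul_one, sub_self, add_zero, Complex.add_im,
      Complex.neg_im, neg_zero, Complex.mul_im, zero_add, Complex.ofReal_neg] at hrect
    have h1 : ‖∫ x : ℝ in (-R)..R, G (x + R * Complex.I)‖ ≤ C * R ^ (-q) * |R - -R| := by
      refine intervalIntegral.norm_integral_le_of_norm_le_const fun x _ => ?_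
      refine hpt _ (by simpa using hyR) ?_
      have := Complex.abs_im_le_norm (x + R * Complex.I)
      simp only [Complex.add_im, Complex.ofReal_im, Complex.mul_im, Complex.ofReal_re,
        Complex.I_im, mul_one, Complex.I_re, mul_zero, add_zero, zero_add] at this
      exact (le_abs_self R).trans this
    have h2 : ‖∫ s : ℝ in y..R, G (R + s * Complex.I)‖ ≤ C * R ^ (-q) * |R - y| := by
      refine intervalIntegral.norm_integral_le_of_norm_le_const fun s hs => ?_
      rw [uIoc_of_le hyR] at hs
      refine hpt _ (by simpa using hs.1.le) ?_
      have := Complex.abs_re_le_norm (R + s * Complex.I)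
      simp only [Complex.add_re, Complex.ofReal_re, Complex.mul_re, Complex.I_re, mul_zero,
        Complex.ofReal_im, Complex.I_im, mul_one, sub_self, add_zero] at this
      exact (le_abs_self R).trans this
    have h3 : ‖∫ s : ℝ in y..R, G (-R + s * Complex.I)‖ ≤ C * R ^ (-q) * |R - y| := by
      refine intervalIntegral.norm_integral_le_of_norm_le_const fun s hs => ?_
      rw [uIoc_of_le hyR] at hs
      refine hpt _ (by simpa using hs.1.le) ?_
      have := Complex.abs_re_le_norm (-R + s * Complex.I)
      simp only [Complex.add_re, Complex.ofReal_re, Complex.mul_re, Complex.I_re, mul_zero,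
        Complex.ofReal_im, Complex.I_im, mul_one, sub_self, add_zero, Complex.neg_re,
        abs_neg] at this
      exact (le_abs_self R).trans this
    have habs : |R - y| ≤ 2 * R := by rw [abs_le]; constructor <;> linarith
    have habs2 : |R - -R| = 2 * R := by rw [sub_neg_eq_add, abs_of_pos (by linarith)]; ring
    rw [habs2] at h1
    set A := ∫ x in (-R)..R, G (x + y * Complex.I)
    set B := ∫ x : ℝ in (-R)..R, G (x + R * Complex.I)
    set D := ∫ s : ℝ in y..R, G (R + s * Complex.I)
    set E := ∫ s : ℝ in y..R, G (-R + s * Complex.I)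
    have hA : A = B - Complex.I * D + Complex.I * E := by
      simp only [smul_eq_mul] at hrect
      linear_combination hrect
    have hM : 0 ≤ C * R ^ (-q) := by positivity
    calc ‖A‖ ≤ ‖B‖ + ‖D‖ + ‖E‖ := by
          rw [hA]
          refine (norm_add_le _ _).trans (add_le_add ((norm_sub_le _ _).trans ?_) ?_) <;> simp
      _ ≤ C * R ^ (-q) * (2 * R) + C * R ^ (-q) * (2 * R) + C * R ^ (-q) * (2 * R) := by
          refine add_le_add (add_le_add h1 (h2.trans ?_)) (h3.trans ?_) <;>
            exact mul_le_mul_of_nonneg_left habs hM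
      _ = _ := by
          rw [sub_eq_neg_add, Real.rpow_add hR0, Real.rpow_one]
          ring
  rw [tendsto_zero_iff_norm_tendsto_zero]
  have hz : Tendsto (fun R : ℝ => 6 * C * R ^ (1 - q)) atTop (𝓝 0) := by
    have := (tendsto_rpow_neg_atTop (y := q - 1) (by linarith)).const_mul (6 * C)
    simpa [neg_sub] using this
  refine tendsto_of_tendsto_of_tendsto_of_le_of_le' tendsto_const_nhds hz
    (Eventually.of_forall fun _ => norm_nonneg _) ?_
  filter_upwards [eventually_gt_atTop |y|] with R hR using hbound R hR

/-! ### The Cauchy integral of a function on the line -/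

/-- `∫ f(t) / (t - z) dt`. -/
def cauchyInt (f : ℝ → ℝ) (z : ℂ) : ℂ := ∫ t, (f t : ℂ) / ((t : ℂ) - z)

theorem sub_ne_zero_of_im_pos {z : ℂ} (hz : 0 < z.im) (t : ℝ) : (t : ℂ) - z ≠ 0 := by
  intro h
  have := congrArg Complex.im h
  simp at this
  linarith

theorem im_le_norm_sub (z : ℂ) (t : ℝ) : z.im ≤ ‖(t : ℂ) - z‖ := by
  have := Complex.abs_im_le_norm ((t : ℂ) - z)
  simp only [Complex.sub_im, Complex.ofReal_im, zero_sub, abs_neg] at this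
  exact (le_abs_self _).trans this

theorem integrable_cauchyInt {f : ℝ → ℝ} (hf : Integrable f) {z : ℂ} (hz : 0 < z.im) :
    Integrable (fun t : ℝ => (f t : ℂ) / ((t : ℂ) - z)) := by
  refine (hf.norm.mul_const (z.im)⁻¹).mono' ?_ (Eventually.of_forall fun t => ?_)
  · simp_rw [div_eq_mul_inv]
    exact (Complex.continuous_ofReal.comp_aestronglyMeasurable hf.1).mul
      (Measurable.aestronglyMeasurable (by fun_prop))
  · rw [norm_div, Complex.norm_real, div_eq_mul_inv]
    gcongr
    exact im_le_norm_sub z t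

theorem differentiableAt_cauchyInt {f : ℝ → ℝ} (hf : Integrable f) {z : ℂ} (hz : 0 < z.im) :
    DifferentiableAt ℂ (cauchyInt f) z := by
  have hs : {w : ℂ | z.im / 2 < w.im} ∈ 𝓝 z :=
    (isOpen_lt continuous_const Complex.continuous_im).mem_nhds (by simpa using by linarith)
  have him : ∀ w ∈ {w : ℂ | z.im / 2 < w.im}, 0 < w.im := fun w hw => by
    have : z.im / 2 < w.im := hw
    linarith
  have key := hasDerivAt_integral_of_dominated_loc_of_deriv_le (μ := volume)
    (F := fun (w : ℂ) (t : ℝ) => (f t : ℂ) / ((t : ℂ) - w))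
    (F' := fun (w : ℂ) (t : ℝ) => (f t : ℂ) / ((t : ℂ) - w) ^ 2)
    (bound := fun t => ‖f t‖ * ((z.im / 2) ^ 2)⁻¹) hs
    (by
      filter_upwards [hs] with w hw using (integrable_cauchyInt hf (him w hw)).1)
    (integrable_cauchyInt hf hz)
    (by
      simp_rw [div_eq_mul_inv]
      exact (Complex.continuous_ofReal.comp_aestronglyMeasurable hf.1).mul
        (Measurable.aestronglyMeasurable (by fun_prop)))
    (Eventually.of_forall fun t w hw => by
      rw [norm_div, Complex.norm_real, div_eq_mul_inv, norm_pow]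
      gcongr
      have h1 : z.im / 2 < w.im := hw
      exact h1.le.trans (im_le_norm_sub w t))
    (hf.norm.mul_const _)
    (Eventually.of_forall fun t w hw => by
      have h0 := sub_ne_zero_of_im_pos (him w hw) t
      have h1 : HasDerivAt (fun w : ℂ => (t : ℂ) - w) (-1) w := by
        simpa using (hasDerivAt_id w).const_sub (t : ℂ)
      have h2 := (hasDerivAt_const w (f t : ℂ)).div h1 h0
      refine h2.congr_deriv ?_
      ring)
  exact key.2.differentiableAt

theorem one_add_norm_le_of_abs_le {R y : ℝ} (hy : 0 < y) {z : ℂ} (hz : y ≤ z.im) {t : ℝ}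
    (ht : |t| ≤ R) : 1 + ‖z‖ ≤ ((1 + R) / y + 1) * ‖(t : ℂ) - z‖ := by
  have h1 : ‖z‖ ≤ ‖(t : ℂ)‖ + ‖(t : ℂ) - z‖ := by
    have := norm_sub_le (t : ℂ) ((t : ℂ) - z)
    simpa using this
  rw [Complex.norm_real, Real.norm_eq_abs] at h1
  have h2 : y ≤ ‖(t : ℂ) - z‖ := hz.trans (im_le_norm_sub z t)
  have hR : 0 ≤ R := (abs_nonneg t).trans ht
  have h3 : 1 + R ≤ (1 + R) / y * ‖(t : ℂ) - z‖ := by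
    calc 1 + R = (1 + R) / y * y := by field_simp
      _ ≤ _ := by gcongr
  linarith

/-- Compact support of f gives decay of order 1/|z| above the height y, so the p-th power decays
with exponent p > 1 and Cauchy's theorem applies to it. -/
theorem norm_cauchyInt_le {f : ℝ → ℝ} (hf : Integrable f) {R y : ℝ}
    (hs : ∀ t, R < |t| → f t = 0) (hy : 0 < y) {z : ℂ} (hz : y ≤ z.im) :
    ‖cauchyInt f z‖ ≤ ((1 + R) / y + 1) * (∫ t, |f t|) * (1 + ‖z‖)⁻¹ := by
  have hz0 : 0 < z.im := hy.trans_le hz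
  calc ‖cauchyInt f z‖ ≤ ∫ t, ‖(f t : ℂ) / ((t : ℂ) - z)‖ := norm_integral_le_integral_norm _
    _ ≤ ∫ t, |f t| * (((1 + R) / y + 1) * (1 + ‖z‖)⁻¹) := by
      refine integral_mono (integrable_cauchyInt hf hz0).norm (hf.abs.mul_const _) fun t => ?_
      simp only
      rw [norm_div, Complex.norm_real, Real.norm_eq_abs]
      rcases le_or_gt |t| R with ht | ht
      · have h1 := one_add_norm_le_of_abs_le hy hz ht
        have h2 : 0 < ‖(t : ℂ) - z‖ := norm_pos_iff.2 (sub_ne_zero_of_im_pos hz0 t)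
        rw [div_eq_mul_inv]
        gcongr
        rw [← div_eq_mul_inv, le_div_iff₀ (by positivity), inv_mul_le_iff₀ h2]
        linarith
      · simp [hs t ht]
    _ = _ := by rw [integral_mul_const]; ring

theorem inv_sub_re (t x y : ℝ) : (((t : ℂ) - (x + y * Complex.I))⁻¹).re =
    (t - x) / ((t - x) ^ 2 + y ^ 2) := by
  simp [Complex.inv_re, Complex.normSq_apply]
  ring_nf

theorem inv_sub_im (t x y : ℝ) : (((t : ℂ) - (x + y * Complex.I))⁻¹).im =
    y / ((t - x) ^ 2 + y ^ 2) := by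
  simp [Complex.inv_im, Complex.normSq_apply]
  ring_nf

theorem cauchyInt_re {f : ℝ → ℝ} (hf : Integrable f) (x : ℝ) {y : ℝ} (hy : 0 < y) :
    (cauchyInt f (x + y * Complex.I)).re = ∫ t, f t * ((t - x) / ((t - x) ^ 2 + y ^ 2)) := by
  have h := integrable_cauchyInt hf (z := x + y * Complex.I) (by simpa using hy)
  rw [cauchyInt, ← RCLike.re_eq_complex_re, ← integral_re h]
  congr 1
  ext t
  rw [div_eq_mul_inv, RCLike.re_eq_complex_re, Complex.re_ofReal_mul, inv_sub_re]

theorem cauchyInt_im {f : ℝ → ℝ} (hf : Integrable f) (x : ℝ) {y : ℝ} (hy : 0 < y) :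
    (cauchyInt f (x + y * Complex.I)).im = ∫ t, f t * (y / ((t - x) ^ 2 + y ^ 2)) := by
  have h := integrable_cauchyInt hf (z := x + y * Complex.I) (by simpa using hy)
  rw [cauchyInt, ← RCLike.im_eq_complex_im, ← integral_im h]
  congr 1
  ext t
  rw [div_eq_mul_inv, RCLike.im_eq_complex_im, Complex.im_ofReal_mul, inv_sub_im]

/-! ### The pointwise inequality of M. Riesz -/

/-- In polar coordinates the claim is |sin θ|^p ≤ A cos^p θ - B cos pθ for |θ| < π/2. The threshold
θ₀ is the midpoint of π/(2p) and π/2. For |θ| ≥ θ₀ the angle p|θ| lies in (π/2, π], because p ≤ 2,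
and the B-term alone is at least 1. For |θ| ≤ θ₀ the cosine is bounded below and the A-term absorbs
everything. -/
theorem exists_abs_im_rpow_le {p : ℝ} (hp : 1 < p) (hp2 : p ≤ 2) :
    ∃ A B : ℝ, 0 ≤ A ∧ 0 ≤ B ∧ ∀ w : ℂ, 0 < w.re →
      |w.im| ^ p ≤ A * w.re ^ p - B * (w ^ (p : ℂ)).re := by
  have hπ := Real.pi_pos
  have hp0 : 0 < p := by linarith
  set θ₀ : ℝ := (Real.pi / 2) * ((1 + 1 / p) / 2) with hθ₀
  have hpinv : 1 / p < 1 := (div_lt_one hp0).2 hp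
  have hpinv0 : 0 < 1 / p := by positivity
  have hθ1 : θ₀ < Real.pi / 2 := by
    rw [hθ₀]; nlinarith
  have hθ0 : 0 < θ₀ := by positivity
  have hpθ : Real.pi / 2 < p * θ₀ := by
    have : p * θ₀ = (Real.pi / 2) * ((p + 1) / 2) := by rw [hθ₀]; field_simp
    rw [this]; nlinarith
  have hpθ2 : p * θ₀ ≤ Real.pi := by nlinarith
  have hc : 0 < -Real.cos (p * θ₀) := by
    have := Real.cos_neg_of_pi_div_two_lt_of_lt hpθ (by linarith)
    linarith
  have hcos0 : 0 < Real.cos θ₀ := Real.cos_pos_of_mem_Ioo ⟨by linarith, hθ1⟩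
  set B := (-Real.cos (p * θ₀))⁻¹ with hB
  have hB0 : 0 < B := inv_pos.2 hc
  refine ⟨(1 + B) / Real.cos θ₀ ^ p, B, by positivity, hB0.le, fun w hw => ?_⟩
  have hw0 : w ≠ 0 := fun h => by simp [h] at hw
  set r := ‖w‖ with hr
  have hr0 : 0 < r := norm_pos_iff.2 hw0
  set θ := Complex.arg w with hθ
  have hθlt : |θ| < Real.pi / 2 := Complex.abs_arg_lt_pi_div_two_iff.2 (Or.inl hw)
  have hre : w.re = r * Real.cos θ := (Complex.norm_mul_cos_arg w).symm
  have him : w.im = r * Real.sin θ := (Complex.norm_mul_sin_arg w).symm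
  have hpow : (w ^ (p : ℂ)).re = r ^ p * Real.cos (p * θ) := by
    rw [Complex.cpow_ofReal_re, mul_comm θ]
  have hcosθ : 0 < Real.cos θ := Real.cos_pos_of_mem_Ioo (abs_lt.1 hθlt)
  have key : |Real.sin θ| ^ p ≤ (1 + B) / Real.cos θ₀ ^ p * Real.cos θ ^ p -
      B * Real.cos (p * θ) := by
    have hs1 : |Real.sin θ| ^ p ≤ 1 :=
      Real.rpow_le_one (abs_nonneg _) (Real.abs_sin_le_one θ) hp0.le
    rw [← Real.cos_abs θ, ← Real.cos_abs (p * θ), abs_mul, abs_of_pos hp0]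
    rcases le_total θ₀ |θ| with h | h
    · have h1 : Real.cos (p * |θ|) ≤ Real.cos (p * θ₀) :=
        Real.cos_le_cos_of_nonneg_of_le_pi (by positivity) (by nlinarith [abs_nonneg θ])
          (by gcongr)
      have h2 : 1 ≤ -(B * Real.cos (p * |θ|)) := by
        calc 1 = B * (-Real.cos (p * θ₀)) := (inv_mul_cancel₀ hc.ne').symm
          _ ≤ B * (-Real.cos (p * |θ|)) := by gcongr
          _ = _ := by ring
      have h3 : 0 ≤ (1 + B) / Real.cos θ₀ ^ p * Real.cos |θ| ^ p := by
        rw [Real.cos_abs]; positivity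
      linarith
    · have h1 : Real.cos θ₀ ≤ Real.cos |θ| :=
        Real.cos_le_cos_of_nonneg_of_le_pi (abs_nonneg _) (by linarith) h
      have h2 : 1 + B ≤ (1 + B) / Real.cos θ₀ ^ p * Real.cos |θ| ^ p := by
        calc 1 + B = (1 + B) / Real.cos θ₀ ^ p * Real.cos θ₀ ^ p := by field_simp
          _ ≤ _ := by gcongr
      have h3 := Real.cos_le_one (p * |θ|)
      nlinarith
  rw [hre, him, hpow, abs_mul, abs_of_pos hr0, Real.mul_rpow hr0.le (abs_nonneg _),
    Real.mul_rpow hr0.le hcosθ.le]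
  have hrp : 0 < r ^ p := by positivity
  calc r ^ p * |Real.sin θ| ^ p ≤ r ^ p * ((1 + B) / Real.cos θ₀ ^ p * Real.cos θ ^ p -
      B * Real.cos (p * θ)) := by gcongr
    _ = _ := by ring

/-! ### The Poisson kernel -/

/-- The Poisson kernel, up to the factor `π`. -/
def poisson (y s : ℝ) : ℝ := y / (s ^ 2 + y ^ 2)

theorem poisson_pos {y : ℝ} (hy : 0 < y) (s : ℝ) : 0 < poisson y s := by
  unfold poisson; positivity

theorem continuous_poisson {y : ℝ} (hy : 0 < y) : Continuous (poisson y) :=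
  continuous_const.div (by fun_prop) fun s => by positivity

theorem poisson_eq {y : ℝ} (hy : 0 < y) (s : ℝ) : poisson y s = y⁻¹ * (1 + (s / y) ^ 2)⁻¹ := by
  unfold poisson; field_simp; ring

theorem integrable_poisson {y : ℝ} (hy : 0 < y) : Integrable (poisson y) := by
  have := (integrable_inv_one_add_sq.comp_div hy.ne').const_mul y⁻¹
  exact this.congr (Eventually.of_forall fun s => (poisson_eq hy s).symm)

theorem integral_poisson {y : ℝ} (hy : 0 < y) : ∫ s, poisson y s = Real.pi := by
  simp_rw [poisson_eq hy]
  rw [integral_const_mul, Measure.integral_comp_div (fun s : ℝ => (1 + s ^ 2)⁻¹),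
    integral_univ_inv_one_add_sq, smul_eq_mul, abs_of_pos hy]
  field_simp

theorem lintegral_poisson {y : ℝ} (hy : 0 < y) (x : ℝ) :
    ∫⁻ t, ENNReal.ofReal (poisson y (t - x)) = ENNReal.ofReal Real.pi := by
  rw [lintegral_sub_right_eq_self (fun s => ENNReal.ofReal (poisson y s)) x,
    ← ofReal_integral_eq_lintegral_ofReal (integrable_poisson hy)
      (Eventually.of_forall fun s => (poisson_pos hy s).le), integral_poisson hy]

theorem poisson_sub_comm (y s t : ℝ) : poisson y (s - t) = poisson y (t - s) := by
  unfold poisson; congr 2; ring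

/-- The kernel has mass π in each variable, so Hölder for the kernel followed by Tonelli gives the
constant π^p. -/
theorem lintegral_poisson_rpow_le {p : ℝ} (hp : 1 < p) {y : ℝ} (hy : 0 < y) {u : ℝ → ℝ≥0∞}
    (hu : AEMeasurable u) :
    ∫⁻ x, (∫⁻ t, ENNReal.ofReal (poisson y (t - x)) * u t) ^ p ≤
      ENNReal.ofReal Real.pi ^ p * ∫⁻ t, u t ^ p := by
  have hp0 : 0 < p := by linarith
  have hk : Measurable (fun z : ℝ × ℝ => ENNReal.ofReal (poisson y (z.2 - z.1))) :=
    ENNReal.measurable_ofReal.comp ((continuous_poisson hy).measurable.comp (by fun_prop))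
  have hkx : ∀ x, Measurable (fun t : ℝ => ENNReal.ofReal (poisson y (t - x))) := fun x =>
    ENNReal.measurable_ofReal.comp ((continuous_poisson hy).measurable.comp (by fun_prop))
  have hkt : ∀ t, Measurable (fun x : ℝ => ENNReal.ofReal (poisson y (t - x))) := fun t =>
    ENNReal.measurable_ofReal.comp ((continuous_poisson hy).measurable.comp (by fun_prop))
  calc ∫⁻ x, (∫⁻ t, ENNReal.ofReal (poisson y (t - x)) * u t) ^ p
      ≤ ∫⁻ x, ENNReal.ofReal Real.pi ^ (p - 1) *
          ∫⁻ t, ENNReal.ofReal (poisson y (t - x)) * u t ^ p := by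
        refine lintegral_mono fun x => ?_
        rw [← lintegral_poisson hy x]
        exact lintegral_mul_rpow_le hp (hkx x).aemeasurable hu
    _ = ENNReal.ofReal Real.pi ^ (p - 1) *
          ∫⁻ x, ∫⁻ t, ENNReal.ofReal (poisson y (t - x)) * u t ^ p :=
        lintegral_const_mul' _ _ (ENNReal.rpow_ne_top_of_nonneg (by linarith) ENNReal.ofReal_ne_top)
    _ = ENNReal.ofReal Real.pi ^ (p - 1) *
          ∫⁻ t, ∫⁻ x, ENNReal.ofReal (poisson y (t - x)) * u t ^ p := by
        rw [lintegral_lintegral_swap]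
        exact hk.aemeasurable.mul ((hu.pow_const p).comp_snd)
    _ = ENNReal.ofReal Real.pi ^ (p - 1) * ∫⁻ t, ENNReal.ofReal Real.pi * u t ^ p := by
        congr 1
        refine lintegral_congr fun t => ?_
        rw [lintegral_mul_const _ (hkt t)]
        simp_rw [poisson_sub_comm y t]
        rw [lintegral_poisson hy]
    _ = _ := by
        rw [lintegral_const_mul' _ _ ENNReal.ofReal_ne_top, ← mul_assoc]
        congr 1
        have hπ : ENNReal.ofReal Real.pi ≠ 0 := by
          simpa using Real.pi_pos
        conv_lhs => rw [← ENNReal.rpow_one (ENNReal.ofReal Real.pi), ← ENNReal.rpow_mul, one_mul]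
        rw [← ENNReal.rpow_add _ _ hπ ENNReal.ofReal_ne_top]
        congr 1
        ring

/-! ### The theorem of M. Riesz for the conjugate Poisson integral -/

theorem continuous_cauchyInt_horizontal {f : ℝ → ℝ} (hf : Integrable f) {y : ℝ} (hy : 0 < y) :
    Continuous (fun x : ℝ => cauchyInt f (x + y * Complex.I)) := by
  rw [continuous_iff_continuousAt]
  intro x
  have h1 := (differentiableAt_cauchyInt hf (z := x + y * Complex.I) (by simpa using hy)).continuousAt
  exact ContinuousAt.comp (f := fun x : ℝ => (x + y * Complex.I : ℂ)) h1 (by fun_prop)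

theorem cauchyInt_im_pos {f : ℝ → ℝ} (hf : Integrable f) (hf0 : ∀ t, 0 ≤ f t)
    (hne : ∫ t, f t ≠ 0) {z : ℂ} (hz : 0 < z.im) : 0 < (cauchyInt f z).im := by
  have e : z = (z.re : ℂ) + z.im * Complex.I := (Complex.re_add_im z).symm
  rw [e, cauchyInt_im hf _ hz]
  have hint : Integrable (fun t => f t * (z.im / ((t - z.re) ^ 2 + z.im ^ 2))) := by
    have := (integrable_cauchyInt hf hz).im
    refine this.congr (Eventually.of_forall fun t => ?_)
    simp only
    rw [div_eq_mul_inv, RCLike.im_eq_complex_im, Complex.im_ofReal_mul]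
    conv_lhs => rw [e]
    rw [inv_sub_im]
  have hpos : ∀ t, 0 < z.im / ((t - z.re) ^ 2 + z.im ^ 2) := fun t => by positivity
  have hs : (Function.support fun t => f t * (z.im / ((t - z.re) ^ 2 + z.im ^ 2))) =
      Function.support f := by
    ext t
    simp only [Function.mem_support, ne_eq, mul_eq_zero, (hpos t).ne', or_false]
  rw [integral_pos_iff_support_of_nonneg (fun t => mul_nonneg (hf0 t) (hpos t).le) hint, hs,
    ← integral_pos_iff_support_of_nonneg hf0 hf]
  exact lt_of_le_of_ne (integral_nonneg hf0) hne.symm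

/-- The factor -i turns the positive imaginary part of the Cauchy integral into a positive real
part, so that F^p is holomorphic on the principal branch. Integrating the pointwise inequality along
the line at height y removes the B-term, since the integral of F^p is zero. -/
theorem lintegral_re_rpow_le_im {p : ℝ} (hp : 1 < p) (hp2 : p ≤ 2) : ∃ A : ℝ≥0,
    ∀ f : ℝ → ℝ, Integrable f → (∀ t, 0 ≤ f t) → (∃ R, ∀ t, R < |t| → f t = 0) → ∀ y : ℝ, 0 < y →
      ∫⁻ x : ℝ, ‖(cauchyInt f (x + y * Complex.I)).re‖ₑ ^ p ≤
        A * ∫⁻ x : ℝ, ENNReal.ofReal (cauchyInt f (x + y * Complex.I)).im ^ p := by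
  have hp0 : 0 < p := by linarith
  obtain ⟨A, B, hA, hB, hAB⟩ := exists_abs_im_rpow_le hp hp2
  refine ⟨A.toNNReal, fun f hf hf0 ⟨R, hR⟩ y hy => ?_⟩
  -- If f vanishes almost everywhere, then F = 0 has no positive real part; both sides are 0.
  by_cases hne : ∫ t, f t = 0
  · have h0 : f =ᵐ[volume] 0 := (integral_eq_zero_iff_of_nonneg hf0 hf).1 hne
    have hz : ∀ z, cauchyInt f z = 0 := fun z => by
      rw [cauchyInt]
      refine integral_eq_zero_of_ae ?_
      filter_upwards [h0] with t ht
      simp [ht]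
    simp [hz, hp0]
  set F : ℂ → ℂ := fun z => -Complex.I * cauchyInt f z with hF
  have hFre : ∀ z, (F z).re = (cauchyInt f z).im := fun z => by simp [hF]
  have hFim : ∀ z, (F z).im = -(cauchyInt f z).re := fun z => by simp [hF]
  have hFpos : ∀ z : ℂ, 0 < z.im → 0 < (F z).re := fun z hz => by
    rw [hFre]; exact cauchyInt_im_pos hf hf0 hne hz
  set G : ℂ → ℂ := fun z => F z ^ (p : ℂ) with hG
  have hR' : ∀ t, |R| < |t| → f t = 0 := fun t ht => hR t ((le_abs_self R).trans_lt ht)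
  have hnorm : ∀ z, ‖F z‖ = ‖cauchyInt f z‖ := fun z => by simp [hF]
  have hGnorm : ∀ z : ℂ, 0 < z.im → ‖G z‖ = ‖F z‖ ^ p := fun z hz => by
    rw [hG, Complex.norm_cpow_real]
  set C := ((1 + |R|) / y + 1) * ∫ t, |f t| with hC
  have hC0 : 0 ≤ C := mul_nonneg (by positivity) (integral_nonneg fun t => abs_nonneg _)
  have hd : ∀ z : ℂ, y ≤ z.im → DifferentiableAt ℂ G z := fun z hz => by
    have hz0 : 0 < z.im := hy.trans_le hz
    exact ((differentiableAt_cauchyInt hf hz0).const_mul _).cpow_const (Or.inl (hFpos z hz0))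
  have hb : ∀ z : ℂ, y ≤ z.im → ‖G z‖ ≤ C ^ p * (1 + ‖z‖) ^ (-p) := fun z hz => by
    rw [hGnorm z (hy.trans_le hz), hnorm, Real.rpow_neg (by positivity), ← Real.inv_rpow (by positivity),
      ← Real.mul_rpow hC0 (by positivity)]
    exact Real.rpow_le_rpow (norm_nonneg _) (norm_cauchyInt_le hf hR' hy hz) hp0.le
  have hGint := integrable_horizontal hp hd hb
  have hGzero := integral_horizontal_eq_zero hp hd hb
  have him : ∀ x : ℝ, (x + y * Complex.I : ℂ).im = y := fun x => by simp
  have hpos : ∀ x : ℝ, 0 < (F (x + y * Complex.I)).re := fun x => hFpos _ (by rw [him]; exact hy)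
  have hPint : Integrable (fun x : ℝ => (F (x + y * Complex.I)).re ^ p) := by
    refine hGint.norm.mono' ?_ (Eventually.of_forall fun x => ?_)
    · have h1 : Continuous (fun x : ℝ => (F (x + y * Complex.I)).re) := by
        simp_rw [hFre]
        exact Complex.continuous_im.comp (continuous_cauchyInt_horizontal hf hy)
      exact (h1.rpow_const fun x => Or.inr hp0.le).aestronglyMeasurable
    · rw [hGnorm _ (by rw [him]; exact hy), Real.norm_of_nonneg (Real.rpow_nonneg (hpos x).le _)]
      exact Real.rpow_le_rpow (hpos x).le (Complex.re_le_norm _) hp0.le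
  have hGre : Integrable (fun x : ℝ => (G (x + y * Complex.I)).re) := hGint.re
  have hGre0 : ∫ x : ℝ, (G (x + y * Complex.I)).re = 0 := by
    have := integral_re hGint
    simp only [RCLike.re_eq_complex_re] at this
    rw [this, hGzero]
    simp
  calc ∫⁻ x : ℝ, ‖(cauchyInt f (x + y * Complex.I)).re‖ₑ ^ p
      ≤ ∫⁻ x : ℝ, ENNReal.ofReal (A * (F (x + y * Complex.I)).re ^ p -
          B * (G (x + y * Complex.I)).re) := by
        refine lintegral_mono fun x => ?_
        rw [Real.enorm_eq_ofReal_abs, ENNReal.ofReal_rpow_of_nonneg (abs_nonneg _) hp0.le]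
        apply ENNReal.ofReal_le_ofReal
        have := hAB _ (hpos x)
        rwa [hFim, abs_neg] at this
    _ = ENNReal.ofReal (∫ x : ℝ, (A * (F (x + y * Complex.I)).re ^ p -
          B * (G (x + y * Complex.I)).re)) := by
        refine (ofReal_integral_eq_lintegral_ofReal
          ((hPint.const_mul A).sub (hGre.const_mul B)) ?_).symm
        exact Eventually.of_forall fun x =>
          (Real.rpow_nonneg (abs_nonneg _) _).trans (hAB _ (hpos x))
    _ = ENNReal.ofReal A * ENNReal.ofReal (∫ x : ℝ, (F (x + y * Complex.I)).re ^ p) := by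
        rw [integral_sub (hPint.const_mul A) (hGre.const_mul B), integral_const_mul,
          integral_const_mul, hGre0, mul_zero, sub_zero, ENNReal.ofReal_mul hA]
    _ = _ := by
        rw [ofReal_integral_eq_lintegral_ofReal hPint
          (Eventually.of_forall fun x => Real.rpow_nonneg (hpos x).le _)]
        congr 1
        refine lintegral_congr fun x => ?_
        rw [← hFre, ENNReal.ofReal_rpow_of_nonneg (hpos x).le hp0.le]

theorem ofReal_cauchyInt_im {f : ℝ → ℝ} (hf : Integrable f) (hf0 : ∀ t, 0 ≤ f t) (x : ℝ) {y : ℝ}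
    (hy : 0 < y) : ENNReal.ofReal (cauchyInt f (x + y * Complex.I)).im =
      ∫⁻ t, ENNReal.ofReal (poisson y (t - x)) * ENNReal.ofReal (f t) := by
  rw [cauchyInt_im hf x hy, ofReal_integral_eq_lintegral_ofReal]
  · refine lintegral_congr fun t => ?_
    rw [ENNReal.ofReal_mul (hf0 t), mul_comm]
    rfl
  · have := (integrable_cauchyInt hf (z := x + y * Complex.I) (by simpa using hy)).im
    refine this.congr (Eventually.of_forall fun t => ?_)
    simp only
    rw [div_eq_mul_inv, RCLike.im_eq_complex_im, Complex.im_ofReal_mul, inv_sub_im]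
  · exact Eventually.of_forall fun t => mul_nonneg (hf0 t) (poisson_pos hy _).le

/-- The bound of M. Riesz for the exponent `p`. -/
def RieszBound (p : ℝ) : Prop := ∃ A : ℝ≥0,
    ∀ f : ℝ → ℝ, Integrable f → (∃ R, ∀ t, R < |t| → f t = 0) → ∀ y : ℝ, 0 < y →
      ∫⁻ x : ℝ, ‖(cauchyInt f (x + y * Complex.I)).re‖ₑ ^ p ≤ A * ∫⁻ t, ‖f t‖ₑ ^ p

theorem cauchyInt_sub {f g : ℝ → ℝ} (hf : Integrable f) (hg : Integrable g) {z : ℂ}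
    (hz : 0 < z.im) : cauchyInt (fun t => f t - g t) z = cauchyInt f z - cauchyInt g z := by
  rw [cauchyInt, cauchyInt, cauchyInt,
    ← integral_sub (integrable_cauchyInt hf hz) (integrable_cauchyInt hg hz)]
  congr 1
  ext t
  push_cast
  ring

theorem lintegral_enorm_sub_rpow_le {α : Type*} [MeasurableSpace α] {μ : Measure α} {p : ℝ}
    (hp : 1 ≤ p) {u v : α → ℝ} (hu : AEMeasurable u μ) :
    ∫⁻ x, ‖u x - v x‖ₑ ^ p ∂μ ≤
      2 ^ (p - 1) * (∫⁻ x, ‖u x‖ₑ ^ p ∂μ + ∫⁻ x, ‖v x‖ₑ ^ p ∂μ) := by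
  have hp0 : 0 < p := by linarith
  rw [← lintegral_add_left' (hu.enorm.pow_const p),
    ← lintegral_const_mul' _ _ (ENNReal.rpow_ne_top_of_nonneg (by linarith) (by simp))]
  refine lintegral_mono fun x => ?_
  calc ‖u x - v x‖ₑ ^ p ≤ (‖u x‖ₑ + ‖v x‖ₑ) ^ p := by
        gcongr
        exact enorm_sub_le
    _ ≤ _ := ENNReal.rpow_add_le_mul_rpow_add_rpow _ _ hp

theorem rieszBound_of_le_two {p : ℝ} (hp : 1 < p) (hp2 : p ≤ 2) : RieszBound p := by
  have hp0 : 0 < p := by linarith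
  obtain ⟨A, hA⟩ := lintegral_re_rpow_le_im hp hp2
  have hpos : ∀ f : ℝ → ℝ, Integrable f → (∀ t, 0 ≤ f t) → (∃ R, ∀ t, R < |t| → f t = 0) →
      ∀ y : ℝ, 0 < y → ∫⁻ x : ℝ, ‖(cauchyInt f (x + y * Complex.I)).re‖ₑ ^ p ≤
        (A * Real.toNNReal Real.pi ^ p : ℝ≥0) * ∫⁻ t, ‖f t‖ₑ ^ p := by
    intro f hf hf0 hR y hy
    refine (hA f hf hf0 hR y hy).trans ?_
    rw [ENNReal.coe_mul, mul_assoc]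
    gcongr
    simp_rw [ofReal_cauchyInt_im hf hf0 _ hy]
    refine (lintegral_poisson_rpow_le hp hy hf.1.aemeasurable.ennreal_ofReal).trans (le_of_eq ?_)
    rw [ENNReal.coe_rpow_of_nonneg _ hp0.le]
    congr 1
    refine lintegral_congr fun t => ?_
    rw [Real.enorm_of_nonneg (hf0 t)]
  set D := (A * Real.toNNReal Real.pi ^ p : ℝ≥0) with hD
  refine ⟨2 ^ (p - 1) * (2 * D), fun f hf ⟨R, hR⟩ y hy => ?_⟩
  have h1 := hpos (fun t => max (f t) 0) hf.pos_part (fun t => le_max_right _ _)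
    ⟨R, fun t ht => by simp [hR t ht]⟩ y hy
  have h2 := hpos (fun t => max (-f t) 0) hf.neg_part (fun t => le_max_right _ _)
    ⟨R, fun t ht => by simp [hR t ht]⟩ y hy
  have hdec : ∀ x : ℝ, (cauchyInt f (x + y * Complex.I)).re =
      (cauchyInt (fun t => max (f t) 0) (x + y * Complex.I)).re -
        (cauchyInt (fun t => max (-f t) 0) (x + y * Complex.I)).re := by
    intro x
    rw [← Complex.sub_re, ← cauchyInt_sub hf.pos_part hf.neg_part (by simpa using hy)]
    congr 3
    ext t
    rcases le_total 0 (f t) with h | h <;> simp [h]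
  simp_rw [hdec]
  have hle : ∀ c : ℝ, c = 1 ∨ c = -1 → ∫⁻ t, ‖max (c * f t) 0‖ₑ ^ p ≤ ∫⁻ t, ‖f t‖ₑ ^ p := by
    intro c hc
    refine lintegral_mono fun t => ?_
    dsimp only
    gcongr
    rw [Real.enorm_eq_ofReal_abs, Real.enorm_eq_ofReal_abs]
    apply ENNReal.ofReal_le_ofReal
    rw [abs_of_nonneg (le_max_right _ _)]
    rcases hc with rfl | rfl
    · simpa using le_abs_self (f t)
    · simpa using neg_le_abs (f t)
  have hle1 := hle 1 (Or.inl rfl)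
  have hle2 := hle (-1) (Or.inr rfl)
  simp only [one_mul, neg_one_mul] at hle1 hle2
  refine (lintegral_enorm_sub_rpow_le hp.le (Complex.continuous_re.comp
    (continuous_cauchyInt_horizontal hf.pos_part hy)).aemeasurable).trans ?_
  rw [ENNReal.coe_mul, ENNReal.coe_rpow_of_nonneg _ (by linarith), mul_assoc]
  gcongr
  · simp
  calc _ ≤ D * (∫⁻ t, ‖f t‖ₑ ^ p) + D * ∫⁻ t, ‖f t‖ₑ ^ p :=
        add_le_add (h1.trans (by gcongr)) (h2.trans (by gcongr))
    _ = _ := by push_cast; ring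

/-! ### Duality -/

theorem abs_conj_poisson_le {y : ℝ} (hy : 0 < y) (s : ℝ) : |s / (s ^ 2 + y ^ 2)| ≤ y⁻¹ := by
  rw [abs_div, abs_of_pos (by positivity : 0 < s ^ 2 + y ^ 2), div_le_iff₀ (by positivity),
    inv_mul_eq_div, le_div_iff₀ hy]
  nlinarith [sq_nonneg (|s| - y), sq_abs s, abs_nonneg s, sq_nonneg s, sq_nonneg y]

/-- The conjugate Poisson kernel is odd, so the operator is skew-adjoint; Fubini applies because the
kernel is bounded by 1/y. -/
theorem integral_mul_cauchyInt_re {f g : ℝ → ℝ} (hf : Integrable f) (hg : Integrable g) {y : ℝ}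
    (hy : 0 < y) : ∫ x, g x * (cauchyInt f (x + y * Complex.I)).re =
      -∫ t, f t * (cauchyInt g (t + y * Complex.I)).re := by
  have hk : Measurable (fun z : ℝ × ℝ => (z.2 - z.1) / ((z.2 - z.1) ^ 2 + y ^ 2)) := by fun_prop
  have hint : Integrable (Function.uncurry fun x t : ℝ =>
      g x * (f t * ((t - x) / ((t - x) ^ 2 + y ^ 2)))) (volume.prod volume) := by
    have h1 := (hg.mul_prod hf).bdd_mul (c := y⁻¹) hk.aestronglyMeasurable
      (Eventually.of_forall fun z => abs_conj_poisson_le hy _)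
    refine h1.congr (Eventually.of_forall fun z => ?_)
    simp only [Function.uncurry]
    ring
  calc ∫ x, g x * (cauchyInt f (x + y * Complex.I)).re
      = ∫ x, ∫ t, g x * (f t * ((t - x) / ((t - x) ^ 2 + y ^ 2))) := by
        congr 1; ext x
        rw [cauchyInt_re hf x hy, integral_const_mul]
    _ = ∫ t, ∫ x, g x * (f t * ((t - x) / ((t - x) ^ 2 + y ^ 2))) := integral_integral_swap hint
    _ = ∫ t, -(f t * (cauchyInt g (t + y * Complex.I)).re) := by
        congr 1; ext t
        rw [cauchyInt_re hg t hy, ← integral_const_mul, ← integral_neg]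
        congr 1; ext x
        have : (t - x) ^ 2 = (x - t) ^ 2 := by ring
        rw [this]
        ring
    _ = _ := integral_neg _

/-- Division by I^(1/q) requires I to be finite. This is why the duality argument works on bounded
intervals first. -/
theorem le_rpow_of_le_mul_rpow {p q : ℝ} (hpq : p.HolderConjugate q) {I N : ℝ≥0∞} (hI : I ≠ ∞)
    (h : I ≤ N * I ^ (1 / q)) : I ≤ N ^ p := by
  rcases eq_or_ne I 0 with rfl | h0
  · exact zero_le
  have e : I ^ (1 / p) * I ^ (1 / q) = I := by
    rw [← ENNReal.rpow_add _ _ h0 hI]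
    have := hpq.inv_add_inv_eq_one
    rw [one_div, one_div, this, ENNReal.rpow_one]
  have hq0 : I ^ (1 / q) ≠ 0 := by
    simp [ENNReal.rpow_eq_zero_iff, h0, hI]
  have hq1 : I ^ (1 / q) ≠ ∞ :=
    ENNReal.rpow_ne_top_of_nonneg (by have := hpq.symm.pos; positivity) hI
  have h1 : I ^ (1 / p) ≤ N := by
    rw [← ENNReal.mul_le_mul_iff_left hq0 hq1, e]
    exact h
  calc I = (I ^ (1 / p)) ^ p := by
        rw [← ENNReal.rpow_mul, one_div, inv_mul_cancel₀ hpq.pos.ne', ENNReal.rpow_one]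
    _ ≤ N ^ p := ENNReal.rpow_le_rpow h1 hpq.nonneg

/-- On [-M, M] the p-th power integral of the conjugate Poisson integral v is its pairing with g =
v|v|^(p-2). Skew-adjointness moves the operator to g, where the bound for q applies, and the q-th
power integral of g equals the original one. Then M tends to infinity. -/
theorem RieszBound.dual {p q : ℝ} (hpq : p.HolderConjugate q) (hp2 : 2 ≤ p) (h : RieszBound q) :
    RieszBound p := by
  obtain ⟨A, hA⟩ := h
  have hp0 := hpq.pos
  have hq0 := hpq.symm.pos
  refine ⟨A ^ (p / q), fun f hf hR y hy => ?_⟩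
  set v : ℝ → ℝ := fun x => (cauchyInt f (x + y * Complex.I)).re with hv
  have hvc : Continuous v := Complex.continuous_re.comp (continuous_cauchyInt_horizontal hf hy)
  have hloc : ∀ M : ℝ, ∫⁻ x in Icc (-M) M, ‖v x‖ₑ ^ p ≤
      (A ^ (p / q) : ℝ≥0) * ∫⁻ t, ‖f t‖ₑ ^ p := by
    intro M
    set S := Icc (-M) M
    set I := ∫⁻ x in S, ‖v x‖ₑ ^ p with hI
    -- The exponent p - 2 is nonnegative, so g₀ is continuous and its restriction to [-M, M] is
    -- integrable.
    set g₀ : ℝ → ℝ := fun x => v x * |v x| ^ (p - 2) with hg₀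
    have hg₀c : Continuous g₀ :=
      hvc.mul (hvc.abs.rpow_const fun x => Or.inr (by linarith))
    set g : ℝ → ℝ := S.indicator g₀ with hg
    have hgi : Integrable g :=
      hg₀c.continuousOn.integrableOn_Icc.integrable_indicator measurableSet_Icc
    have hvg : ∀ x, v x * g₀ x = |v x| ^ p := by
      intro x
      have h1 : |v x| ^ p = |v x| ^ (2 : ℝ) * |v x| ^ (p - 2) := by
        rw [← Real.rpow_add_of_nonneg (abs_nonneg _) (by norm_num) (by linarith)]
        congr 1; ring
      rw [h1, Real.rpow_two, sq_abs, hg₀]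
      ring
    have hgq : ∀ x, ‖g₀ x‖ₑ ^ q = ‖v x‖ₑ ^ p := by
      intro x
      have h1 : |g₀ x| = |v x| ^ (p - 1) := by
        rw [hg₀, abs_mul, abs_of_nonneg (Real.rpow_nonneg (abs_nonneg _) _)]
        conv_lhs => rw [← Real.rpow_one |v x|, ← Real.rpow_mul (abs_nonneg _), one_mul]
        rw [← Real.rpow_add_of_nonneg (abs_nonneg _) (by norm_num) (by linarith)]
        congr 1; ring
      rw [Real.enorm_eq_ofReal_abs, Real.enorm_eq_ofReal_abs, h1,
        ENNReal.ofReal_rpow_of_nonneg (by positivity) hq0.le,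
        ENNReal.ofReal_rpow_of_nonneg (abs_nonneg _) hp0.le, ← Real.rpow_mul (abs_nonneg _)]
      congr 2
      exact hpq.sub_one_mul_conj
    have hIfin : I ≠ ∞ := by
      have h1 : IntegrableOn (fun x => |v x| ^ p) S :=
        (hvc.abs.rpow_const fun x => Or.inr hp0.le).continuousOn.integrableOn_Icc
      have h2 := h1.2.ne
      rw [hI]
      convert h2 using 4 with x
      rw [Real.enorm_eq_ofReal_abs, Real.enorm_of_nonneg (by positivity),
        ENNReal.ofReal_rpow_of_nonneg (abs_nonneg _) hp0.le]
    have hIeq : I = ENNReal.ofReal (∫ x, g x * v x) := by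
      have h0 : ∀ x, g x * v x = S.indicator (fun x => |v x| ^ p) x := by
        intro x
        rw [hg]
        by_cases hx : x ∈ S
        · rw [indicator_of_mem hx, indicator_of_mem hx, ← hvg x, mul_comm]
        · rw [indicator_of_notMem hx, indicator_of_notMem hx, zero_mul]
      simp_rw [h0]
      rw [integral_indicator measurableSet_Icc, ofReal_integral_eq_lintegral_ofReal
        (hvc.abs.rpow_const fun x => Or.inr hp0.le).continuousOn.integrableOn_Icc
        (Eventually.of_forall fun x => Real.rpow_nonneg (abs_nonneg _) _)]
      refine lintegral_congr fun x => ?_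
      rw [Real.enorm_eq_ofReal_abs, ENNReal.ofReal_rpow_of_nonneg (abs_nonneg _) hp0.le]
    have hgI : ∫⁻ x, ‖g x‖ₑ ^ q = I := by
      rw [hI, ← lintegral_indicator measurableSet_Icc]
      refine lintegral_congr fun x => ?_
      by_cases hx : x ∈ S
      · rw [indicator_of_mem hx, hg, indicator_of_mem hx, hgq]
      · rw [indicator_of_notMem hx, hg, indicator_of_notMem hx]
        simp [hq0]
    have hgs : ∃ R, ∀ t, R < |t| → g t = 0 := by
      refine ⟨M, fun t ht => indicator_of_notMem (fun h => ?_) _⟩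
      exact absurd (abs_le.2 h) (not_le.2 ht)
    have hmain : I ≤ (∫⁻ t, ‖f t‖ₑ ^ p) ^ (1 / p) * (A * I) ^ (1 / q) := by
      calc I = ENNReal.ofReal (-∫ t, f t * (cauchyInt g (t + y * Complex.I)).re) := by
            rw [hIeq, ← integral_mul_cauchyInt_re hf hgi hy]
        _ ≤ ‖∫ t, f t * (cauchyInt g (t + y * Complex.I)).re‖ₑ := by
            rw [Real.enorm_eq_ofReal_abs]
            exact ENNReal.ofReal_le_ofReal (neg_le_abs _)
        _ ≤ ∫⁻ t, ‖f t * (cauchyInt g (t + y * Complex.I)).re‖ₑ := enorm_integral_le_lintegral_enorm _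
        _ = ∫⁻ t, ((fun t => ‖f t‖ₑ) * fun t : ℝ => ‖(cauchyInt g (t + y * Complex.I)).re‖ₑ) t := by
            simp_rw [enorm_mul]
            rfl
        _ ≤ (∫⁻ t, ‖f t‖ₑ ^ p) ^ (1 / p) *
            (∫⁻ t : ℝ, ‖(cauchyInt g (t + y * Complex.I)).re‖ₑ ^ q) ^ (1 / q) :=
            ENNReal.lintegral_mul_le_Lp_mul_Lq _ hpq hf.1.enorm
              (Complex.continuous_re.comp (continuous_cauchyInt_horizontal hgi hy)).enorm.aemeasurable
        _ ≤ _ := by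
            gcongr
            rw [← hgI]
            exact hA g hgi hgs y hy
    rw [ENNReal.mul_rpow_of_nonneg _ _ (by positivity), ← mul_assoc] at hmain
    refine (le_rpow_of_le_mul_rpow hpq hIfin hmain).trans (le_of_eq ?_)
    rw [ENNReal.mul_rpow_of_nonneg _ _ hp0.le, ← ENNReal.rpow_mul, ← ENNReal.rpow_mul, one_div,
      inv_mul_cancel₀ hp0.ne', ENNReal.rpow_one, mul_comm, ENNReal.coe_rpow_of_nonneg _ (by positivity)]
    congr 2
    ring
  have hlim := (aecover_Icc (μ := volume) tendsto_neg_atTop_atBot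
    (tendsto_id (α := ℝ) (x := atTop))).lintegral_tendsto_of_countably_generated
    (f := fun x => ‖v x‖ₑ ^ p) (hvc.enorm.aemeasurable.pow_const p)
  exact le_of_tendsto' hlim fun M => hloc M

theorem rieszBound {p : ℝ} (hp : 1 < p) : RieszBound p := by
  rcases le_total p 2 with h | h
  · exact rieszBound_of_le_two hp h
  · have hpq := Real.HolderConjugate.conjExponent hp
    refine RieszBound.dual hpq h (rieszBound_of_le_two hpq.symm.lt ?_)
    have h1 := hpq.sub_one_mul_conj
    have h2 := hpq.symm.pos
    nlinarith

/-! ### The semigroup property of Poisson integrals -/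

theorem one_add_norm_le_mul_norm_sub {a z : ℂ} {δ : ℝ} (hδ : 0 < δ) (h : δ ≤ z.im - a.im) :
    1 + ‖z‖ ≤ ((1 + ‖a‖) / δ + 1) * ‖z - a‖ := by
  have h1 : ‖z‖ ≤ ‖a‖ + ‖z - a‖ := by
    have := norm_add_le a (z - a)
    simpa using this
  have h2 : δ ≤ ‖z - a‖ := by
    have := Complex.abs_im_le_norm (z - a)
    rw [Complex.sub_im] at this
    exact h.trans ((le_abs_self _).trans this)
  have h3 : 1 + ‖a‖ ≤ (1 + ‖a‖) / δ * ‖z - a‖ := by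
    calc 1 + ‖a‖ = (1 + ‖a‖) / δ * δ := by field_simp
      _ ≤ _ := by gcongr
  linarith

theorem integral_inv_mul_inv_eq_zero {a b : ℂ} (ha : a.im < 0) (hb : b.im < 0) :
    ∫ s : ℝ, ((s : ℂ) - a)⁻¹ * ((s : ℂ) - b)⁻¹ = 0 := by
  have hne : ∀ c : ℂ, c.im < 0 → ∀ z : ℂ, 0 ≤ z.im → z - c ≠ 0 := by
    intro c hc z hz h
    have := congrArg Complex.im h
    simp at this
    linarith
  have hbd : ∀ c : ℂ, c.im < 0 → ∀ z : ℂ, 0 ≤ z.im →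
      ‖(z - c)⁻¹‖ ≤ ((1 + ‖c‖) / (-c.im) + 1) * (1 + ‖z‖)⁻¹ := by
    intro c hc z hz
    have h1 := one_add_norm_le_mul_norm_sub (a := c) (z := z) (δ := -c.im) (by linarith)
      (by linarith)
    have h2 : 0 < ‖z - c‖ := norm_pos_iff.2 (hne c hc z hz)
    rw [norm_inv, ← div_eq_mul_inv, le_div_iff₀ (by positivity), inv_mul_le_iff₀ h2]
    linarith
  have := integral_horizontal_eq_zero (y := 0) (q := 2)
    (C := ((1 + ‖a‖) / (-a.im) + 1) * ((1 + ‖b‖) / (-b.im) + 1))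
    (G := fun z => (z - a)⁻¹ * (z - b)⁻¹) (by norm_num)
    (fun z hz => by
      have h1 := hne a ha z hz
      have h2 := hne b hb z hz
      fun_prop (disch := assumption))
    (fun z hz => by
      rw [norm_mul, Real.rpow_neg (by positivity), Real.rpow_two]
      calc _ ≤ (((1 + ‖a‖) / (-a.im) + 1) * (1 + ‖z‖)⁻¹) *
            (((1 + ‖b‖) / (-b.im) + 1) * (1 + ‖z‖)⁻¹) := by
            exact mul_le_mul (hbd a ha z hz) (hbd b hb z hz) (norm_nonneg _)
              ((norm_nonneg _).trans (hbd a ha z hz))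
        _ = _ := by rw [← inv_pow]; ring)
  simpa using this

/-- Poisson's formula for the Cauchy kernel. Subtracting from g(s) = 1/(τ - s - iσ) its value at s =
x + iy cancels the pole of the Poisson kernel in the upper half-plane. What remains is a multiple of
a product of two simple poles below the axis, whose integral is zero. -/
theorem integral_poisson_mul_inv {y σ : ℝ} (hy : 0 < y) (hσ : 0 < σ) (x τ : ℝ) :
    ∫ s : ℝ, (poisson y (s - x) : ℂ) * ((τ : ℂ) - (s + σ * Complex.I))⁻¹ =
      Real.pi * ((τ : ℂ) - (x + ((y + σ : ℝ) : ℂ) * Complex.I))⁻¹ := by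
  set g : ℝ → ℂ := fun s => ((τ : ℂ) - (s + σ * Complex.I))⁻¹ with hg
  set gw : ℂ := ((τ : ℂ) - (x + ((y + σ : ℝ) : ℂ) * Complex.I))⁻¹ with hgw
  have hsne : ∀ s : ℝ, (τ : ℂ) - (s + σ * Complex.I) ≠ 0 := fun s =>
    sub_ne_zero_of_im_pos (by simpa using hσ) τ
  have hwne : (τ : ℂ) - (x + ((y + σ : ℝ) : ℂ) * Complex.I) ≠ 0 :=
    sub_ne_zero_of_im_pos (by simp; positivity) τ
  have hint : Integrable fun s : ℝ => (poisson y (s - x) : ℂ) :=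
    ((integrable_poisson hy).comp_sub_right x).ofReal
  have hgi : Integrable fun s : ℝ => (poisson y (s - x) : ℂ) * g s := by
    refine hint.mul_bdd (c := σ⁻¹) (Measurable.aestronglyMeasurable (by fun_prop)) ?_
    refine Eventually.of_forall fun s => ?_
    rw [hg, norm_inv]
    refine inv_anti₀ hσ ?_
    have := im_le_norm_sub (s + σ * Complex.I) τ
    simpa using this
  have hkey : ∀ s : ℝ, (poisson y (s - x) : ℂ) * g s - (poisson y (s - x) : ℂ) * gw =
      (-(y : ℂ) * gw) * (((s : ℂ) - (τ - σ * Complex.I))⁻¹ * ((s : ℂ) - (x - y * Complex.I))⁻¹) := by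
    intro s
    have h1 : (s : ℂ) - (τ - σ * Complex.I) ≠ 0 := by
      intro h; apply hsne s; linear_combination -h
    have h2 : (s : ℂ) - (x - y * Complex.I) ≠ 0 := by
      intro h
      have := congrArg Complex.im h
      simp at this
      linarith
    have h3 : (s : ℂ) - (x + y * Complex.I) ≠ 0 := by
      intro h
      have := congrArg Complex.im h
      simp at this
      linarith
    have hp : (poisson y (s - x) : ℂ) =
        y * (((s : ℂ) - (x - y * Complex.I))⁻¹ * ((s : ℂ) - (x + y * Complex.I))⁻¹) := by
      have e : ((s : ℂ) - x) ^ 2 + (y : ℂ) ^ 2 =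
          ((s : ℂ) - (x - y * Complex.I)) * ((s : ℂ) - (x + y * Complex.I)) := by
        linear_combination ((y : ℂ) ^ 2) * Complex.I_sq
      unfold poisson
      push_cast
      rw [e, div_eq_mul_inv, mul_inv]
    have hg1 : g s = -((s : ℂ) - (τ - σ * Complex.I))⁻¹ := by
      rw [hg, ← inv_neg]
      ring
    have e : (τ : ℂ) - (x + ((y + σ : ℝ) : ℂ) * Complex.I) =
        ((s : ℂ) - (x + y * Complex.I)) - ((s : ℂ) - (τ - σ * Complex.I)) := by
      push_cast; ring
    rw [hg1, hgw, hp]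
    rw [e] at hwne ⊢
    generalize (s : ℂ) - (τ - σ * Complex.I) = A at *
    generalize (s : ℂ) - (x - y * Complex.I) = B at *
    generalize (s : ℂ) - (x + y * Complex.I) = D at *
    field_simp
    ring
  have hzero := integral_inv_mul_inv_eq_zero (a := τ - σ * Complex.I) (b := x - y * Complex.I)
    (by simpa using hσ) (by simpa using hy)
  have hsub : (∫ s : ℝ, (poisson y (s - x) : ℂ) * g s) - ∫ s : ℝ, (poisson y (s - x) : ℂ) * gw = 0 := by
    rw [← integral_sub hgi (hint.mul_const gw)]
    simp_rw [hkey]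
    rw [integral_const_mul, hzero, mul_zero]
  have hpi : ∫ s : ℝ, (poisson y (s - x) : ℂ) * gw = Real.pi * gw := by
    rw [integral_mul_const, integral_complex_ofReal,
      integral_sub_right_eq_self (fun s => poisson y s) x, integral_poisson hy]
  rw [← hpi]
  exact sub_eq_zero.1 hsub

/-- Fubini reduces the semigroup property to the Cauchy kernel; the kernel is bounded by 1/σ, so the
double integral converges absolutely. -/
theorem integral_poisson_mul_cauchyInt {f : ℝ → ℝ} (hf : Integrable f) {y σ : ℝ} (hy : 0 < y)
    (hσ : 0 < σ) (x : ℝ) :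
    ∫ s : ℝ, (poisson y (s - x) : ℂ) * cauchyInt f (s + σ * Complex.I) =
      Real.pi * cauchyInt f (x + ((y + σ : ℝ) : ℂ) * Complex.I) := by
  have hint : Integrable fun s : ℝ => (poisson y (s - x) : ℂ) :=
    ((integrable_poisson hy).comp_sub_right x).ofReal
  have hprod : Integrable (Function.uncurry fun s t : ℝ =>
      (poisson y (s - x) : ℂ) * ((f t : ℂ) / ((t : ℂ) - (s + σ * Complex.I))))
      (volume.prod volume) := by
    have h1 := (hint.mul_prod (hf.ofReal (𝕜 := ℂ))).mul_bdd (c := σ⁻¹)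
      (g := fun z : ℝ × ℝ => ((z.2 : ℂ) - (z.1 + σ * Complex.I))⁻¹)
      (Measurable.aestronglyMeasurable (by fun_prop)) (Eventually.of_forall fun z => by
        rw [norm_inv]
        refine inv_anti₀ hσ ?_
        have := im_le_norm_sub (z.1 + σ * Complex.I) z.2
        simpa using this)
    refine h1.congr (Eventually.of_forall fun z => ?_)
    simp only [Function.uncurry]
    rw [mul_assoc, ← div_eq_mul_inv]
    rfl
  calc ∫ s : ℝ, (poisson y (s - x) : ℂ) * cauchyInt f (s + σ * Complex.I)
      = ∫ s : ℝ, ∫ t : ℝ, (poisson y (s - x) : ℂ) *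
          ((f t : ℂ) / ((t : ℂ) - (s + σ * Complex.I))) := by
        congr 1; ext s
        rw [cauchyInt, integral_const_mul]
    _ = ∫ t : ℝ, ∫ s : ℝ, (poisson y (s - x) : ℂ) *
          ((f t : ℂ) / ((t : ℂ) - (s + σ * Complex.I))) := integral_integral_swap hprod
    _ = ∫ t : ℝ, Real.pi * ((f t : ℂ) / ((t : ℂ) - (x + ((y + σ : ℝ) : ℂ) * Complex.I))) := by
        congr 1; ext t
        rw [div_eq_mul_inv, mul_left_comm, ← integral_poisson_mul_inv hy hσ x t,
          ← integral_const_mul]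
        congr 1; ext s
        rw [div_eq_mul_inv]; ring
    _ = _ := by rw [integral_const_mul, cauchyInt]

theorem integral_poisson_mul_cauchyInt_re {f : ℝ → ℝ} (hf : Integrable f) {y σ : ℝ} (hy : 0 < y)
    (hσ : 0 < σ) (x : ℝ) :
    ∫ s : ℝ, poisson y (s - x) * (cauchyInt f (s + σ * Complex.I)).re =
      Real.pi * (cauchyInt f (x + ((y + σ : ℝ) : ℂ) * Complex.I)).re := by
  have hint : Integrable fun s : ℝ => (poisson y (s - x) : ℂ) :=
    ((integrable_poisson hy).comp_sub_right x).ofReal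
  have hgi : Integrable fun s : ℝ => (poisson y (s - x) : ℂ) * cauchyInt f (s + σ * Complex.I) := by
    refine hint.mul_bdd (c := (∫ t, |f t|) * σ⁻¹)
      (continuous_cauchyInt_horizontal hf hσ).aestronglyMeasurable ?_
    refine Eventually.of_forall fun s => ?_
    have hz : 0 < ((s : ℂ) + σ * Complex.I).im := by simpa using hσ
    calc _ ≤ ∫ t, ‖(f t : ℂ) / ((t : ℂ) - (s + σ * Complex.I))‖ := norm_integral_le_integral_norm _
      _ ≤ ∫ t, |f t| * σ⁻¹ := by
        refine integral_mono (integrable_cauchyInt hf hz).norm (hf.abs.mul_const _) fun t => ?_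
        simp only
        rw [norm_div, Complex.norm_real, Real.norm_eq_abs, div_eq_mul_inv]
        gcongr
        have := im_le_norm_sub (s + σ * Complex.I) t
        simpa using this
      _ = _ := integral_mul_const _ _
  have h1 := congrArg Complex.re (integral_poisson_mul_cauchyInt hf hy hσ x)
  rw [Complex.re_ofReal_mul, ← RCLike.re_eq_complex_re, ← integral_re hgi] at h1
  simpa only [RCLike.re_eq_complex_re, Complex.re_ofReal_mul] using h1

/-- This lets the single finite measure with density `poisson 1` control Poisson integrals at all
points and heights. -/
theorem exists_poisson_le (x : ℝ) {y : ℝ} (hy : 0 < y) :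
    ∃ C : ℝ, 0 < C ∧ ∀ s, poisson y (s - x) ≤ C * poisson 1 s := by
  refine ⟨y * (2 + (2 * x ^ 2 + 1) / y ^ 2), by positivity, fun s => ?_⟩
  unfold poisson
  rw [mul_one_div, div_le_div_iff₀ (by positivity) (by positivity)]
  have h1 : (2 + (2 * x ^ 2 + 1) / y ^ 2) * ((s - x) ^ 2 + y ^ 2) =
      2 * (s - x) ^ 2 + 2 * y ^ 2 + (2 * x ^ 2 + 1) + (2 * x ^ 2 + 1) / y ^ 2 * (s - x) ^ 2 := by
    field_simp
    ring
  have h2 : 0 ≤ (2 * x ^ 2 + 1) / y ^ 2 * (s - x) ^ 2 := by positivity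
  rw [mul_assoc y, h1]
  refine mul_le_mul_of_nonneg_left ?_ hy.le
  nlinarith [sq_nonneg (s - 2 * x), sq_nonneg y]

/-! ### Poisson integrals at Lebesgue points -/

/-- The kernel is at most 1/ε on the ball of radius ε and at most ε|t-x|^(-2) outside it; linear
growth makes both contributions bounded by multiples of G, independently of ε. -/
theorem lintegral_poisson_of_growth : ∃ C : ℝ≥0, ∀ (μ : Measure ℝ) (x : ℝ) (G : ℝ≥0∞),
    (∀ R > 0, μ (Metric.closedBall x R) ≤ G * ENNReal.ofReal (R ^ (1 : ℝ))) → ∀ ε : ℝ, 0 < ε →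
    ∫⁻ t, ENNReal.ofReal (poisson ε (t - x)) ∂μ ≤ C * G := by
  obtain ⟨D, hD⟩ := lintegral_outer_of_growth (s := 1) (a := 2) (by norm_num)
  refine ⟨1 + D, fun μ x G hμ ε hε => ?_⟩
  have hm : MeasurableSet (Metric.closedBall x ε) := Metric.isClosed_closedBall.measurableSet
  rw [← lintegral_add_compl _ hm, ENNReal.coe_add, add_mul]
  have h1 : ∀ t, ENNReal.ofReal (poisson ε (t - x)) ≤ ENNReal.ofReal ε⁻¹ := fun t => by
    apply ENNReal.ofReal_le_ofReal
    unfold poisson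
    rw [div_le_iff₀ (by positivity), inv_mul_eq_div, le_div_iff₀ hε]
    nlinarith [sq_nonneg (t - x)]
  refine add_le_add ?_ ?_
  · calc _ ≤ ∫⁻ t in Metric.closedBall x ε, ENNReal.ofReal ε⁻¹ ∂μ := lintegral_mono fun t => h1 t
      _ = ENNReal.ofReal ε⁻¹ * μ (Metric.closedBall x ε) := setLIntegral_const _ _
      _ ≤ ENNReal.ofReal ε⁻¹ * (G * ENNReal.ofReal (ε ^ (1 : ℝ))) := by gcongr; exact hμ ε hε
      _ = ENNReal.ofReal (ε⁻¹ * ε) * G := by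
          rw [Real.rpow_one, ENNReal.ofReal_mul (by positivity)]; ring
      _ = _ := by rw [inv_mul_cancel₀ hε.ne']; simp
  · have hsub : (Metric.closedBall x ε)ᶜ ⊆ {t | ε ≤ |t - x|} := fun t ht => by
      simp only [mem_compl_iff, Metric.mem_closedBall, Real.dist_eq, not_le] at ht
      exact ht.le
    calc _ ≤ ∫⁻ t in {t | ε ≤ |t - x|}, ENNReal.ofReal (poisson ε (t - x)) ∂μ :=
          lintegral_mono_set hsub
      _ ≤ ∫⁻ t in {t | ε ≤ |t - x|}, ENNReal.ofReal ε * ENNReal.ofReal (|t - x| ^ (-2 : ℝ)) ∂μ := by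
          have hms : MeasurableSet {t : ℝ | ε ≤ |t - x|} :=
            measurableSet_le measurable_const (by fun_prop : Measurable fun t : ℝ => |t - x|)
          refine setLIntegral_mono' hms fun t ht => ?_
          have ht' : 0 < |t - x| := hε.trans_le ht
          rw [← ENNReal.ofReal_mul hε.le]
          apply ENNReal.ofReal_le_ofReal
          unfold poisson
          rw [Real.rpow_neg ht'.le, Real.rpow_two, sq_abs, div_eq_mul_inv]
          have : 0 < (t - x) ^ 2 := by rw [← sq_abs]; positivity
          gcongr
          linarith [sq_nonneg ε]
      _ = ENNReal.ofReal ε * ∫⁻ t in {t | ε ≤ |t - x|}, ENNReal.ofReal (|t - x| ^ (-2 : ℝ)) ∂μ :=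
          lintegral_const_mul' _ _ ENNReal.ofReal_ne_top
      _ ≤ ENNReal.ofReal ε * (D * G * ENNReal.ofReal (ε ^ (1 - 2 : ℝ))) := by
          gcongr
          exact hD μ x G hμ ε hε
      _ = D * G * ENNReal.ofReal (ε * ε ^ (1 - 2 : ℝ)) := by
          rw [ENNReal.ofReal_mul hε.le]; ring
      _ = _ := by
          have : (1 - 2 : ℝ) = -1 := by norm_num
          rw [this, Real.rpow_neg_one, mul_inv_cancel₀ hε.ne']
          simp

theorem ae_lintegral_closedBall_le {h : ℝ → ℝ} (hh : LocallyIntegrable h) :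
    ∀ᵐ x, ∀ δ : ℝ, 0 < δ → ∃ r₀ : ℝ, 0 < r₀ ∧ ∀ r : ℝ, 0 < r → r ≤ r₀ →
      ∫⁻ t in Metric.closedBall x r, ‖h t - h x‖ₑ ≤ ENNReal.ofReal (δ * r) := by
  filter_upwards [IsUnifLocDoublingMeasure.ae_tendsto_average_norm_sub volume hh 1] with x hx δ hδ
  have h1 := hx (fun _ : ℝ => x) (fun r => r) (l := 𝓝[>] (0 : ℝ)) tendsto_id (by
    filter_upwards [self_mem_nhdsWithin] with r hr
    have hr : (0 : ℝ) < r := hr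
    simpa using hr.le)
  have h2 := h1.eventually (gt_mem_nhds (by positivity : (0 : ℝ) < δ / 2))
  obtain ⟨r₀, hr₀, hsub⟩ := mem_nhdsGT_iff_exists_Ioc_subset.1 h2
  refine ⟨r₀, hr₀, fun r hr hr' => ?_⟩
  have h3 : ⨍ t in Metric.closedBall x r, ‖h t - h x‖ < δ / 2 := hsub ⟨hr, hr'⟩
  have hint : IntegrableOn (fun t => h t - h x) (Metric.closedBall x r) :=
    (hh.integrableOn_isCompact (isCompact_closedBall x r)).sub
      (integrableOn_const (isCompact_closedBall x r).measure_lt_top.ne)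
  rw [setAverage_eq, smul_eq_mul, Measure.real, Real.volume_closedBall,
    ENNReal.toReal_ofReal (by positivity), inv_mul_lt_iff₀ (by positivity)] at h3
  rw [← ofReal_integral_norm_eq_lintegral_enorm hint]
  apply ENNReal.ofReal_le_ofReal
  linarith

/-- At a Lebesgue point the density |h - h(x)| near x has linear growth with an arbitrarily small
constant δ, so the near part is small uniformly in ε. Away from x the kernel is at most ε times a
multiple of `poisson 1`, so the far part vanishes with ε. As the absolute value is inside, the
result also covers kernels merely dominated by the Poisson kernel. -/
theorem ae_tendsto_lintegral_poisson {h : ℝ → ℝ} (hh : LocallyIntegrable h)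
    (hN : ∫⁻ t, ENNReal.ofReal (poisson 1 t) * ‖h t‖ₑ ≠ ∞) :
    ∀ᵐ x, Tendsto (fun ε => ∫⁻ t, ENNReal.ofReal (poisson ε (t - x)) * ‖h t - h x‖ₑ)
      (𝓝[>] 0) (𝓝 0) := by
  obtain ⟨C, hC⟩ := lintegral_poisson_of_growth
  have hpm : ∀ ε x : ℝ, Measurable fun t : ℝ => ENNReal.ofReal (poisson ε (t - x)) := by
    intro ε x
    unfold poisson
    fun_prop
  filter_upwards [ae_lintegral_closedBall_le hh] with x hx
  rw [ENNReal.tendsto_nhds_zero]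
  intro η hη
  obtain ⟨η', hη'0, hη'⟩ := ENNReal.lt_iff_exists_nnreal_btwn.1 hη
  have hη'pos : (0 : ℝ) < η' := by exact_mod_cast hη'0
  -- Chosen so that Cδ ≤ η'/2, also when C = 0.
  set δ : ℝ := η' / (2 * (C + 1)) with hδ
  have hδ0 : 0 < δ := by positivity
  obtain ⟨r₀, hr₀, hr⟩ := hx δ hδ0
  set B := Metric.closedBall x r₀ with hB
  have hBm : MeasurableSet B := Metric.isClosed_closedBall.measurableSet
  have hum : AEMeasurable (fun t => ‖h t - h x‖ₑ) := by
    exact (hh.aestronglyMeasurable.sub aestronglyMeasurable_const).enorm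
  set μ : Measure ℝ := (volume.restrict B).withDensity (fun t => ‖h t - h x‖ₑ) with hμ
  have hgrow : ∀ R > 0, μ (Metric.closedBall x R) ≤
      ENNReal.ofReal δ * ENNReal.ofReal (R ^ (1 : ℝ)) := by
    intro R hR
    rw [hμ, withDensity_apply _ Metric.isClosed_closedBall.measurableSet,
      Measure.restrict_restrict Metric.isClosed_closedBall.measurableSet, Real.rpow_one,
      ← ENNReal.ofReal_mul hδ0.le]
    rcases le_total R r₀ with h1 | h1
    · exact (lintegral_mono_set inter_subset_left).trans (hr R hR h1)
    · refine (lintegral_mono_set inter_subset_right).trans ((hr r₀ hr₀ le_rfl).trans ?_)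
      apply ENNReal.ofReal_le_ofReal
      gcongr
  have hnear : ∀ ε : ℝ, 0 < ε → ∫⁻ t in B, ENNReal.ofReal (poisson ε (t - x)) * ‖h t - h x‖ₑ ≤
      (η' : ℝ≥0∞) / 2 := by
    intro ε hε
    have h1 := hC μ x _ hgrow ε hε
    rw [hμ, lintegral_withDensity_eq_lintegral_mul₀ hum.restrict (hpm ε x).aemeasurable] at h1
    calc _ = ∫⁻ t in B, ((fun t => ‖h t - h x‖ₑ) * fun t =>
          ENNReal.ofReal (poisson ε (t - x))) t := by
          refine lintegral_congr fun t => ?_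
          rw [Pi.mul_apply, mul_comm]
      _ ≤ C * ENNReal.ofReal δ := h1
      _ = ENNReal.ofReal (C * δ) := by rw [ENNReal.ofReal_mul (by positivity)]; simp
      _ ≤ ENNReal.ofReal (η' / 2) := by
          apply ENNReal.ofReal_le_ofReal
          rw [hδ, mul_div_assoc', div_le_div_iff₀ (by positivity) (by positivity)]
          nlinarith [C.2, hη'pos]
      _ = _ := by rw [ENNReal.ofReal_div_of_pos (by norm_num)]; simp
  obtain ⟨D, hD0, hD⟩ := exists_poisson_le x hr₀
  set K : ℝ≥0∞ := ENNReal.ofReal (2 / r₀ * D) *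
    ((∫⁻ t, ENNReal.ofReal (poisson 1 t) * ‖h t‖ₑ) + ENNReal.ofReal Real.pi * ‖h x‖ₑ) with hK
  have hKfin : K ≠ ∞ := ENNReal.mul_ne_top ENNReal.ofReal_ne_top
    (ENNReal.add_ne_top.2 ⟨hN, ENNReal.mul_ne_top ENNReal.ofReal_ne_top enorm_ne_top⟩)
  have hfar : ∀ ε : ℝ, 0 < ε → ∫⁻ t in Bᶜ, ENNReal.ofReal (poisson ε (t - x)) * ‖h t - h x‖ₑ ≤
      ENNReal.ofReal ε * K := by
    intro ε hε
    calc _ ≤ ∫⁻ t in Bᶜ, ENNReal.ofReal ε * (ENNReal.ofReal (2 / r₀ * D) *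
          (ENNReal.ofReal (poisson 1 t) * ‖h t‖ₑ + ENNReal.ofReal (poisson 1 t) * ‖h x‖ₑ)) := by
          refine setLIntegral_mono' hBm.compl fun t ht => ?_
          rw [← mul_add, ← mul_assoc, ← mul_assoc]
          refine mul_le_mul' ?_ enorm_sub_le
          rw [← ENNReal.ofReal_mul hε.le, ← ENNReal.ofReal_mul (by positivity)]
          apply ENNReal.ofReal_le_ofReal
          have ht' : r₀ ≤ |t - x| := by
            rw [hB, mem_compl_iff, Metric.mem_closedBall, Real.dist_eq, not_le] at ht
            exact ht.le
          have ht2 : r₀ ^ 2 ≤ (t - x) ^ 2 := by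
            rw [← sq_abs (t - x)]; gcongr
          have h2 : poisson ε (t - x) ≤ ε * (2 / r₀ * poisson r₀ (t - x)) := by
            unfold poisson
            have e : ε * (2 / r₀ * (r₀ / ((t - x) ^ 2 + r₀ ^ 2))) =
              ε * 2 / ((t - x) ^ 2 + r₀ ^ 2) := by field_simp
            rw [e, div_le_div_iff₀ (by positivity) (by positivity)]
            nlinarith [sq_nonneg ε]
          calc _ ≤ ε * (2 / r₀ * poisson r₀ (t - x)) := h2
            _ ≤ ε * (2 / r₀ * (D * poisson 1 t)) := by gcongr; exact hD t
            _ = _ := by ring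
      _ ≤ ∫⁻ t, ENNReal.ofReal ε * (ENNReal.ofReal (2 / r₀ * D) *
          (ENNReal.ofReal (poisson 1 t) * ‖h t‖ₑ + ENNReal.ofReal (poisson 1 t) * ‖h x‖ₑ)) :=
          setLIntegral_le_lintegral _ _
      _ = _ := by
          rw [lintegral_const_mul' _ _ ENNReal.ofReal_ne_top,
            lintegral_const_mul' _ _ ENNReal.ofReal_ne_top, lintegral_add_right,
            lintegral_mul_const' _ _ enorm_ne_top]
          · have := lintegral_poisson one_pos 0
            simp only [sub_zero] at this
            rw [this]
          · have := hpm 1 0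
            simp only [sub_zero] at this
            exact this.mul_const _
  have hsmall : Tendsto (fun ε : ℝ => ENNReal.ofReal ε * K) (𝓝[>] 0) (𝓝 0) := by
    have h1 : Tendsto (fun ε : ℝ => ENNReal.ofReal ε) (𝓝[>] 0) (𝓝 0) := by
      have := (ENNReal.continuous_ofReal.tendsto 0).mono_left
        (nhdsWithin_le_nhds (s := Ioi (0 : ℝ)))
      simpa using this
    have := ENNReal.Tendsto.mul_const (b := K) h1 (Or.inr hKfin)
    simpa using this
  have hη2 : (0 : ℝ≥0∞) < (η' : ℝ≥0∞) / 2 := ENNReal.div_pos hη'0.ne' (by simp)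
  filter_upwards [hsmall.eventually (gt_mem_nhds hη2), self_mem_nhdsWithin] with ε h1 hε
  rw [← lintegral_add_compl _ hBm]
  calc _ ≤ (η' : ℝ≥0∞) / 2 + (η' : ℝ≥0∞) / 2 := add_le_add (hnear ε hε) ((hfar ε hε).trans h1.le)
    _ = η' := ENNReal.add_halves _
    _ ≤ η := hη'.le

/-! ### Boundary values of the conjugate Poisson integral -/

theorem integrable_conj_poisson {f : ℝ → ℝ} (hf : Integrable f) (x : ℝ) {y : ℝ} (hy : 0 < y) :
    Integrable fun t => f t * ((t - x) / ((t - x) ^ 2 + y ^ 2)) := by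
  have := (integrable_cauchyInt hf (z := x + y * Complex.I) (by simpa using hy)).re
  refine this.congr (Eventually.of_forall fun t => ?_)
  simp only
  rw [div_eq_mul_inv, RCLike.re_eq_complex_re, Complex.re_ofReal_mul, inv_sub_re]

/-- Symmetrization about x with the odd kernel leaves only differences of f, which a Lipschitz
condition can estimate. -/
theorem two_mul_cauchyInt_re {f : ℝ → ℝ} (hf : Integrable f) (x : ℝ) {y : ℝ} (hy : 0 < y) :
    Integrable (fun s => (f (s + x) - f (-s + x)) * (s / (s ^ 2 + y ^ 2))) ∧
    2 * (cauchyInt f (x + y * Complex.I)).re =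
      ∫ s, (f (s + x) - f (-s + x)) * (s / (s ^ 2 + y ^ 2)) := by
  have h1 : Integrable fun s => f (s + x) * (s / (s ^ 2 + y ^ 2)) := by
    simpa using (integrable_conj_poisson hf x hy).comp_add_right x
  have e1 : (cauchyInt f (x + y * Complex.I)).re = ∫ s, f (s + x) * (s / (s ^ 2 + y ^ 2)) := by
    rw [cauchyInt_re hf x hy, ← integral_add_right_eq_self _ x]
    simp
  have h2 := h1.comp_neg
  have e2 := integral_neg_eq_self (fun s => f (s + x) * (s / (s ^ 2 + y ^ 2))) volume
  have hpt : ∀ s, f (s + x) * (s / (s ^ 2 + y ^ 2)) + f (-s + x) * (-s / ((-s) ^ 2 + y ^ 2)) =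
      (f (s + x) - f (-s + x)) * (s / (s ^ 2 + y ^ 2)) := fun s => by
    rw [neg_sq]; ring
  refine ⟨(h1.add h2).congr (Eventually.of_forall hpt), ?_⟩
  simp_rw [← hpt]
  rw [integral_add h1 h2, e2, e1]
  ring

/-- The Lipschitz condition supplies a factor s, and s times the difference of the conjugate kernels
at heights y and z equals z `poisson z s` - y `poisson y s`, whose absolute value integrates to at
most π(y + z). -/
theorem abs_cauchyInt_re_sub_le {f : ℝ → ℝ} (hf : Integrable f) {L : ℝ≥0} (hL : LipschitzWith L f)
    (x : ℝ) {y z : ℝ} (hy : 0 < y) (hz : 0 < z) :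
    |(cauchyInt f (x + y * Complex.I)).re - (cauchyInt f (x + z * Complex.I)).re| ≤
      L * Real.pi * (y + z) := by
  obtain ⟨i1, e1⟩ := two_mul_cauchyInt_re hf x hy
  obtain ⟨i2, e2⟩ := two_mul_cauchyInt_re hf x hz
  have hker : ∀ s, |s * (s / (s ^ 2 + y ^ 2) - s / (s ^ 2 + z ^ 2))| ≤
      y * poisson y s + z * poisson z s := by
    intro s
    have e : s * (s / (s ^ 2 + y ^ 2) - s / (s ^ 2 + z ^ 2)) =
        z * poisson z s - y * poisson y s := by
      unfold poisson
      field_simp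
      ring
    have h1 := poisson_pos hy s
    have h2 := poisson_pos hz s
    rw [e, abs_le]
    constructor <;> nlinarith
  have hpt : ∀ s, ‖(f (s + x) - f (-s + x)) * (s / (s ^ 2 + y ^ 2)) -
      (f (s + x) - f (-s + x)) * (s / (s ^ 2 + z ^ 2))‖ ≤
      2 * L * (y * poisson y s + z * poisson z s) := by
    intro s
    have h1 : |f (s + x) - f (-s + x)| ≤ L * (2 * |s|) := by
      have := hL.dist_le_mul (s + x) (-s + x)
      rw [Real.dist_eq, Real.dist_eq] at this
      have e : s + x - (-s + x) = 2 * s := by ring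
      rwa [e, abs_mul, abs_two] at this
    rw [← mul_sub, Real.norm_eq_abs, abs_mul]
    calc _ ≤ L * (2 * |s|) * |s / (s ^ 2 + y ^ 2) - s / (s ^ 2 + z ^ 2)| := by gcongr
      _ = 2 * L * |s * (s / (s ^ 2 + y ^ 2) - s / (s ^ 2 + z ^ 2))| := by rw [abs_mul]; ring
      _ ≤ _ := by gcongr; exact hker s
  have h3 : 2 * |(cauchyInt f (x + y * Complex.I)).re - (cauchyInt f (x + z * Complex.I)).re| ≤
      2 * (L * Real.pi * (y + z)) := by
    calc _ = ‖∫ s, ((f (s + x) - f (-s + x)) * (s / (s ^ 2 + y ^ 2)) -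
          (f (s + x) - f (-s + x)) * (s / (s ^ 2 + z ^ 2)))‖ := by
          rw [integral_sub i1 i2, ← e1, ← e2, ← mul_sub, Real.norm_eq_abs, abs_mul, abs_two]
      _ ≤ ∫ s, 2 * L * (y * poisson y s + z * poisson z s) :=
          norm_integral_le_of_norm_le ((((integrable_poisson hy).const_mul y).add
            ((integrable_poisson hz).const_mul z)).const_mul _) (Eventually.of_forall hpt)
      _ = _ := by
          rw [integral_const_mul, integral_add ((integrable_poisson hy).const_mul y)
            ((integrable_poisson hz).const_mul z), integral_const_mul, integral_const_mul,
            integral_poisson hy, integral_poisson hz]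
          ring
  linarith

/-! ### Convergence in L^1 of the Poisson measure. -/

/-- The finite measure with the density of the Poisson kernel. -/
def poissonMeasure : Measure ℝ := volume.withDensity fun s => ENNReal.ofReal (poisson 1 s)

theorem measurable_poisson (y : ℝ) : Measurable (poisson y) := by
  unfold poisson; fun_prop

theorem lintegral_poissonMeasure {u : ℝ → ℝ≥0∞} (hu : AEMeasurable u) :
    ∫⁻ s, u s ∂poissonMeasure = ∫⁻ s, ENNReal.ofReal (poisson 1 s) * u s := by
  rw [poissonMeasure, lintegral_withDensity_eq_lintegral_mul₀
    (measurable_poisson 1).ennreal_ofReal.aemeasurable hu]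
  rfl

theorem lintegral_poissonMeasure_one : poissonMeasure univ = ENNReal.ofReal Real.pi := by
  have h := lintegral_poissonMeasure (u := fun _ => 1) aemeasurable_const
  have h2 := lintegral_poisson one_pos 0
  simp only [sub_zero, lintegral_one, mul_one] at h h2
  rw [h, h2]

theorem ae_poissonMeasure_iff {P : ℝ → Prop} : (∀ᵐ s ∂poissonMeasure, P s) ↔ ∀ᵐ s, P s := by
  rw [poissonMeasure, ae_withDensity_iff (measurable_poisson 1).ennreal_ofReal]
  have : ∀ s, ENNReal.ofReal (poisson 1 s) ≠ 0 := fun s => by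
    simpa using poisson_pos one_pos s
  simp [this]

instance : IsFiniteMeasure poissonMeasure :=
  ⟨by rw [lintegral_poissonMeasure_one]; exact ENNReal.ofReal_lt_top⟩

theorem aestronglyMeasurable_poissonMeasure_iff {u : ℝ → ℝ} :
    AEStronglyMeasurable u poissonMeasure ↔ AEStronglyMeasurable u := by
  constructor
  · rintro ⟨g, hg, h⟩
    exact ⟨g, hg, ae_poissonMeasure_iff.1 h⟩
  · rintro ⟨g, hg, h⟩
    exact ⟨g, hg, ae_poissonMeasure_iff.2 h⟩

theorem lintegral_poissonMeasure_le {p : ℝ} (hp : 1 < p) {u : ℝ → ℝ≥0∞} (hu : AEMeasurable u) :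
    (∫⁻ s, u s ∂poissonMeasure) ^ p ≤ ENNReal.ofReal Real.pi ^ (p - 1) * ∫⁻ s, u s ^ p := by
  have h2 := lintegral_poisson one_pos 0
  simp only [sub_zero] at h2
  rw [lintegral_poissonMeasure hu]
  refine (lintegral_mul_rpow_le hp (measurable_poisson 1).ennreal_ofReal.aemeasurable hu).trans ?_
  rw [h2]
  gcongr with s
  refine mul_le_of_le_one_left zero_le ?_
  rw [ENNReal.ofReal_le_one]
  unfold poisson
  rw [div_le_one (by positivity)]
  nlinarith [sq_nonneg s]

/-- Conjugate Poisson integrals at heights tending to zero form a Cauchy family. -/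
theorem cauchy_conj_poisson {p : ℝ} (hp : 1 < p) {f : ℝ → ℝ} (hf : Integrable f)
    (hs : ∃ R, ∀ t, R < |t| → f t = 0) (hfp : MemLp f (ENNReal.ofReal p)) {η : ℝ} (hη : 0 < η) :
    ∃ δ > 0, ∀ y z : ℝ, 0 < y → y < δ → 0 < z → z < δ →
      ∫⁻ x, ‖(cauchyInt f (x + y * Complex.I)).re - (cauchyInt f (x + z * Complex.I)).re‖ₑ
        ∂poissonMeasure ≤ ENNReal.ofReal η := by
  have hp0 : 0 < p := by linarith
  obtain ⟨A, hA⟩ := rieszBound hp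
  have hc : ∀ (g : ℝ → ℝ) (hg : Integrable g) (y : ℝ) (hy : 0 < y),
      Continuous fun x : ℝ => (cauchyInt g (x + y * Complex.I)).re := fun g hg y hy =>
    Complex.continuous_re.comp (continuous_cauchyInt_horizontal hg hy)
  -- The approximation error ε is taken so small that π^(p-1) A ε^p ≤ (η/3)^p; the summand 1 keeps
  -- the divisor positive.
  set π' : ℝ := Real.pi ^ (p - 1) * A + 1 with hπ'
  have hπ0 : 0 < π' := by positivity
  set ε : ℝ := η / 3 / π' ^ (1 / p) with hε
  have hε0 : 0 < ε := by positivity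
  have hpE : ENNReal.ofReal p ≠ 0 := by simpa using hp0
  -- Approximation in L^p by a smooth function g of compact support. The Riesz bound controls f - g
  -- uniformly in the height, and g is Lipschitz, so its conjugate Poisson integrals at two small
  -- heights are uniformly close.
  obtain ⟨g, hgs, hgc, hgε⟩ := hfp.exist_eLpNorm_sub_le ENNReal.ofReal_ne_top
    (by simpa using hp.le) hε0
  obtain ⟨L, hL⟩ := hgc.lipschitzWith_of_hasCompactSupport hgs (by simp)
  have hgi : Integrable g := hgc.continuous.integrable_of_hasCompactSupport hgs
  have hfg : Integrable fun t => f t - g t := hf.sub hgi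
  have hsupp : ∃ R, ∀ t, R < |t| → f t - g t = 0 := by
    obtain ⟨R, hR⟩ := hs
    obtain ⟨R', hR'⟩ := hgs.isCompact.isBounded.subset_closedBall 0
    refine ⟨max R R', fun t ht => ?_⟩
    have hgt : g t = 0 := image_eq_zero_of_notMem_tsupport fun h => by
      have := hR' h
      rw [Metric.mem_closedBall, Real.dist_eq, sub_zero] at this
      linarith [le_max_right R R']
    rw [hR t ((le_max_left _ _).trans_lt ht), hgt, sub_zero]
  have hsmall : ∀ y : ℝ, 0 < y →
      ∫⁻ x, ‖(cauchyInt (fun t => f t - g t) (x + y * Complex.I)).re‖ₑ ∂poissonMeasure ≤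
        ENNReal.ofReal (η / 3) := by
    intro y hy
    rw [← ENNReal.rpow_le_rpow_iff hp0]
    refine (lintegral_poissonMeasure_le hp (hc _ hfg y hy).enorm.aemeasurable).trans ?_
    have h1 := hA _ hfg hsupp y hy
    have h2 : ∫⁻ t, ‖f t - g t‖ₑ ^ p ≤ ENNReal.ofReal (ε ^ p) := by
      rw [eLpNorm_eq_lintegral_rpow_enorm_toReal hpE ENNReal.ofReal_ne_top,
        ENNReal.toReal_ofReal hp0.le] at hgε
      have h3 := ENNReal.rpow_le_rpow hgε hp0.le
      rw [← ENNReal.rpow_mul, one_div, inv_mul_cancel₀ hp0.ne', ENNReal.rpow_one,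
        ENNReal.ofReal_rpow_of_nonneg hε0.le hp0.le] at h3
      exact h3
    calc _ ≤ ENNReal.ofReal Real.pi ^ (p - 1) * (A * ENNReal.ofReal (ε ^ p)) := by
          gcongr
          exact h1.trans (by gcongr)
      _ = ENNReal.ofReal (Real.pi ^ (p - 1) * (A * ε ^ p)) := by
          rw [ENNReal.ofReal_mul (by positivity), ENNReal.ofReal_mul (by positivity),
            ENNReal.ofReal_rpow_of_nonneg Real.pi_pos.le (by linarith)]
          simp
      _ ≤ ENNReal.ofReal ((η / 3) ^ p) := by
          apply ENNReal.ofReal_le_ofReal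
          rw [hε, Real.div_rpow (by positivity) (by positivity), ← Real.rpow_mul (by positivity),
            one_div, inv_mul_cancel₀ hp0.ne', Real.rpow_one, mul_div_assoc', mul_div_assoc',
            div_le_iff₀ hπ0, hπ']
          have : 0 < (η / 3) ^ p := by positivity
          nlinarith
      _ = _ := by rw [ENNReal.ofReal_rpow_of_nonneg (by positivity) hp0.le]
  set K : ℝ := L * Real.pi * 2 * Real.pi + 1 with hK
  have hK0 : 0 < K := by positivity
  refine ⟨η / 3 / K, by positivity, fun y z hy hyδ hz hzδ => ?_⟩
  have hdec : ∀ (w : ℝ), 0 < w → ∀ x : ℝ, (cauchyInt f (x + w * Complex.I)).re =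
      (cauchyInt (fun t => f t - g t) (x + w * Complex.I)).re +
        (cauchyInt g (x + w * Complex.I)).re := by
    intro w hw x
    rw [cauchyInt_sub hf hgi (by simpa using hw), Complex.sub_re]
    ring
  have hmid : ∫⁻ x, ‖(cauchyInt g (x + y * Complex.I)).re -
      (cauchyInt g (x + z * Complex.I)).re‖ₑ ∂poissonMeasure ≤ ENNReal.ofReal (η / 3) := by
    calc _ ≤ ∫⁻ x, ENNReal.ofReal (L * Real.pi * (y + z)) ∂poissonMeasure := by
          refine lintegral_mono fun x => ?_
          rw [Real.enorm_eq_ofReal_abs]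
          exact ENNReal.ofReal_le_ofReal (abs_cauchyInt_re_sub_le hgi hL x hy hz)
      _ = ENNReal.ofReal (L * Real.pi * (y + z) * Real.pi) := by
          rw [lintegral_const, lintegral_poissonMeasure_one, ← ENNReal.ofReal_mul (by positivity)]
      _ ≤ _ := by
          apply ENNReal.ofReal_le_ofReal
          rw [lt_div_iff₀ hK0] at hyδ hzδ
          have : 0 ≤ L * Real.pi * Real.pi := by positivity
          nlinarith
  calc _ ≤ ∫⁻ x, (‖(cauchyInt (fun t => f t - g t) (x + y * Complex.I)).re‖ₑ +
        (‖(cauchyInt g (x + y * Complex.I)).re - (cauchyInt g (x + z * Complex.I)).re‖ₑ +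
        ‖(cauchyInt (fun t => f t - g t) (x + z * Complex.I)).re‖ₑ)) ∂poissonMeasure := by
        refine lintegral_mono fun x => ?_
        dsimp only
        rw [hdec y hy x, hdec z hz x]
        have e : ∀ a b c d : ℝ, a + b - (c + d) = a + ((b - d) - c) := fun a b c d => by ring
        rw [e]
        refine (enorm_add_le _ _).trans (add_le_add le_rfl ?_)
        exact enorm_sub_le
    _ = _ := by
        have hm : Measurable fun x : ℝ => ‖(cauchyInt g (x + y * Complex.I)).re -
            (cauchyInt g (x + z * Complex.I)).re‖ₑ :=
          ((hc _ hgi y hy).sub (hc _ hgi z hz)).enorm.measurable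
        rw [lintegral_add_left (hc _ hfg y hy).enorm.measurable, lintegral_add_left hm]
    _ ≤ ENNReal.ofReal (η / 3) + (ENNReal.ofReal (η / 3) + ENNReal.ofReal (η / 3)) :=
        add_le_add (hsmall y hy) (add_le_add hmid (hsmall z hz))
    _ = _ := by
        rw [← ENNReal.ofReal_add (by positivity) (by positivity),
          ← ENNReal.ofReal_add (by positivity) (by positivity)]
        congr 1
        ring

theorem integrable_conj_poisson_poissonMeasure {f : ℝ → ℝ} (hf : Integrable f) {y : ℝ}
    (hy : 0 < y) :
    Integrable (fun x : ℝ => (cauchyInt f (x + y * Complex.I)).re) poissonMeasure := by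
  have hc : Continuous fun x : ℝ => (cauchyInt f (x + y * Complex.I)).re :=
    Complex.continuous_re.comp (continuous_cauchyInt_horizontal hf hy)
  refine Integrable.of_bound hc.aestronglyMeasurable (∫ t, |f t| * y⁻¹)
    (Eventually.of_forall fun x => ?_)
  rw [cauchyInt_re hf x hy]
  refine norm_integral_le_of_norm_le (hf.abs.mul_const _) (Eventually.of_forall fun t => ?_)
  rw [norm_mul, Real.norm_eq_abs, Real.norm_eq_abs]
  gcongr
  exact abs_conj_poisson_le hy _

/-- Existence of the boundary function. -/
theorem exists_conj_poisson_limit {p : ℝ} (hp : 1 < p) {f : ℝ → ℝ} (hf : Integrable f)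
    (hs : ∃ R, ∀ t, R < |t| → f t = 0) (hfp : MemLp f (ENNReal.ofReal p)) :
    ∃ h : ℝ → ℝ, Integrable h poissonMeasure ∧ ∃ σ : ℕ → ℝ, (∀ n, 0 < σ n) ∧
      Tendsto σ atTop (𝓝 0) ∧
      Tendsto (fun n => ∫⁻ x, ‖(cauchyInt f (x + σ n * Complex.I)).re - h x‖ₑ ∂poissonMeasure)
        atTop (𝓝 0) := by
  set σ : ℕ → ℝ := fun n => 1 / ((n : ℝ) + 1) with hσ
  have hσ0 : ∀ n, 0 < σ n := fun n => by positivity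
  have hσt : Tendsto σ atTop (𝓝 0) := tendsto_one_div_add_atTop_nhds_zero_nat
  set v : ℕ → ℝ → ℝ := fun n x => (cauchyInt f (x + σ n * Complex.I)).re with hv
  have hvi : ∀ n, MemLp (v n) 1 poissonMeasure := fun n =>
    memLp_one_iff_integrable.2 (integrable_conj_poisson_poissonMeasure hf (hσ0 n))
  have hcau : CauchySeq fun n => (hvi n).toLp (v n) := by
    rw [Metric.cauchySeq_iff]
    intro ε hε
    obtain ⟨δ, hδ, h⟩ := cauchy_conj_poisson hp hf hs hfp (half_pos hε)
    obtain ⟨N, hN⟩ := eventually_atTop.1 (hσt.eventually (gt_mem_nhds hδ))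
    refine ⟨N, fun m hm n hn => ?_⟩
    rw [Lp.dist_def, eLpNorm_congr_ae ((hvi m).coeFn_toLp.sub (hvi n).coeFn_toLp),
      eLpNorm_one_eq_lintegral_enorm]
    have h1 := h (σ m) (σ n) (hσ0 m) (hN m hm) (hσ0 n) (hN n hn)
    refine lt_of_le_of_lt (ENNReal.toReal_le_of_le_ofReal (by positivity) h1) (by linarith)
  obtain ⟨H, hH⟩ := cauchySeq_tendsto_of_complete hcau
  refine ⟨H, memLp_one_iff_integrable.1 (Lp.memLp H), σ, hσ0, hσt, ?_⟩
  rw [Lp.tendsto_Lp_iff_tendsto_eLpNorm'] at hH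
  refine hH.congr fun n => ?_
  rw [eLpNorm_congr_ae ((hvi n).coeFn_toLp.sub (ae_eq_refl H)), eLpNorm_one_eq_lintegral_enorm]
  rfl

/-! ### The Hilbert transform as a principal value -/

theorem lintegral_poisson_mul_le {u : ℝ → ℝ} (hu : AEStronglyMeasurable u) {x y C : ℝ}
    (hy : 0 < y) (hC : ∀ s, poisson y (s - x) ≤ C * poisson 1 s) :
    ∫⁻ s, ‖poisson y (s - x) * u s‖ₑ ≤ ENNReal.ofReal C * ∫⁻ s, ‖u s‖ₑ ∂poissonMeasure := by
  rw [lintegral_poissonMeasure hu.enorm, ← lintegral_const_mul' _ _ ENNReal.ofReal_ne_top]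
  refine lintegral_mono fun s => ?_
  rw [enorm_mul, ← mul_assoc, Real.enorm_of_nonneg (poisson_pos hy _).le,
    ← ENNReal.ofReal_mul' (poisson_pos one_pos s).le]
  gcongr
  exact hC s

theorem integrable_poisson_mul {u : ℝ → ℝ} (hu : Integrable u poissonMeasure) (x : ℝ) {y : ℝ}
    (hy : 0 < y) : Integrable fun s => poisson y (s - x) * u s := by
  have hum := aestronglyMeasurable_poissonMeasure_iff.1 hu.1
  obtain ⟨C, -, hC⟩ := exists_poisson_le x hy
  refine ⟨?_, (lintegral_poisson_mul_le hum hy hC).trans_lt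
    (ENNReal.mul_lt_top ENNReal.ofReal_lt_top hu.2)⟩
  exact (((measurable_poisson y).comp (by fun_prop)).aestronglyMeasurable).mul hum

theorem locallyIntegrable_of_poissonMeasure {u : ℝ → ℝ} (hu : Integrable u poissonMeasure) :
    LocallyIntegrable u := by
  have h1 := integrable_poisson_mul hu 0 one_pos
  simp only [sub_zero] at h1
  rw [locallyIntegrable_iff]
  intro K hK
  have h2 := (h1.integrableOn (s := K)).continuousOn_mul (g := fun s => (poisson 1 s)⁻¹)
    ((continuous_poisson one_pos).inv₀ fun s => (poisson_pos one_pos s).ne').continuousOn hK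
  refine h2.congr (Eventually.of_forall fun s => ?_)
  simp only
  rw [inv_mul_cancel_left₀ (poisson_pos one_pos s).ne']

/-- The semigroup identity holds with the boundary function replaced by the conjugate Poisson
integral at height σ n. As n grows, one side converges by continuity of the Cauchy integral at x +
iy, the other by convergence in L^1 of the Poisson measure. -/
theorem conj_poisson_eq_integral {f : ℝ → ℝ} (hf : Integrable f) {h : ℝ → ℝ}
    (hh : Integrable h poissonMeasure) {σ : ℕ → ℝ} (hσ0 : ∀ n, 0 < σ n)
    (hσ : Tendsto σ atTop (𝓝 0))
    (hlim : Tendsto (fun n => ∫⁻ x, ‖(cauchyInt f (x + σ n * Complex.I)).re - h x‖ₑ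
      ∂poissonMeasure) atTop (𝓝 0)) (x : ℝ) {y : ℝ} (hy : 0 < y) :
    Real.pi * (cauchyInt f (x + y * Complex.I)).re = ∫ s, poisson y (s - x) * h s := by
  have h1 : Tendsto (fun n => Real.pi * (cauchyInt f (x + ((y + σ n : ℝ) : ℂ) * Complex.I)).re)
      atTop (𝓝 (Real.pi * (cauchyInt f (x + y * Complex.I)).re)) := by
    have hc := (differentiableAt_cauchyInt hf (z := x + y * Complex.I)
      (by simpa using hy)).continuousAt
    have hz : Tendsto (fun n => (x + ((y + σ n : ℝ) : ℂ) * Complex.I)) atTop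
        (𝓝 (x + y * Complex.I)) := by
      have h2 : Tendsto (fun n => y + σ n) atTop (𝓝 y) := by simpa using hσ.const_add y
      exact (((Complex.continuous_ofReal.tendsto y).comp h2).mul_const Complex.I).const_add (x : ℂ)
    exact ((Complex.continuous_re.tendsto _).comp (hc.tendsto.comp hz)).const_mul Real.pi
  refine tendsto_nhds_unique h1 ?_
  rw [tendsto_iff_edist_tendsto_0]
  obtain ⟨C, -, hC⟩ := exists_poisson_le x hy
  have hz : Tendsto (fun n => ENNReal.ofReal C * ∫⁻ x, ‖(cauchyInt f (x + σ n * Complex.I)).re -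
      h x‖ₑ ∂poissonMeasure) atTop (𝓝 0) := by
    simpa using ENNReal.Tendsto.const_mul hlim (Or.inr ENNReal.ofReal_ne_top)
  refine tendsto_of_tendsto_of_tendsto_of_le_of_le tendsto_const_nhds hz (fun _ => zero_le)
    fun n => ?_
  have hi := integrable_conj_poisson_poissonMeasure hf (hσ0 n)
  dsimp only
  rw [← integral_poisson_mul_cauchyInt_re hf hy (hσ0 n) x, edist_eq_enorm_sub,
    ← integral_sub (integrable_poisson_mul hi x hy) (integrable_poisson_mul hh x hy)]
  refine (enorm_integral_le_lintegral_enorm _).trans ?_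
  simp_rw [← mul_sub]
  exact lintegral_poisson_mul_le
    (aestronglyMeasurable_poissonMeasure_iff.1 (hi.sub hh).1) hy hC

/-- By the previous identity this is convergence of Poisson integrals of h at its Lebesgue points.
-/
theorem ae_tendsto_conj_poisson {f : ℝ → ℝ} (hf : Integrable f) {h : ℝ → ℝ}
    (hh : Integrable h poissonMeasure) {σ : ℕ → ℝ} (hσ0 : ∀ n, 0 < σ n)
    (hσ : Tendsto σ atTop (𝓝 0))
    (hlim : Tendsto (fun n => ∫⁻ x, ‖(cauchyInt f (x + σ n * Complex.I)).re - h x‖ₑ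
      ∂poissonMeasure) atTop (𝓝 0)) :
    ∀ᵐ x : ℝ, Tendsto (fun y : ℝ => (cauchyInt f (x + y * Complex.I)).re) (𝓝[>] 0) (𝓝 (h x)) := by
  have hN : ∫⁻ t, ENNReal.ofReal (poisson 1 t) * ‖h t‖ₑ ≠ ∞ := by
    rw [← lintegral_poissonMeasure (aestronglyMeasurable_poissonMeasure_iff.1 hh.1).enorm]
    exact hh.2.ne
  filter_upwards [ae_tendsto_lintegral_poisson (locallyIntegrable_of_poissonMeasure hh) hN]
    with x hx
  have h1 : Tendsto (fun y : ℝ => Real.pi * (cauchyInt f (x + y * Complex.I)).re) (𝓝[>] 0)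
      (𝓝 (Real.pi * h x)) := by
    rw [tendsto_iff_edist_tendsto_0]
    refine tendsto_of_tendsto_of_tendsto_of_le_of_le' tendsto_const_nhds hx
      (Eventually.of_forall fun _ => zero_le) ?_
    filter_upwards [self_mem_nhdsWithin] with y hy
    have hy : 0 < y := hy
    have hint : Integrable fun s => poisson y (s - x) := (integrable_poisson hy).comp_sub_right x
    have e : ∫ s, poisson y (s - x) * h x = Real.pi * h x := by
      rw [integral_mul_const, integral_sub_right_eq_self (fun s => poisson y s) x,
        integral_poisson hy]
    rw [conj_poisson_eq_integral hf hh hσ0 hσ hlim x hy, edist_eq_enorm_sub, ← e,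
      ← integral_sub (integrable_poisson_mul hh x hy) (hint.mul_const _)]
    refine (enorm_integral_le_lintegral_enorm _).trans (le_of_eq ?_)
    refine lintegral_congr fun s => ?_
    rw [← mul_sub, enorm_mul, Real.enorm_of_nonneg (poisson_pos hy _).le]
  have h2 := h1.const_mul Real.pi⁻¹
  simpa [inv_mul_cancel_left₀ Real.pi_ne_zero] using h2

/-- The difference of the truncated Hilbert kernel and the conjugate Poisson kernel. -/
def truncDiff (ε s : ℝ) : ℝ := (if ε < |s| then s⁻¹ else 0) - s / (s ^ 2 + ε ^ 2)

theorem abs_truncDiff_le {ε : ℝ} (hε : 0 < ε) (s : ℝ) : |truncDiff ε s| ≤ poisson ε s := by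
  unfold truncDiff poisson
  have hden : 0 < s ^ 2 + ε ^ 2 := by positivity
  split_ifs with h
  · have hs : 0 < |s| := hε.trans h
    have hs0 : s ≠ 0 := abs_pos.1 hs
    have e : s⁻¹ - s / (s ^ 2 + ε ^ 2) = ε ^ 2 / (s * (s ^ 2 + ε ^ 2)) := by
      field_simp; ring
    rw [e, abs_div, abs_mul, abs_of_pos hden, abs_of_pos (by positivity : 0 < ε ^ 2),
      div_le_div_iff₀ (by positivity) hden]
    have : ε * ε ≤ ε * |s| := by gcongr
    nlinarith
  · push Not at h
    rw [zero_sub, abs_neg, abs_div, abs_of_pos hden]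
    gcongr

theorem measurable_truncDiff (ε : ℝ) : Measurable (truncDiff ε) := by
  unfold truncDiff
  refine Measurable.sub (Measurable.ite ?_ measurable_inv measurable_const) (by fun_prop)
  exact measurableSet_lt measurable_const (by fun_prop)

theorem integral_truncDiff (ε : ℝ) : ∫ s, truncDiff ε s = 0 := by
  have h1 : ∀ s, truncDiff ε (-s) = -truncDiff ε s := by
    intro s
    unfold truncDiff
    rw [abs_neg, neg_sq]
    split_ifs
    · rw [inv_neg]; ring
    · ring
  have h2 := integral_neg_eq_self (truncDiff ε) volume
  simp_rw [h1] at h2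
  rw [integral_neg] at h2
  linarith

theorem integrable_truncDiff {ε : ℝ} (hε : 0 < ε) : Integrable (truncDiff ε) :=
  (integrable_poisson hε).mono' (measurable_truncDiff ε).aestronglyMeasurable
    (Eventually.of_forall fun s => abs_truncDiff_le hε s)

theorem poisson_le_inv {ε : ℝ} (hε : 0 < ε) (s : ℝ) : poisson ε s ≤ ε⁻¹ := by
  unfold poisson
  rw [div_le_iff₀ (by positivity), inv_mul_eq_div, le_div_iff₀ hε]
  nlinarith [sq_nonneg s]

/-- The kernel `truncDiff ε` is odd, so its integral is zero and f(t) may be replaced by f(t) -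
f(x); it is dominated by the Poisson kernel. -/
theorem enorm_truncated_sub_le {f : ℝ → ℝ} (hf : Integrable f) (x : ℝ) {ε : ℝ} (hε : 0 < ε) :
    ‖(∫ t in (Metric.closedBall x ε)ᶜ, f t / (t - x)) - (cauchyInt f (x + ε * Complex.I)).re‖ₑ ≤
      ∫⁻ t, ENNReal.ofReal (poisson ε (t - x)) * ‖f t - f x‖ₑ := by
  have hm : MeasurableSet (Metric.closedBall x ε)ᶜ := Metric.isClosed_closedBall.measurableSet.compl
  have hk : Integrable fun t => truncDiff ε (t - x) := (integrable_truncDiff hε).comp_sub_right x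
  have hfk : Integrable fun t => f t * truncDiff ε (t - x) := by
    refine hf.mul_bdd (c := ε⁻¹) hk.1 (Eventually.of_forall fun t => ?_)
    exact (abs_truncDiff_le hε _).trans (poisson_le_inv hε _)
  have h0 : ∫ t, f x * truncDiff ε (t - x) = 0 := by
    rw [integral_const_mul, integral_sub_right_eq_self (fun s => truncDiff ε s) x,
      integral_truncDiff, mul_zero]
  have hpt : ∀ t, f t * truncDiff ε (t - x) =
      (Metric.closedBall x ε)ᶜ.indicator (fun t => f t / (t - x)) t -
        f t * ((t - x) / ((t - x) ^ 2 + ε ^ 2)) := by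
    intro t
    unfold truncDiff
    by_cases ht : t ∈ (Metric.closedBall x ε)ᶜ
    · rw [indicator_of_mem ht]
      rw [mem_compl_iff, Metric.mem_closedBall, Real.dist_eq, not_le] at ht
      rw [if_pos ht]
      ring
    · rw [indicator_of_notMem ht]
      rw [mem_compl_iff, Metric.mem_closedBall, Real.dist_eq, not_le] at ht
      rw [if_neg ht]
      ring
  have hind : Integrable ((Metric.closedBall x ε)ᶜ.indicator (fun t => f t / (t - x))) := by
    refine (hfk.add (integrable_conj_poisson hf x hε)).congr (Eventually.of_forall fun t => ?_)
    rw [Pi.add_apply, hpt t]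
    ring
  have e : (∫ t in (Metric.closedBall x ε)ᶜ, f t / (t - x)) -
      (cauchyInt f (x + ε * Complex.I)).re = ∫ t, (f t - f x) * truncDiff ε (t - x) := by
    have h1 : ∫ t, (f t - f x) * truncDiff ε (t - x) = ∫ t, f t * truncDiff ε (t - x) := by
      simp_rw [sub_mul]
      rw [integral_sub hfk (hk.const_mul _), h0, sub_zero]
    rw [h1]
    simp_rw [hpt]
    rw [integral_sub hind (integrable_conj_poisson hf x hε), integral_indicator hm,
      cauchyInt_re hf x hε]
  rw [e]
  refine (enorm_integral_le_lintegral_enorm _).trans (lintegral_mono fun t => ?_)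
  dsimp only
  rw [enorm_mul, mul_comm]
  gcongr
  rw [Real.enorm_eq_ofReal_abs]
  exact ENNReal.ofReal_le_ofReal (abs_truncDiff_le hε _)

/-- **M. Riesz**: the Hilbert transform exists almost everywhere and is bounded in `L^p`. -/
theorem hilbert_real {p : ℝ} (hp : 1 < p) : ∃ A : ℝ≥0, ∀ f : ℝ → ℝ, Integrable f →
    (∃ R, ∀ t, R < |t| → f t = 0) → ∫⁻ t, ‖f t‖ₑ ^ p ≠ ∞ →
    ∃ h : ℝ → ℝ, AEStronglyMeasurable h ∧
      (∀ᵐ x, Tendsto (fun ε => ∫ t in (Metric.closedBall x ε)ᶜ, f t / (t - x)) (𝓝[>] 0)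
        (𝓝 (h x))) ∧
      ∫⁻ x, ‖h x‖ₑ ^ p ≤ A * ∫⁻ t, ‖f t‖ₑ ^ p := by
  have hp0 : 0 < p := by linarith
  obtain ⟨A, hA⟩ := rieszBound hp
  refine ⟨A, fun f hf hs hfp => ?_⟩
  have hmem : MemLp f (ENNReal.ofReal p) := by
    refine ⟨hf.1, ?_⟩
    rw [eLpNorm_eq_lintegral_rpow_enorm_toReal (by simpa using hp0) ENNReal.ofReal_ne_top,
      ENNReal.toReal_ofReal hp0.le]
    exact ENNReal.rpow_lt_top_of_nonneg (by positivity) hfp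
  obtain ⟨h, hh, σ, hσ0, hσ, hlim⟩ := exists_conj_poisson_limit hp hf hs hmem
  have hae := ae_tendsto_conj_poisson hf hh hσ0 hσ hlim
  refine ⟨h, aestronglyMeasurable_poissonMeasure_iff.1 hh.1, ?_, ?_⟩
  · have hN : ∫⁻ t, ENNReal.ofReal (poisson 1 t) * ‖f t‖ₑ ≠ ∞ := by
      refine ne_top_of_le_ne_top hf.2.ne (lintegral_mono fun t => ?_)
      refine mul_le_of_le_one_left zero_le ?_
      rw [ENNReal.ofReal_le_one]
      simpa using poisson_le_inv one_pos t
    filter_upwards [hae, ae_tendsto_lintegral_poisson hf.locallyIntegrable hN] with x h1 h2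
    have h3 : Tendsto (fun ε => (∫ t in (Metric.closedBall x ε)ᶜ, f t / (t - x)) -
        (cauchyInt f (x + ε * Complex.I)).re) (𝓝[>] 0) (𝓝 0) := by
      rw [tendsto_iff_edist_tendsto_0]
      refine tendsto_of_tendsto_of_tendsto_of_le_of_le' tendsto_const_nhds h2
        (Eventually.of_forall fun _ => zero_le) ?_
      filter_upwards [self_mem_nhdsWithin] with ε hε
      rw [edist_zero_right]
      exact enorm_truncated_sub_le hf x hε
    simpa using h3.add h1
  -- Fatou's lemma carries the Riesz bound, uniform in the height, to the boundary function.
  · have hσ' : Tendsto σ atTop (𝓝[>] 0) :=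
      tendsto_nhdsWithin_iff.2 ⟨hσ, Eventually.of_forall hσ0⟩
    calc ∫⁻ x, ‖h x‖ₑ ^ p
        = ∫⁻ x : ℝ, liminf (fun n => ‖(cauchyInt f (x + σ n * Complex.I)).re‖ₑ ^ p) atTop := by
          refine lintegral_congr_ae ?_
          filter_upwards [hae] with x hx
          exact (((hx.comp hσ').enorm).ennrpow_const p).liminf_eq.symm
      _ ≤ liminf (fun n => ∫⁻ x : ℝ, ‖(cauchyInt f (x + σ n * Complex.I)).re‖ₑ ^ p) atTop :=
          lintegral_liminf_le fun n => (Complex.continuous_re.comp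
            (continuous_cauchyInt_horizontal hf (hσ0 n))).enorm.measurable.pow_const p
      _ ≤ _ := by
          refine liminf_le_of_le (h := fun b hb => ?_)
          obtain ⟨n, hn⟩ := hb.exists
          exact hn.trans (hA f hf hs (σ n) (hσ0 n))

theorem integrableOn_div_compl_closedBall {f : ℝ → ℂ} (hf : Integrable f) (x : ℝ) {ε : ℝ}
    (hε : 0 < ε) :
    IntegrableOn (fun t => f t / ((t : ℂ) - (x : ℂ))) (Metric.closedBall x ε)ᶜ := by
  have hm : MeasurableSet (Metric.closedBall x ε)ᶜ := Metric.isClosed_closedBall.measurableSet.compl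
  simp_rw [div_eq_mul_inv]
  refine hf.integrableOn.mul_bdd (c := ε⁻¹) (Measurable.aestronglyMeasurable (by fun_prop)) ?_
  refine (ae_restrict_iff' hm).2 (Eventually.of_forall fun t ht => ?_)
  rw [mem_compl_iff, Metric.mem_closedBall, Real.dist_eq, not_le] at ht
  rw [norm_inv, ← Complex.ofReal_sub, Complex.norm_real, Real.norm_eq_abs]
  exact inv_anti₀ hε ht.le

theorem hilbert_complex {p : ℝ} (hp : 1 < p) : ∃ A : ℝ≥0, ∀ f : ℝ → ℂ, Integrable f →
    (∃ R, ∀ t, R < |t| → f t = 0) → ∫⁻ t, ‖f t‖ₑ ^ p ≠ ∞ →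
    ∃ h : ℝ → ℂ, AEStronglyMeasurable h ∧
      (∀ᵐ x : ℝ, Tendsto (fun ε => ∫ t in (Metric.closedBall x ε)ᶜ, f t / ((t : ℂ) - (x : ℂ)))
        (𝓝[>] 0) (𝓝 (h x))) ∧
      ∫⁻ x, ‖h x‖ₑ ^ p ≤ A * ∫⁻ t, ‖f t‖ₑ ^ p := by
  have hp0 : 0 < p := by linarith
  obtain ⟨A, hA⟩ := hilbert_real hp
  refine ⟨2 ^ (p - 1) * (2 * A), fun f hf ⟨R, hR⟩ hfp => ?_⟩
  have hle1 : ∫⁻ t, ‖(f t).re‖ₑ ^ p ≤ ∫⁻ t, ‖f t‖ₑ ^ p := by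
    refine lintegral_mono fun t => ENNReal.rpow_le_rpow ?_ hp0.le
    rw [enorm_le_iff_norm_le]
    exact Complex.abs_re_le_norm _
  have hle2 : ∫⁻ t, ‖(f t).im‖ₑ ^ p ≤ ∫⁻ t, ‖f t‖ₑ ^ p := by
    refine lintegral_mono fun t => ENNReal.rpow_le_rpow ?_ hp0.le
    rw [enorm_le_iff_norm_le]
    exact Complex.abs_im_le_norm _
  obtain ⟨h₁, m₁, t₁, b₁⟩ := hA (fun t => (f t).re) hf.re ⟨R, fun t ht => by simp [hR t ht]⟩
    (ne_top_of_le_ne_top hfp hle1)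
  obtain ⟨h₂, m₂, t₂, b₂⟩ := hA (fun t => (f t).im) hf.im ⟨R, fun t ht => by simp [hR t ht]⟩
    (ne_top_of_le_ne_top hfp hle2)
  refine ⟨fun x => (h₁ x : ℂ) + h₂ x * Complex.I, ?_, ?_, ?_⟩
  · exact (Complex.continuous_ofReal.comp_aestronglyMeasurable m₁).add
      ((Complex.continuous_ofReal.comp_aestronglyMeasurable m₂).mul aestronglyMeasurable_const)
  · filter_upwards [t₁, t₂] with x h1 h2
    have h3 : Tendsto (fun ε => ((∫ t in (Metric.closedBall x ε)ᶜ, (f t).re / (t - x) : ℝ) : ℂ) +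
        ((∫ t in (Metric.closedBall x ε)ᶜ, (f t).im / (t - x) : ℝ) : ℂ) * Complex.I) (𝓝[>] 0)
        (𝓝 ((h₁ x : ℂ) + h₂ x * Complex.I)) :=
      ((Complex.continuous_ofReal.tendsto _).comp h1).add
        (((Complex.continuous_ofReal.tendsto _).comp h2).mul_const _)
    refine h3.congr' ?_
    filter_upwards [self_mem_nhdsWithin] with ε hε
    have hi := integrableOn_div_compl_closedBall hf x hε
    have hre : ∀ t : ℝ, (f t / ((t : ℂ) - (x : ℂ))).re = (f t).re / (t - x) := fun t => by
      rw [← Complex.ofReal_sub, Complex.div_ofReal_re]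
    have him : ∀ t : ℝ, (f t / ((t : ℂ) - (x : ℂ))).im = (f t).im / (t - x) := fun t => by
      rw [← Complex.ofReal_sub, Complex.div_ofReal_im]
    have := integral_re_add_im hi
    simp only [RCLike.re_eq_complex_re, RCLike.im_eq_complex_im, hre, him] at this
    exact this
  · calc ∫⁻ x, ‖(h₁ x : ℂ) + h₂ x * Complex.I‖ₑ ^ p
        ≤ ∫⁻ x, 2 ^ (p - 1) * (‖h₁ x‖ₑ ^ p + ‖h₂ x‖ₑ ^ p) := by
          refine lintegral_mono fun x => ?_
          refine le_trans ?_ (ENNReal.rpow_add_le_mul_rpow_add_rpow _ _ hp.le)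
          gcongr
          refine (enorm_add_le _ _).trans (le_of_eq ?_)
          rw [enorm_mul]
          have e1 : ∀ r : ℝ, ‖(r : ℂ)‖ₑ = ‖r‖ₑ := fun r => by
            rw [← ofReal_norm, ← ofReal_norm, Complex.norm_real]
          have e2 : ‖Complex.I‖ₑ = 1 := by
            rw [← ofReal_norm, Complex.norm_I, ENNReal.ofReal_one]
          rw [e1, e1, e2, mul_one]
      _ = 2 ^ (p - 1) * ((∫⁻ x, ‖h₁ x‖ₑ ^ p) + ∫⁻ x, ‖h₂ x‖ₑ ^ p) := by
          rw [lintegral_const_mul' _ _ (ENNReal.rpow_ne_top_of_nonneg (by linarith) (by simp)),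
            lintegral_add_left' (m₁.enorm.pow_const p)]
      _ ≤ 2 ^ (p - 1) * (A * (∫⁻ t, ‖f t‖ₑ ^ p) + A * ∫⁻ t, ‖f t‖ₑ ^ p) := by
          gcongr
          · exact b₁.trans (by gcongr)
          · exact b₂.trans (by gcongr)
      _ = _ := by
          push_cast
          rw [ENNReal.coe_rpow_of_nonneg _ (by linarith)]
          push_cast
          ring

/-! ### Morrey spaces: Hardy operators, powers and the Hilbert transform. -/

/-! ### Morrey bounds on the line -/

/-- `G` bounds the Morrey norm of `u` over the whole line. -/
def MorreyBound (p lam : ℝ) (u : ℝ → ℝ≥0∞) (G : ℝ≥0∞) : Prop :=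
  ∀ x : ℝ, ∀ r > 0, ∫⁻ y in Metric.ball x r, u y ^ p ≤ G ^ p * ENNReal.ofReal (r ^ lam)

theorem MorreyBound.mono_ae {p lam : ℝ} (hp : 0 ≤ p) {u v : ℝ → ℝ≥0∞} {G : ℝ≥0∞}
    (h : MorreyBound p lam v G) (huv : ∀ᵐ y, u y ≤ v y) : MorreyBound p lam u G := fun x r hr =>
  (lintegral_mono_ae ((ae_restrict_of_ae huv).mono fun _ hy => ENNReal.rpow_le_rpow hy hp)).trans
    (h x r hr)

theorem MorreyBound.mono_right {p lam : ℝ} (hp : 0 ≤ p) {u : ℝ → ℝ≥0∞} {G H : ℝ≥0∞}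
    (h : MorreyBound p lam u G) (hGH : G ≤ H) : MorreyBound p lam u H := fun x r hr =>
  (h x r hr).trans (by gcongr)

theorem MorreyBound.add {p lam : ℝ} (hp : 1 ≤ p) {u v : ℝ → ℝ≥0∞} {G H : ℝ≥0∞}
    (hu : AEMeasurable u) (hv : AEMeasurable v)
    (h : MorreyBound p lam u G) (h' : MorreyBound p lam v H) :
    MorreyBound p lam (fun x => u x + v x) (G + H) := by
  intro x r hr
  have hp0 : 0 < p := by linarith
  have hrt : ∀ {I A : ℝ≥0∞}, I ≤ A ^ p * ENNReal.ofReal (r ^ lam) →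
      I ^ (1 / p) ≤ A * ENNReal.ofReal (r ^ lam) ^ (1 / p) := fun {I A} hI => by
    calc I ^ (1 / p) ≤ (A ^ p * ENNReal.ofReal (r ^ lam)) ^ (1 / p) := by gcongr
      _ = _ := by
        rw [ENNReal.mul_rpow_of_nonneg _ _ (by positivity), ← ENNReal.rpow_mul,
          mul_one_div_cancel hp0.ne', ENNReal.rpow_one]
  have := (ENNReal.lintegral_Lp_add_le (μ := volume.restrict (Metric.ball x r)) hu.restrict
    hv.restrict hp).trans (add_le_add (hrt (h x r hr)) (hrt (h' x r hr)))
  rw [← add_mul] at this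
  calc _ = ((∫⁻ y in Metric.ball x r, (u y + v y) ^ p) ^ (1 / p)) ^ p := by
        rw [← ENNReal.rpow_mul, one_div_mul_cancel hp0.ne', ENNReal.rpow_one]
    _ ≤ ((G + H) * ENNReal.ofReal (r ^ lam) ^ (1 / p)) ^ p := by
        gcongr
        exact this
    _ = _ := by
        rw [ENNReal.mul_rpow_of_nonneg _ _ hp0.le, ← ENNReal.rpow_mul, one_div_mul_cancel hp0.ne',
          ENNReal.rpow_one]

theorem MorreyBound.const_mul {p lam : ℝ} (hp : 0 ≤ p) {u : ℝ → ℝ≥0∞} {G c : ℝ≥0∞} (hc : c ≠ ∞)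
    (h : MorreyBound p lam u G) : MorreyBound p lam (fun x => c * u x) (c * G) := by
  intro x r hr
  simp_rw [ENNReal.mul_rpow_of_nonneg _ _ hp]
  rw [lintegral_const_mul' _ _ (ENNReal.rpow_ne_top_of_nonneg hp hc), mul_assoc]
  gcongr
  exact h x r hr

theorem MorreyBound.zero {p lam : ℝ} (hp : 0 < p) : MorreyBound p lam (fun _ => 0) 0 := by
  intro x r hr
  simp [ENNReal.zero_rpow_of_pos hp]

theorem MorreyBound.sum {p lam : ℝ} (hp : 1 ≤ p) {ι : Type*} (s : Finset ι) {u : ι → ℝ → ℝ≥0∞}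
    {G : ι → ℝ≥0∞} (hu : ∀ i, AEMeasurable (u i)) (h : ∀ i, MorreyBound p lam (u i) (G i)) :
    MorreyBound p lam (fun x => ∑ i ∈ s, u i x) (∑ i ∈ s, G i) := by
  classical
  induction s using Finset.induction_on with
  | empty => simpa using MorreyBound.zero (lam := lam) (by linarith : 0 < p)
  | insert i s hi ih =>
    simp_rw [Finset.sum_insert hi]
    exact (h i).add hp (hu i) (Finset.aemeasurable_fun_sum s fun i _ => hu i) ih

/-- Hölder against the constant 1. A Morrey function is thus the density of a measure of growth λ/p
+ 1 - 1/p, to which the shell estimates apply. The factor 4 absorbs the passage to an open ball of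
twice the radius. -/
theorem MorreyBound.lintegral_closedBall_le {p lam : ℝ} (hp : 1 < p) (hlam : lam ≤ 1)
    {u : ℝ → ℝ≥0∞} {G : ℝ≥0∞} (hu : AEMeasurable u) (h : MorreyBound p lam u G) (c : ℝ) {R : ℝ}
    (hR : 0 < R) :
    ∫⁻ t in Metric.closedBall c R, u t ≤ 4 * G * ENNReal.ofReal (R ^ (lam / p + (1 - 1 / p))) := by
  have hp0 : 0 < p := by linarith
  rw [← ENNReal.rpow_le_rpow_iff hp0]
  have hsub : Metric.closedBall c R ⊆ Metric.ball c (2 * R) :=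
    Metric.closedBall_subset_ball (by linarith)
  have h1 := lintegral_mul_rpow_le (μ := volume.restrict (Metric.ball c (2 * R))) hp
    (k := fun _ => 1) aemeasurable_const hu.restrict
  simp only [one_mul, lintegral_one, Measure.restrict_apply_univ, Real.volume_ball] at h1
  have hreal : (2 * (2 * R)) ^ (p - 1) * (2 * R) ^ lam ≤
      4 ^ p * (R ^ (lam / p + (1 - 1 / p))) ^ p := by
    rw [← Real.rpow_mul hR.le, show 2 * (2 * R) = 4 * R by ring, Real.mul_rpow (by norm_num) hR.le,
      Real.mul_rpow (by norm_num) hR.le,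
      show (lam / p + (1 - 1 / p)) * p = (p - 1) + lam by field_simp; ring, Real.rpow_add hR]
    have h2 : (4 : ℝ) ^ (p - 1) * 2 ^ lam ≤ 4 ^ p := by
      have e : (4 : ℝ) ^ p = 4 ^ (p - 1) * 4 := by
        rw [← Real.rpow_add_one (by norm_num)]; ring_nf
      rw [e]
      gcongr
      calc (2 : ℝ) ^ lam ≤ 2 ^ (1 : ℝ) := Real.rpow_le_rpow_of_exponent_le (by norm_num) hlam
        _ ≤ 4 := by norm_num
    calc (4 : ℝ) ^ (p - 1) * R ^ (p - 1) * (2 ^ lam * R ^ lam)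
        = (4 ^ (p - 1) * 2 ^ lam) * (R ^ (p - 1) * R ^ lam) := by ring
      _ ≤ _ := by gcongr
  calc (∫⁻ t in Metric.closedBall c R, u t) ^ p
      ≤ (∫⁻ t in Metric.ball c (2 * R), u t) ^ p := by gcongr
    _ ≤ _ := h1
    _ ≤ ENNReal.ofReal (2 * (2 * R)) ^ (p - 1) * (G ^ p * ENNReal.ofReal ((2 * R) ^ lam)) := by
        gcongr
        exact h c _ (by positivity)
    _ = G ^ p * ENNReal.ofReal ((2 * (2 * R)) ^ (p - 1) * (2 * R) ^ lam) := by
        rw [ENNReal.ofReal_rpow_of_pos (by positivity), ENNReal.ofReal_mul (by positivity)]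
        ring
    _ ≤ G ^ p * ENNReal.ofReal (4 ^ p * (R ^ (lam / p + (1 - 1 / p))) ^ p) := by gcongr
    _ = _ := by
        rw [ENNReal.mul_rpow_of_nonneg _ _ hp0.le, ENNReal.mul_rpow_of_nonneg _ _ hp0.le,
          ENNReal.ofReal_rpow_of_pos (by positivity), ENNReal.ofReal_mul (by positivity),
          ← ENNReal.ofReal_rpow_of_pos (by norm_num)]
        simp only [ENNReal.ofReal_ofNat]
        ring

theorem MorreyBound.withDensity_closedBall_le {p lam : ℝ} (hp : 1 < p) (hlam : lam ≤ 1)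
    {u : ℝ → ℝ≥0∞} {G : ℝ≥0∞} (hu : AEMeasurable u) (h : MorreyBound p lam u G) (c : ℝ) :
    ∀ R > 0, volume.withDensity u (Metric.closedBall c R) ≤
      4 * G * ENNReal.ofReal (R ^ (lam / p + (1 - 1 / p))) := fun R hR => by
  rw [withDensity_apply' u]
  exact h.lintegral_closedBall_le hp hlam hu c hR

theorem MorreyBound.lintegral_inner {p lam a : ℝ} (hp : 1 < p) (hlam : lam ≤ 1)
    (ha : a < lam / p + (1 - 1 / p)) : ∃ C : ℝ≥0, ∀ (u : ℝ → ℝ≥0∞) (G : ℝ≥0∞), AEMeasurable u →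
      MorreyBound p lam u G → ∀ c, ∀ X > 0,
      ∫⁻ t in {t | |t - c| ≤ X}, ENNReal.ofReal (|t - c| ^ (-a)) * u t ≤
        C * G * ENNReal.ofReal (X ^ (lam / p + (1 - 1 / p) - a)) := by
  obtain ⟨C, hC⟩ := lintegral_inner_of_growth ha
  refine ⟨4 * C, fun u G hu h c X hX => ?_⟩
  have := hC _ c _ (h.withDensity_closedBall_le hp hlam hu c) X hX
  have hc : Measurable fun t : ℝ => |t - c| := by fun_prop
  have hm : MeasurableSet {t : ℝ | 0 < |t - c| ∧ |t - c| ≤ X} :=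
    (measurableSet_lt measurable_const hc).inter (measurableSet_le hc measurable_const)
  rw [setLIntegral_withDensity_eq_lintegral_mul₀ hu
    (Measurable.aemeasurable (by fun_prop)) hm] at this
  have hset : ({t : ℝ | |t - c| ≤ X} : Set ℝ) =ᵐ[volume] {t | 0 < |t - c| ∧ |t - c| ≤ X} := by
    have : ∀ᵐ t : ℝ, t ≠ c := by simp [ae_iff, measure_singleton]
    filter_upwards [this] with t ht
    have : 0 < |t - c| := abs_pos.2 (sub_ne_zero.2 ht)
    simp only [eq_iff_iff]
    change |t - c| ≤ X ↔ (0 < |t - c| ∧ |t - c| ≤ X)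
    simp [this]
  rw [setLIntegral_congr hset]
  refine le_trans (le_of_eq ?_) (this.trans (le_of_eq ?_))
  · simp_rw [Pi.mul_apply, mul_comm]
  · push_cast; ring

theorem MorreyBound.lintegral_outer {p lam a : ℝ} (hp : 1 < p) (hlam : lam ≤ 1)
    (ha : lam / p + (1 - 1 / p) < a) : ∃ C : ℝ≥0, ∀ (u : ℝ → ℝ≥0∞) (G : ℝ≥0∞), AEMeasurable u →
      MorreyBound p lam u G → ∀ c, ∀ X > 0,
      ∫⁻ t in {t | X ≤ |t - c|}, ENNReal.ofReal (|t - c| ^ (-a)) * u t ≤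
        C * G * ENNReal.ofReal (X ^ (lam / p + (1 - 1 / p) - a)) := by
  obtain ⟨C, hC⟩ := lintegral_outer_of_growth ha
  refine ⟨4 * C, fun u G hu h c X hX => ?_⟩
  have := hC _ c _ (h.withDensity_closedBall_le hp hlam hu c) X hX
  have hc : Measurable fun t : ℝ => |t - c| := by fun_prop
  rw [setLIntegral_withDensity_eq_lintegral_mul₀ hu
    (Measurable.aemeasurable (by fun_prop)) (measurableSet_le measurable_const hc)] at this
  refine le_trans (le_of_eq ?_) (this.trans (le_of_eq ?_))
  · simp_rw [Pi.mul_apply, mul_comm]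
  · push_cast; ring

/-! ### Hardy operators -/

theorem lintegral_comp_add_mul {F : ℝ → ℝ≥0∞} (hF : Measurable F) (e : ℝ) {d : ℝ} (hd : d ≠ 0) :
    ∫⁻ x, F (e + d * x) = ENNReal.ofReal |d⁻¹| * ∫⁻ x, F x := by
  have h1 : Measurable fun y => F (e + y) := hF.comp (measurable_const_add e)
  have h2 : Measurable fun x : ℝ => d * x := measurable_const_mul d
  rw [← lintegral_map h1 h2, Real.map_volume_mul_left hd, lintegral_smul_measure,
    lintegral_add_left_eq_self F e, smul_eq_mul]

/-- A change of variables: |s|^λ comes from the radius of the image ball and |s|^(-1) from the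
Jacobian. In terms of norms the factor is |s|^((λ-1)/p). -/
theorem MorreyBound.dilate {p lam : ℝ} {u : ℝ → ℝ≥0∞} {G : ℝ≥0∞}
    (hu : Measurable u) (h : MorreyBound p lam u G) (c : ℝ) {s : ℝ} (hs : s ≠ 0) (x : ℝ) {r : ℝ}
    (hr : 0 < r) :
    ∫⁻ y in Metric.ball x r, u (c + s * (y - c)) ^ p ≤
      ENNReal.ofReal (|s| ^ (lam - 1)) * (G ^ p * ENNReal.ofReal (r ^ lam)) := by
  have hs0 : 0 < |s| := abs_pos.2 hs
  set F : ℝ → ℝ≥0∞ := (Metric.ball (c + s * (x - c)) (|s| * r)).indicator fun y => u y ^ p with hF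
  have hFm : Measurable F := (hu.pow_const p).indicator Metric.isOpen_ball.measurableSet
  have e1 : ∀ y, (Metric.ball x r).indicator (fun y => u (c + s * (y - c)) ^ p) y =
      F ((c - s * c) + s * y) := by
    intro y
    have e : (c - s * c) + s * y = c + s * (y - c) := by ring
    rw [e, hF]
    by_cases hy : y ∈ Metric.ball x r
    · rw [indicator_of_mem hy, indicator_of_mem]
      rw [Metric.mem_ball, Real.dist_eq] at hy ⊢
      rw [show c + s * (y - c) - (c + s * (x - c)) = s * (y - x) by ring, abs_mul]
      gcongr
    · rw [indicator_of_notMem hy, indicator_of_notMem]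
      rw [Metric.mem_ball, Real.dist_eq, not_lt] at hy ⊢
      rw [show c + s * (y - c) - (c + s * (x - c)) = s * (y - x) by ring, abs_mul]
      gcongr
  rw [← lintegral_indicator Metric.isOpen_ball.measurableSet]
  simp_rw [e1]
  rw [lintegral_comp_add_mul hFm _ hs, hF, lintegral_indicator Metric.isOpen_ball.measurableSet]
  calc _ ≤ ENNReal.ofReal |s⁻¹| * (G ^ p * ENNReal.ofReal ((|s| * r) ^ lam)) := by
        gcongr
        exact h _ _ (by positivity)
    _ = _ := by
        rw [Real.mul_rpow hs0.le hr.le, ENNReal.ofReal_mul (by positivity), Real.rpow_sub_one hs0.ne',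
          div_eq_inv_mul, ENNReal.ofReal_mul (by positivity), abs_inv]
        ring

/-- The kernel dominating the commutator of the Cauchy kernel with a weight. -/
def hardyKernel (b g X T : ℝ) : ℝ :=
  if T < X then X ^ (g - 1) * T ^ (-g) else X ^ b * T ^ (-b - 1)

theorem hardyKernel_nonneg (b g : ℝ) {X T : ℝ} (hX : 0 ≤ X) (hT : 0 ≤ T) :
    0 ≤ hardyKernel b g X T := by
  unfold hardyKernel; split_ifs <;> positivity

theorem measurable_hardyKernel (b g : ℝ) : Measurable fun z : ℝ × ℝ => hardyKernel b g z.1 z.2 := by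
  unfold hardyKernel
  exact Measurable.ite (measurableSet_lt measurable_snd measurable_fst) (by fun_prop) (by fun_prop)

theorem hardyKernel_mul {b g X : ℝ} (hX : 0 < X) {S : ℝ} (hS : 0 ≤ S) :
    X * hardyKernel b g X (S * X) = hardyKernel b g 1 S := by
  unfold hardyKernel
  have h1 : S * X < X ↔ S < 1 := by
    constructor <;> intro h <;> nlinarith
  simp only [h1, Real.one_rpow, one_mul]
  split_ifs
  · rw [Real.mul_rpow hS hX.le, Real.rpow_sub_one hX.ne', Real.rpow_neg hX.le]
    have := (Real.rpow_pos_of_pos hX g).ne'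
    field_simp
  · rw [Real.mul_rpow hS hX.le, Real.rpow_sub_one hX.ne', Real.rpow_neg hX.le]
    have := (Real.rpow_pos_of_pos hX b).ne'
    field_simp

/-- Convergence at 0 uses g - β < 1, convergence at infinity uses b > β; the two sides of the
Zygmund condition enter here. -/
theorem lintegral_hardyKernel_ne_top {β b g : ℝ} (hb : β < b) (hg : g < β + 1) :
    ∫⁻ s : ℝ, ENNReal.ofReal (hardyKernel b g 1 |s|) * ENNReal.ofReal (|s| ^ β) ≠ ∞ := by
  obtain ⟨C₁, h1⟩ := lintegral_inner_of_growth (s := 1) (a := g - β) (by linarith)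
  obtain ⟨C₂, h2⟩ := lintegral_outer_of_growth (s := 1) (a := b + 1 - β) (by linarith)
  have h1 := h1 volume 0 2 (fun R _ => volume_closedBall_growth 0 R) 1 one_pos
  have h2 := h2 volume 0 2 (fun R _ => volume_closedBall_growth 0 R) 1 one_pos
  have hm : Measurable fun s : ℝ => |s| := by fun_prop
  set A := {t : ℝ | 0 < |t - 0| ∧ |t - 0| ≤ 1}
  set B := {t : ℝ | 1 ≤ |t - 0|}
  have hA : MeasurableSet A := by
    simp only [A, sub_zero]
    exact (measurableSet_lt measurable_const hm).inter (measurableSet_le hm measurable_const)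
  have hB : MeasurableSet B := by
    simp only [B, sub_zero]
    exact measurableSet_le measurable_const hm
  have hle : ∀ᵐ s : ℝ, ENNReal.ofReal (hardyKernel b g 1 |s|) * ENNReal.ofReal (|s| ^ β) ≤
      A.indicator (fun s => ENNReal.ofReal (|s - 0| ^ (-(g - β)))) s +
      B.indicator (fun s => ENNReal.ofReal (|s - 0| ^ (-(b + 1 - β)))) s := by
    have : ∀ᵐ t : ℝ, t ≠ 0 := by simp [ae_iff, measure_singleton]
    filter_upwards [this] with s hs
    have hs0 : 0 < |s| := abs_pos.2 hs
    rw [← ENNReal.ofReal_mul (hardyKernel_nonneg _ _ zero_le_one hs0.le)]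
    unfold hardyKernel
    split_ifs with h
    · refine le_add_right ?_
      rw [indicator_of_mem (show s ∈ A by simp only [A, sub_zero]; exact ⟨hs0, h.le⟩)]
      rw [Real.one_rpow, one_mul, ← Real.rpow_add hs0, sub_zero, neg_sub, neg_add_eq_sub]
    · refine le_add_left ?_
      rw [indicator_of_mem (show s ∈ B by simp only [B, sub_zero]; exact not_lt.1 h)]
      rw [Real.one_rpow, one_mul, ← Real.rpow_add hs0, sub_zero]
      refine le_of_eq ?_
      congr 2
      ring
  refine ne_top_of_le_ne_top ?_ (lintegral_mono_ae hle)
  rw [lintegral_add_left ((Measurable.indicator (by fun_prop) hA)), lintegral_indicator hA,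
    lintegral_indicator hB]
  refine ENNReal.add_ne_top.2 ⟨ne_top_of_le_ne_top ?_ h1, ne_top_of_le_ne_top ?_ h2⟩
  · exact ENNReal.mul_ne_top (ENNReal.mul_ne_top (by simp) (by simp)) (by simp)
  · exact ENNReal.mul_ne_top (ENNReal.mul_ne_top (by simp) (by simp)) (by simp)

/-- Homogeneity of degree -1 and the substitution t = c + s(x - c) exhibit the operator as an
average of dilations. -/
theorem hardyKernel_integral_eq {b g : ℝ} {u : ℝ → ℝ≥0∞} (hu : Measurable u) {c x : ℝ} (hx : x ≠ c) :
    ∫⁻ t, ENNReal.ofReal (hardyKernel b g |x - c| |t - c|) * u t =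
      ∫⁻ s, ENNReal.ofReal (hardyKernel b g 1 |s|) * u (c + s * (x - c)) := by
  have hd : x - c ≠ 0 := sub_ne_zero.2 hx
  have hd0 : 0 < |x - c| := abs_pos.2 hd
  have hm : Measurable fun t => ENNReal.ofReal (hardyKernel b g |x - c| |t - c|) * u t :=
    ((measurable_hardyKernel b g).comp (by fun_prop : Measurable fun t : ℝ =>
      (|x - c|, |t - c|))).ennreal_ofReal.mul hu
  have h := lintegral_comp_add_mul hm c hd
  have h2 : ENNReal.ofReal |x - c| * ENNReal.ofReal |(x - c)⁻¹| = 1 := by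
    rw [← ENNReal.ofReal_mul hd0.le, abs_inv, mul_inv_cancel₀ hd0.ne', ENNReal.ofReal_one]
  calc _ = ENNReal.ofReal |x - c| * ∫⁻ s, ENNReal.ofReal
        (hardyKernel b g |x - c| |c + (x - c) * s - c|) * u (c + (x - c) * s) := by
        rw [h, ← mul_assoc, h2, one_mul]
    _ = _ := by
        rw [← lintegral_const_mul' _ _ (by simp)]
        refine lintegral_congr fun s => ?_
        rw [← mul_assoc, ← ENNReal.ofReal_mul hd0.le, add_sub_cancel_left, abs_mul, mul_comm |x - c| |s|,
          hardyKernel_mul hd0 (abs_nonneg s), mul_comm s]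

/-- The dilation by s has norm |s|^β with β = (λ-1)/p, so the operator norm is at most W = ∫
k(s)|s|^β ds. The triangle inequality for integrals is carried out by Hölder with the weight w =
k|s|^β and Tonelli. -/
theorem MorreyBound.hardy {p lam b g : ℝ} (hp : 1 < p) (hb : (lam - 1) / p < b)
    (hg : g < lam / p + (1 - 1 / p)) : ∃ C : ℝ≥0, ∀ (u : ℝ → ℝ≥0∞) (G : ℝ≥0∞), AEMeasurable u →
      MorreyBound p lam u G → ∀ c : ℝ, MorreyBound p lam
        (fun x => ∫⁻ t, ENNReal.ofReal (hardyKernel b g |x - c| |t - c|) * u t) (C * G) := by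
  have hp0 : 0 < p := by linarith
  set β := (lam - 1) / p with hβ
  have hg' : g < β + 1 := by rw [hβ, sub_div]; linarith
  set k : ℝ → ℝ≥0∞ := fun s => ENNReal.ofReal (hardyKernel b g 1 |s|) with hk
  have hkm : Measurable k := ((measurable_hardyKernel b g).comp (by fun_prop :
    Measurable fun t : ℝ => ((1 : ℝ), |t|))).ennreal_ofReal
  set w : ℝ → ℝ≥0∞ := fun s => k s * ENNReal.ofReal (|s| ^ β) with hw
  have hwm : Measurable w := hkm.mul (by fun_prop)
  have hW : ∫⁻ s, w s ≠ ∞ := lintegral_hardyKernel_ne_top hb hg'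
  set W := ∫⁻ s, w s with hWdef
  refine ⟨W.toNNReal, fun u G hu h c => ?_⟩
  rw [ENNReal.coe_toNNReal hW]
  -- The joint measurability used in Tonelli needs a measurable representative, since u is composed
  -- with dilations.
  set v := hu.mk u with hv
  have hvm : Measurable v := hu.measurable_mk
  have hveq : u =ᵐ[volume] v := hu.ae_eq_mk
  have hvG : MorreyBound p lam v G := h.mono_ae hp0.le (hveq.symm.le)
  have huv : ∀ x, ∫⁻ t, ENNReal.ofReal (hardyKernel b g |x - c| |t - c|) * u t =
      ∫⁻ t, ENNReal.ofReal (hardyKernel b g |x - c| |t - c|) * v t := fun x =>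
    lintegral_congr_ae (by filter_upwards [hveq] with t ht; rw [ht])
  simp_rw [huv]
  have hne0 : ∀ᵐ t : ℝ, t ≠ 0 := by simp [ae_iff, measure_singleton]
  have hnec : ∀ᵐ t : ℝ, t ≠ c := by simp [ae_iff, measure_singleton]
  -- The factor |s|^(-β) compensates the weight and, raised to the power p, cancels the factor
  -- |s|^(λ-1) of the dilation.
  set q : ℝ → ℝ → ℝ≥0∞ := fun x s => w s * (ENNReal.ofReal (|s| ^ (-β)) * v (c + s * (x - c))) ^ p
    with hq
  have hqm : Measurable (Function.uncurry q) := by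
    refine (hwm.comp measurable_snd).mul (Measurable.pow_const (Measurable.mul (by fun_prop)
      (hvm.comp (by fun_prop))) p)
  have hpt : ∀ᵐ x : ℝ, (∫⁻ t, ENNReal.ofReal (hardyKernel b g |x - c| |t - c|) * v t) ^ p ≤
      W ^ (p - 1) * ∫⁻ s, q x s := by
    filter_upwards [hnec] with x hx
    rw [hardyKernel_integral_eq hvm hx]
    have e : ∫⁻ s, ENNReal.ofReal (hardyKernel b g 1 |s|) * v (c + s * (x - c)) =
        ∫⁻ s, w s * (ENNReal.ofReal (|s| ^ (-β)) * v (c + s * (x - c))) := by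
      refine lintegral_congr_ae ?_
      filter_upwards [hne0] with s hs
      have hs0 : 0 < |s| := abs_pos.2 hs
      rw [hw]
      simp only
      rw [← mul_assoc, mul_assoc (k s), ← ENNReal.ofReal_mul (by positivity), ← Real.rpow_add hs0,
        add_neg_cancel, Real.rpow_zero, ENNReal.ofReal_one, mul_one]
    rw [e]
    exact lintegral_mul_rpow_le hp hwm.aemeasurable
      (Measurable.aemeasurable (Measurable.mul (by fun_prop) (hvm.comp (by fun_prop))))
  intro x r hr
  calc _ ≤ ∫⁻ y in Metric.ball x r, W ^ (p - 1) * ∫⁻ s, q y s :=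
        lintegral_mono_ae (ae_restrict_of_ae hpt)
    _ = W ^ (p - 1) * ∫⁻ y in Metric.ball x r, ∫⁻ s, q y s :=
        lintegral_const_mul' _ _ (ENNReal.rpow_ne_top_of_nonneg (by linarith) hW)
    _ = W ^ (p - 1) * ∫⁻ s, ∫⁻ y in Metric.ball x r, q y s := by
        rw [lintegral_lintegral_swap hqm.aemeasurable]
    _ ≤ W ^ (p - 1) * ∫⁻ s, w s * (G ^ p * ENNReal.ofReal (r ^ lam)) := by
        gcongr W ^ (p - 1) * ?_
        refine lintegral_mono_ae ?_
        filter_upwards [hne0] with s hs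
        have hs0 : 0 < |s| := abs_pos.2 hs
        have hmq : Measurable fun y => v (c + s * (y - c)) ^ p :=
          (hvm.comp (by fun_prop)).pow_const p
        simp only [hq, ENNReal.mul_rpow_of_nonneg _ _ hp0.le]
        rw [lintegral_const_mul _ (hmq.const_mul _), lintegral_const_mul _ hmq]
        gcongr w s * ?_
        calc _ ≤ ENNReal.ofReal (|s| ^ (-β)) ^ p *
              (ENNReal.ofReal (|s| ^ (lam - 1)) * (G ^ p * ENNReal.ofReal (r ^ lam))) := by
              gcongr
              exact hvG.dilate hvm c hs x hr
          _ = _ := by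
              rw [← mul_assoc, ENNReal.ofReal_rpow_of_pos (by positivity),
                ← ENNReal.ofReal_mul (by positivity), ← Real.rpow_mul hs0.le, ← Real.rpow_add hs0,
                hβ, neg_mul, div_mul_cancel₀ _ hp0.ne', neg_add_cancel, Real.rpow_zero,
                ENNReal.ofReal_one, one_mul]
    _ = W ^ (p - 1) * (W * (G ^ p * ENNReal.ofReal (r ^ lam))) := by
        rw [lintegral_mul_const _ hwm]
    _ = _ := by
        rw [ENNReal.mul_rpow_of_nonneg _ _ hp0.le, ← mul_assoc, ← mul_assoc]
        congr 2
        nth_rewrite 2 [← ENNReal.rpow_one W]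
        rw [← ENNReal.rpow_add_of_nonneg _ _ (by linarith) zero_le_one]
        ring_nf

/-! ### Powers in Morrey spaces -/

theorem lintegral_ball_rpow_le {s : ℝ} (hs0 : 0 ≤ s) (hs1 : s < 1) :
    ∃ C : ℝ≥0, ∀ c x : ℝ, ∀ r > 0, ∫⁻ y in Metric.ball x r, ENNReal.ofReal (|y - c| ^ (-s)) ≤
      C * ENNReal.ofReal (r ^ (1 - s)) := by
  obtain ⟨C, hC⟩ := lintegral_inner_of_growth hs1
  refine ⟨2 * C + 2, fun c x r hr => ?_⟩
  have h1 := hC volume c 2 (fun R _ => volume_closedBall_growth c R) r hr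
  have hm : Measurable fun t : ℝ => |t - c| := by fun_prop
  set A := {t : ℝ | 0 < |t - c| ∧ |t - c| ≤ r} with hAdef
  have hA : MeasurableSet A :=
    (measurableSet_lt measurable_const hm).inter (measurableSet_le hm measurable_const)
  have hle : ∀ᵐ y : ℝ, ENNReal.ofReal (|y - c| ^ (-s)) ≤
      A.indicator (fun y => ENNReal.ofReal (|y - c| ^ (-s))) y + ENNReal.ofReal (r ^ (-s)) := by
    have : ∀ᵐ t : ℝ, t ≠ c := by simp [ae_iff, measure_singleton]
    filter_upwards [this] with y hy
    have hy0 : 0 < |y - c| := abs_pos.2 (sub_ne_zero.2 hy)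
    by_cases h : |y - c| ≤ r
    · refine le_add_right ?_
      rw [indicator_of_mem (show y ∈ A from ⟨hy0, h⟩)]
    · refine le_add_left (ENNReal.ofReal_le_ofReal ?_)
      exact Real.rpow_le_rpow_of_nonpos hr (not_le.1 h).le (by linarith)
  calc _ ≤ ∫⁻ y in Metric.ball x r, (A.indicator (fun y => ENNReal.ofReal (|y - c| ^ (-s))) y +
          ENNReal.ofReal (r ^ (-s))) := lintegral_mono_ae (ae_restrict_of_ae hle)
    _ = (∫⁻ y in Metric.ball x r, A.indicator (fun y => ENNReal.ofReal (|y - c| ^ (-s))) y) +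
          ENNReal.ofReal (r ^ (-s)) * ENNReal.ofReal (2 * r) := by
        rw [lintegral_add_right _ measurable_const, setLIntegral_const, Real.volume_ball]
    _ ≤ C * 2 * ENNReal.ofReal (r ^ (1 - s)) + ENNReal.ofReal (r ^ (-s)) * ENNReal.ofReal (2 * r) := by
        gcongr
        refine (setLIntegral_le_lintegral _ _).trans ?_
        rw [lintegral_indicator hA]
        exact h1
    _ = _ := by
        rw [← ENNReal.ofReal_mul (by positivity), show r ^ (-s) * (2 * r) = 2 * r ^ (1 - s) by
          rw [sub_eq_neg_add, Real.rpow_add_one hr.ne']; ring, ENNReal.ofReal_mul (by norm_num)]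
        push_cast
        simp only [ENNReal.ofReal_ofNat]
        ring

/-- The p-th power of |y-c|^b has integral O(r^(1+bp)) over balls of radius r, and 1 + bp > λ. For r
≤ ℓ the surplus power of r is bounded by ℓ^e; for larger r the whole interval lies in one ball of
radius ℓ. -/
theorem morreyBound_indicator_rpow {p lam b : ℝ} (hp : 1 < p) (hlam : 0 ≤ lam)
    (hb : (lam - 1) / p < b) (hb0 : b ≤ 0) (l u : ℝ) (hlu : l < u) : ∃ C : ℝ≥0, ∀ c : ℝ,
      MorreyBound p lam ((Icc l u).indicator fun y => ENNReal.ofReal (|y - c| ^ b)) C := by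
  have hp0 : 0 < p := by linarith
  have hbp : lam - 1 < b * p := by rwa [div_lt_iff₀ hp0] at hb
  have hbp0 : b * p ≤ 0 := mul_nonpos_of_nonpos_of_nonneg hb0 hp0.le
  obtain ⟨D, hD⟩ := lintegral_ball_rpow_le (s := -(b * p)) (by linarith) (by linarith)
  set ℓ := 2 * (u - l) with hℓ
  have hℓ0 : 0 < ℓ := by rw [hℓ]; linarith
  set e := 1 - -(b * p) - lam with he
  have he0 : 0 < e := by rw [he]; linarith
  set K : ℝ≥0 := D * Real.toNNReal (ℓ ^ e) with hK
  refine ⟨K ^ (1 / p), fun c x r hr => ?_⟩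
  have hK' : ((K ^ (1 / p) : ℝ≥0) : ℝ≥0∞) ^ p = D * ENNReal.ofReal (ℓ ^ e) := by
    rw [ENNReal.coe_rpow_of_nonneg _ (by positivity : (0 : ℝ) ≤ 1 / p), ← ENNReal.rpow_mul,
      one_div_mul_cancel hp0.ne', ENNReal.rpow_one, hK]
    push_cast
    rfl
  have hpow : ∀ y, ((Icc l u).indicator (fun y => ENNReal.ofReal (|y - c| ^ b)) y) ^ p ≤
      (Icc l u).indicator (fun y => ENNReal.ofReal (|y - c| ^ (- -(b * p)))) y := by
    intro y
    by_cases hy : y ∈ Icc l u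
    · rw [indicator_of_mem hy, indicator_of_mem hy,
        ENNReal.ofReal_rpow_of_nonneg (by positivity) hp0.le, ← Real.rpow_mul (abs_nonneg _), neg_neg]
    · rw [indicator_of_notMem hy, indicator_of_notMem hy, ENNReal.zero_rpow_of_pos hp0]
  rw [hK']
  refine (lintegral_mono hpow).trans ?_
  rcases le_total r ℓ with h | h
  · calc _ ≤ ∫⁻ y in Metric.ball x r, ENNReal.ofReal (|y - c| ^ (- -(b * p))) :=
          lintegral_mono fun y => indicator_le_self _ _ y
      _ ≤ _ := hD c x r hr
      _ ≤ D * ENNReal.ofReal (ℓ ^ e * r ^ lam) := by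
          gcongr
          rw [show (1 : ℝ) - -(b * p) = e + lam by rw [he]; ring, Real.rpow_add hr]
          gcongr
      _ = _ := by rw [ENNReal.ofReal_mul (by positivity), mul_assoc]
  · calc _ ≤ ∫⁻ y in Icc l u, ENNReal.ofReal (|y - c| ^ (- -(b * p))) := by
          rw [← lintegral_indicator measurableSet_Icc]
          exact setLIntegral_le_lintegral _ _
      _ ≤ ∫⁻ y in Metric.ball l ℓ, ENNReal.ofReal (|y - c| ^ (- -(b * p))) := by
          refine lintegral_mono_set fun y hy => ?_
          rw [Metric.mem_ball, Real.dist_eq, abs_of_nonneg (by linarith [hy.1])]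
          linarith [hy.2]
      _ ≤ _ := hD c l ℓ hℓ0
      _ ≤ D * ENNReal.ofReal (ℓ ^ e * r ^ lam) := by
          gcongr
          rw [show (1 : ℝ) - -(b * p) = e + lam by rw [he]; ring, Real.rpow_add hℓ0]
          gcongr
      _ = _ := by rw [ENNReal.ofReal_mul (by positivity), mul_assoc]

/-! ### The Hilbert transform in unweighted Morrey spaces -/

/-- Here |t - x| ≥ |t - x₀|/2, so the bound depends neither on x in the ball nor on ε. -/
theorem enorm_far_integral_le {g : ℝ → ℂ} {x₀ x r ε : ℝ} (hx : x ∈ Metric.ball x₀ r) :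
    ‖∫ t in (Metric.closedBall x ε)ᶜ,
      (Metric.ball x₀ (2 * r))ᶜ.indicator g t / ((t : ℂ) - (x : ℂ))‖ₑ ≤
      2 * ∫⁻ t in {t | 2 * r ≤ |t - x₀|}, ENNReal.ofReal (|t - x₀| ^ (-1 : ℝ)) * ‖g t‖ₑ := by
  rw [Metric.mem_ball, Real.dist_eq] at hx
  have hm : Measurable fun t : ℝ => |t - x₀| := by fun_prop
  refine (enorm_integral_le_lintegral_enorm _).trans ((setLIntegral_le_lintegral _ _).trans ?_)
  rw [← lintegral_const_mul' _ _ (by simp), ← lintegral_indicator (measurableSet_le measurable_const hm)]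
  refine lintegral_mono fun t => ?_
  by_cases ht : 2 * r ≤ |t - x₀|
  · have ht' : t ∈ (Metric.ball x₀ (2 * r))ᶜ := by
      rw [mem_compl_iff, Metric.mem_ball, Real.dist_eq, not_lt]; exact ht
    rw [indicator_of_mem ht', indicator_of_mem (show t ∈ {t | 2 * r ≤ |t - x₀|} from ht)]
    have h0 : 0 < |t - x₀| := by linarith [abs_nonneg (x - x₀)]
    have h1 : |t - x₀| / 2 ≤ |t - x| := by
      have := abs_sub_abs_le_abs_sub (t - x₀) (x - x₀)
      rw [show t - x₀ - (x - x₀) = t - x by ring] at this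
      linarith
    have h2 : ‖((t : ℂ) - (x : ℂ))‖ = |t - x| := by
      rw [← Complex.ofReal_sub, Complex.norm_real, Real.norm_eq_abs]
    rw [← mul_assoc, ← ofReal_norm, norm_div, h2, ← ofReal_norm, show (2 : ℝ≥0∞) = ENNReal.ofReal 2 by
      simp, ← ENNReal.ofReal_mul (by norm_num), ← ENNReal.ofReal_mul (by positivity)]
    refine ENNReal.ofReal_le_ofReal ?_
    rw [Real.rpow_neg_one, div_eq_mul_inv, mul_comm]
    gcongr
    calc |t - x|⁻¹ ≤ (|t - x₀| / 2)⁻¹ := inv_anti₀ (by positivity) h1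
      _ = _ := by field_simp
  · have ht' : t ∉ (Metric.ball x₀ (2 * r))ᶜ := by
      rw [mem_compl_iff, Metric.mem_ball, Real.dist_eq, not_not]; exact not_le.1 ht
    rw [indicator_of_notMem ht']
    simp

theorem MorreyBound.integrable {p lam : ℝ} (hp : 1 < p) (hlam : lam ≤ 1) {g : ℝ → ℂ}
    (hg : AEStronglyMeasurable g) {R : ℝ} (hR : ∀ t, R < |t| → g t = 0) {G : ℝ≥0∞} (hG : G ≠ ∞)
    (h : MorreyBound p lam (fun t => ‖g t‖ₑ) G) : Integrable g := by
  refine ⟨hg, ?_⟩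
  have h1 := h.lintegral_closedBall_le hp hlam hg.enorm 0 (R := |R| + 1) (by positivity)
  refine lt_of_le_of_lt ?_ (h1.trans_lt (ENNReal.mul_lt_top (ENNReal.mul_lt_top (by simp)
    hG.lt_top) (by simp)))
  rw [← lintegral_indicator Metric.isClosed_closedBall.measurableSet]
  refine lintegral_mono fun t => ?_
  by_cases ht : t ∈ Metric.closedBall (0 : ℝ) (|R| + 1)
  · rw [indicator_of_mem ht]
  · rw [Metric.mem_closedBall, Real.dist_eq, sub_zero, not_le] at ht
    simp [hR t (by linarith [le_abs_self R])]

theorem MorreyBound.lintegral_rpow_ne_top {p lam : ℝ} (hp : 0 < p) {g : ℝ → ℂ}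
    {R : ℝ} (hR : ∀ t, R < |t| → g t = 0) {G : ℝ≥0∞} (hG : G ≠ ∞)
    (h : MorreyBound p lam (fun t => ‖g t‖ₑ) G) : ∫⁻ t, ‖g t‖ₑ ^ p ≠ ∞ := by
  refine ne_top_of_le_ne_top (ENNReal.mul_ne_top (ENNReal.rpow_ne_top_of_nonneg hp.le hG)
    ENNReal.ofReal_ne_top) (le_trans ?_ (h 0 (|R| + 1) (by positivity)))
  rw [← lintegral_indicator Metric.isOpen_ball.measurableSet]
  refine lintegral_mono fun t => ?_
  by_cases ht : t ∈ Metric.ball (0 : ℝ) (|R| + 1)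
  · rw [indicator_of_mem ht]
  · rw [Metric.mem_ball, Real.dist_eq, sub_zero, not_lt] at ht
    simp [hR t (by linarith [le_abs_self R]), ENNReal.zero_rpow_of_pos hp]

/-- For a given ball, the part of g in the doubled ball is handled by the L^p theorem. The rest is
bounded on the ball by a constant of order G r^((λ-1)/p); the far integral converges since λ < 1. -/
theorem hilbert_morrey {p lam : ℝ} (hp : 1 < p) (hlam1 : lam < 1) :
    ∃ A : ℝ≥0, ∀ g : ℝ → ℂ, AEStronglyMeasurable g → (∃ R, ∀ t, R < |t| → g t = 0) →
    ∀ G : ℝ≥0∞, G ≠ ∞ → MorreyBound p lam (fun t => ‖g t‖ₑ) G →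
    ∃ h : ℝ → ℂ, AEStronglyMeasurable h ∧
      (∀ᵐ x : ℝ, Tendsto (fun ε => ∫ t in (Metric.closedBall x ε)ᶜ, g t / ((t : ℂ) - (x : ℂ)))
        (𝓝[>] 0) (𝓝 (h x))) ∧
      MorreyBound p lam (fun t => ‖h t‖ₑ) (A * G) := by
  have hp0 : 0 < p := by linarith
  obtain ⟨A₀, hA₀⟩ := hilbert_complex hp
  obtain ⟨C, hC⟩ := MorreyBound.lintegral_outer (p := p) (lam := lam) (a := 1) hp hlam1.le (by
    have : lam / p < 1 / p := by gcongr
    linarith)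
  refine ⟨2 * (A₀ + (2 * C) ^ p) ^ (1 / p), fun g hg ⟨R, hR⟩ G hG hM => ?_⟩
  have hgi : Integrable g := hM.integrable hp hlam1.le hg hR hG
  have hgp := hM.lintegral_rpow_ne_top hp0 hR hG
  obtain ⟨h, hh, hlim, -⟩ := hA₀ g hgi ⟨R, hR⟩ hgp
  refine ⟨h, hh, hlim, fun x₀ r hr => ?_⟩
  set B := Metric.ball x₀ (2 * r) with hB
  have hBm : MeasurableSet B := Metric.isOpen_ball.measurableSet
  have hle : ∫⁻ t, ‖B.indicator g t‖ₑ ^ p ≤ G ^ p * ENNReal.ofReal ((2 * r) ^ lam) := by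
    refine le_trans (le_of_eq ?_) (hM x₀ (2 * r) (by positivity))
    rw [← lintegral_indicator hBm]
    refine lintegral_congr fun t => ?_
    by_cases ht : t ∈ B
    · rw [indicator_of_mem ht, indicator_of_mem ht]
    · rw [indicator_of_notMem ht, indicator_of_notMem ht]; simp [ENNReal.zero_rpow_of_pos hp0]
  obtain ⟨h₁, hh₁, hlim₁, hb₁⟩ := hA₀ (B.indicator g) (hgi.indicator hBm)
    ⟨R, fun t ht => by by_cases h : t ∈ B <;> simp [h, hR t ht]⟩
    (ne_top_of_le_ne_top (ENNReal.mul_ne_top (ENNReal.rpow_ne_top_of_nonneg hp0.le hG)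
      ENNReal.ofReal_ne_top) hle)
  set K : ℝ≥0∞ := 2 * (C * G * ENNReal.ofReal ((2 * r) ^ ((lam - 1) / p))) with hK
  have hfar : ∀ x ∈ Metric.ball x₀ r, ∀ ε, ‖∫ t in (Metric.closedBall x ε)ᶜ,
      Bᶜ.indicator g t / ((t : ℂ) - (x : ℂ))‖ₑ ≤ K := fun x hx ε => by
    refine (enorm_far_integral_le hx).trans ?_
    rw [hK]
    gcongr
    refine (hC _ G hg.enorm hM x₀ (2 * r) (by positivity)).trans_eq ?_
    congr 3
    field_simp
    ring
  have hpt : ∀ᵐ x ∂volume.restrict (Metric.ball x₀ r), ‖h x‖ₑ ≤ ‖h₁ x‖ₑ + K := by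
    refine (ae_restrict_iff' Metric.isOpen_ball.measurableSet).2 ?_
    filter_upwards [hlim, hlim₁] with x hx hx1 hxB
    -- The difference of the two principal values is the limit of truncated integrals of the far
    -- part, all bounded by K.
    have h2 : ‖h x - h₁ x‖ₑ ≤ K := by
      refine le_of_tendsto ((hx.sub hx1).enorm) ?_
      filter_upwards [self_mem_nhdsWithin] with ε hε
      refine le_trans (le_of_eq ?_) (hfar x hxB ε)
      congr 1
      rw [← integral_sub (integrableOn_div_compl_closedBall hgi x hε)
        (integrableOn_div_compl_closedBall (hgi.indicator hBm) x hε)]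
      refine integral_congr_ae (Eventually.of_forall fun t => ?_)
      by_cases ht : t ∈ B <;> simp [ht]
    calc ‖h x‖ₑ = ‖h₁ x + (h x - h₁ x)‖ₑ := by rw [add_sub_cancel]
      _ ≤ ‖h₁ x‖ₑ + ‖h x - h₁ x‖ₑ := enorm_add_le _ _
      _ ≤ _ := by gcongr
  have h2t : (2 : ℝ≥0∞) ^ (p - 1) ≠ ∞ := ENNReal.rpow_ne_top_of_nonneg (by linarith) (by simp)
  have hKp : K ^ p * ENNReal.ofReal (2 * r) = (2 * C) ^ p * (G ^ p * ENNReal.ofReal ((2 * r) ^ lam)) := by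
    rw [hK, show (2 : ℝ≥0∞) * (C * G * ENNReal.ofReal ((2 * r) ^ ((lam - 1) / p))) =
      (2 * C) * G * ENNReal.ofReal ((2 * r) ^ ((lam - 1) / p)) by ring,
      ENNReal.mul_rpow_of_nonneg _ _ hp0.le, ENNReal.mul_rpow_of_nonneg _ _ hp0.le, mul_assoc,
      mul_assoc, ENNReal.ofReal_rpow_of_pos (by positivity), ← ENNReal.ofReal_mul (by positivity),
      ← Real.rpow_mul (by positivity), div_mul_cancel₀ _ hp0.ne', ← Real.rpow_add_one (by positivity),
      sub_add_cancel]
  calc _ ≤ ∫⁻ x in Metric.ball x₀ r, 2 ^ (p - 1) * (‖h₁ x‖ₑ ^ p + K ^ p) := by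
        refine lintegral_mono_ae (hpt.mono fun x hx => ?_)
        exact (ENNReal.rpow_le_rpow hx hp0.le).trans (ENNReal.rpow_add_le_mul_rpow_add_rpow _ _ hp.le)
    _ = 2 ^ (p - 1) * ((∫⁻ x in Metric.ball x₀ r, ‖h₁ x‖ₑ ^ p) + K ^ p * ENNReal.ofReal (2 * r)) := by
        rw [lintegral_const_mul' _ _ h2t, lintegral_add_right _ measurable_const, setLIntegral_const,
          Real.volume_ball]
    _ ≤ 2 ^ (p - 1) * (A₀ * (G ^ p * ENNReal.ofReal ((2 * r) ^ lam)) +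
          (2 * C) ^ p * (G ^ p * ENNReal.ofReal ((2 * r) ^ lam))) := by
        rw [hKp]
        gcongr
        exact (setLIntegral_le_lintegral _ _).trans (hb₁.trans (by gcongr))
    _ = 2 ^ (p - 1) * ENNReal.ofReal ((2 * r) ^ lam) * ((A₀ + (2 * C) ^ p) * G ^ p) := by ring
    _ ≤ 2 ^ (p - 1) * (2 * ENNReal.ofReal (r ^ lam)) * ((A₀ + (2 * C) ^ p) * G ^ p) := by
        gcongr
        rw [show (2 : ℝ≥0∞) = ENNReal.ofReal 2 by simp, ← ENNReal.ofReal_mul (by norm_num),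
          Real.mul_rpow (by norm_num) hr.le]
        refine ENNReal.ofReal_le_ofReal ?_
        gcongr
        calc (2 : ℝ) ^ lam ≤ 2 ^ (1 : ℝ) := Real.rpow_le_rpow_of_exponent_le (by norm_num) hlam1.le
          _ = 2 := by norm_num
    _ = _ := by
        have e1 : (2 : ℝ≥0∞) ^ (p - 1) * 2 = 2 ^ p := by
          nth_rewrite 2 [← ENNReal.rpow_one 2]
          rw [← ENNReal.rpow_add _ _ (by simp) (by simp), sub_add_cancel]
        have e2 : (((A₀ + (2 * C) ^ p) ^ (1 / p) : ℝ≥0) : ℝ≥0∞) ^ p = A₀ + (2 * C) ^ p := by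
          rw [ENNReal.coe_rpow_of_nonneg _ (by positivity : (0 : ℝ) ≤ 1 / p), ← ENNReal.rpow_mul,
            one_div_mul_cancel hp0.ne', ENNReal.rpow_one]
          push_cast
          rw [ENNReal.coe_rpow_of_nonneg _ hp0.le]
          push_cast
          rfl
        rw [ENNReal.coe_mul, ENNReal.mul_rpow_of_nonneg _ G hp0.le, ENNReal.mul_rpow_of_nonneg
          ((2 : ℝ≥0) : ℝ≥0∞) _ hp0.le, e2, ENNReal.coe_ofNat, ← e1]
        ring

/-! ### The commutator with the weight and the boundedness theorem. -/

/-! ### Kernel estimates for product weights -/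

theorem hardyKernel_of_lt {b g X T : ℝ} (hX : 0 < X) (hT : 0 < T) (h : T < X) :
    hardyKernel b g X T = (X / T) ^ g / X := by
  rw [hardyKernel, if_pos h, Real.rpow_sub_one hX.ne', Real.div_rpow hX.le hT.le,
    Real.rpow_neg hT.le]
  ring

theorem hardyKernel_of_le {b g X T : ℝ} (hX : 0 < X) (hT : 0 < T) (h : X ≤ T) :
    hardyKernel b g X T = (X / T) ^ b / T := by
  rw [hardyKernel, if_neg h.not_gt, Real.rpow_sub_one hT.ne', Real.div_rpow hX.le hT.le,
    Real.rpow_neg hT.le]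
  ring

/-- For comparable X and T the Lipschitz estimate suffices. Otherwise |X - T| is at least half of
the larger argument and the power estimates bound φ(X) by φ(T). The signs b ≤ 0 ≤ g make the power
factor at least 1, so that it also absorbs the summand φ(T). -/
theorem abs_sub_le_hardyKernel {ℓ b g L : ℝ} {φ : ℝ → ℝ} (hb : b ≤ 0) (hg : 0 ≤ g)
    (hpos : ∀ x ∈ Ioc 0 ℓ, 0 < φ x) (hU : PowerUpper ℓ b φ) (hLo : PowerLower ℓ g φ) (hL0 : 0 < L)
    (hL : ∀ x ∈ Ioc 0 ℓ, ∀ y ∈ Ioc 0 ℓ, x / 2 ≤ y → y ≤ 2 * x →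
      |φ x - φ y| ≤ L * φ y * (|x - y| / x)) :
    ∃ C : ℝ, 0 < C ∧ ∀ X ∈ Ioc 0 ℓ, ∀ T ∈ Ioc 0 ℓ,
      |φ X - φ T| ≤ C * φ T * (|X - T| * hardyKernel b g X T) := by
  obtain ⟨C₁, hC₁, hU⟩ := hU
  obtain ⟨C₂, hC₂, hLo⟩ := hLo
  refine ⟨2 * (L + C₁ + C₂ + 1), by positivity, fun X hX T hT => ?_⟩
  have hX0 := hX.1
  have hT0 := hT.1
  have hφX := hpos X hX
  have hφT := hpos T hT
  have habs : |φ X - φ T| ≤ φ X + φ T := by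
    refine (abs_sub _ _).trans_eq ?_
    rw [abs_of_pos hφX, abs_of_pos hφT]
  rcases lt_or_ge T X with h | h
  · rw [hardyKernel_of_lt hX0 hT0 h]
    have hq : 1 ≤ (X / T) ^ g := Real.one_le_rpow ((one_le_div hT0).2 h.le) hg
    by_cases h2 : X / 2 ≤ T
    · calc |φ X - φ T| ≤ L * φ T * (|X - T| / X) := hL X hX T hT h2 (by linarith)
        _ = L * φ T * (|X - T| * (1 / X)) := by ring
        _ ≤ 2 * (L + C₁ + C₂ + 1) * φ T * (|X - T| * ((X / T) ^ g / X)) := by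
            gcongr
            linarith
    · have h3 : X / 2 ≤ |X - T| := by
        rw [abs_of_pos (by linarith)]; linarith
      calc |φ X - φ T| ≤ C₂ * (X / T) ^ g * φ T + φ T := by
            linarith [hLo T X hT0 h.le hX.2]
        _ ≤ C₂ * (X / T) ^ g * φ T + (X / T) ^ g * φ T := by nlinarith
        _ = 2 * (C₂ + 1) * φ T * (X / 2 * ((X / T) ^ g / X)) := by field_simp
        _ ≤ _ := by
            gcongr
            linarith
  · rw [hardyKernel_of_le hX0 hT0 h]
    have hq : 1 ≤ (X / T) ^ b :=
      Real.one_le_rpow_of_pos_of_le_one_of_nonpos (by positivity) ((div_le_one hT0).2 h) hb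
    by_cases h2 : T ≤ 2 * X
    · calc |φ X - φ T| ≤ L * φ T * (|X - T| / X) := hL X hX T hT (by linarith) h2
        _ = L * φ T * (|X - T| * (2 * (1 / (2 * X)))) := by field_simp
        _ ≤ L * φ T * (|X - T| * (2 * ((X / T) ^ b / T))) := by gcongr
        _ = 2 * L * φ T * (|X - T| * ((X / T) ^ b / T)) := by ring
        _ ≤ 2 * (L + C₁ + C₂ + 1) * φ T * (|X - T| * ((X / T) ^ b / T)) := by
            gcongr
            linarith
    · have h3 : T / 2 ≤ |X - T| := by
        rw [abs_of_nonpos (by linarith)]; linarith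
      calc |φ X - φ T| ≤ C₁ * (X / T) ^ b * φ T + φ T := by
            linarith [hU X T hX0 h hT.2]
        _ ≤ C₁ * (X / T) ^ b * φ T + (X / T) ^ b * φ T := by nlinarith
        _ = 2 * (C₁ + 1) * φ T * (T / 2 * ((X / T) ^ b / T)) := by field_simp
        _ ≤ _ := by
            gcongr
            linarith

theorem le_const_mul_of_ge {ℓ b g δ : ℝ} {φ : ℝ → ℝ} (hb : b ≤ 0) (hg : 0 ≤ g) (hδ : 0 < δ)
    (hpos : ∀ x ∈ Ioc 0 ℓ, 0 < φ x) (hU : PowerUpper ℓ b φ) (hLo : PowerLower ℓ g φ) :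
    ∃ M : ℝ, 0 < M ∧ ∀ X ∈ Icc δ ℓ, ∀ T ∈ Icc δ ℓ, φ X ≤ M * φ T := by
  obtain ⟨C₁, hC₁, hU⟩ := hU
  obtain ⟨C₂, hC₂, hLo⟩ := hLo
  by_cases hδℓ : δ ≤ ℓ
  swap
  · exact ⟨1, one_pos, fun X hX => absurd (hX.1.trans hX.2) hδℓ⟩
  have hℓ : 0 < ℓ := hδ.trans_le hδℓ
  refine ⟨C₁ * (δ / ℓ) ^ b + C₂ * (ℓ / δ) ^ g, by positivity, fun X hX T hT => ?_⟩
  have hX0 : 0 < X := hδ.trans_le hX.1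
  have hT0 : 0 < T := hδ.trans_le hT.1
  have hφT := hpos T ⟨hT0, hT.2⟩
  rcases le_total X T with h | h
  · calc φ X ≤ C₁ * (X / T) ^ b * φ T := hU X T hX0 h hT.2
      _ ≤ (C₁ * (δ / ℓ) ^ b + 0) * φ T := by
          rw [add_zero]
          gcongr C₁ * ?_ * φ T
          refine Real.rpow_le_rpow_of_nonpos (by positivity) ?_ hb
          exact div_le_div₀ hX0.le hX.1 hT0 hT.2
      _ ≤ _ := by gcongr; positivity
  · calc φ X ≤ C₂ * (X / T) ^ g * φ T := hLo T X hT0 h hX.2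
      _ ≤ (0 + C₂ * (ℓ / δ) ^ g) * φ T := by
          rw [zero_add]
          gcongr C₂ * ?_ * φ T
          exact Real.rpow_le_rpow (by positivity) (div_le_div₀ hℓ.le hX.2 hδ hT.1) hg
      _ ≤ _ := by gcongr; positivity

theorem exists_pos_le_of_finite {ι : Type*} [Finite ι] (f : ι → ℝ) (hf : ∀ i, 0 < f i) :
    ∃ δ : ℝ, 0 < δ ∧ ∀ i, δ ≤ f i := by
  rcases isEmpty_or_nonempty ι with h | h
  · exact ⟨1, one_pos, fun i => h.elim i⟩
  · obtain ⟨i, hi⟩ := Finite.exists_min f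
    exact ⟨f i, hf i, hi⟩

theorem exists_ge_of_finite {ι : Type*} [Finite ι] (f : ι → ℝ) : ∃ C : ℝ, 0 < C ∧ ∀ i, f i ≤ C := by
  obtain ⟨B, hB⟩ := (Set.finite_range f).bddAbove
  exact ⟨max B 1, by positivity, fun i => (hB (mem_range_self i)).trans (le_max_left _ _)⟩

/-- Telescoping by induction on the set of factors. The separation hypothesis says that of any two
factors at least one has both arguments at least δ, hence a ratio bounded by M. -/
theorem abs_prod_sub_prod_le {ι : Type*} [Fintype ι] {ℓ b g δ : ℝ} {φ : ι → ℝ → ℝ}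
    (hpos : ∀ k, ∀ x ∈ Ioc 0 ℓ, 0 < φ k x) {C M : ℝ} (hC : 0 < C) (hM : 0 < M)
    (hCφ : ∀ k, ∀ X ∈ Ioc 0 ℓ, ∀ T ∈ Ioc 0 ℓ,
      |φ k X - φ k T| ≤ C * φ k T * (|X - T| * hardyKernel b g X T))
    (hMφ : ∀ k, ∀ X ∈ Icc δ ℓ, ∀ T ∈ Icc δ ℓ, φ k X ≤ M * φ k T) (s : Finset ι) :
    ∃ D : ℝ, 0 < D ∧ ∀ X T : ι → ℝ, (∀ k, X k ∈ Ioc 0 ℓ) → (∀ k, T k ∈ Ioc 0 ℓ) → ∀ d : ℝ,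
      (∀ k, |X k - T k| ≤ d) →
      (∀ j k, j ≠ k → (δ ≤ X j ∧ δ ≤ T j) ∨ (δ ≤ X k ∧ δ ≤ T k)) →
      |∏ k ∈ s, φ k (X k) - ∏ k ∈ s, φ k (T k)| ≤
        D * (∏ k ∈ s, φ k (T k)) * (d * ∑ k ∈ s, hardyKernel b g (X k) (T k)) := by
  classical
  induction s using Finset.induction_on with
  | empty => exact ⟨1, one_pos, fun X T _ _ d _ _ => by simp⟩
  | insert k s hk ih =>
    obtain ⟨D, hD, ih⟩ := ih
    refine ⟨D * M + D + C + C * M ^ s.card, by positivity, fun X T hX hT d hd hsep => ?_⟩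
    have ih := ih X T hX hT d hd hsep
    rw [Finset.prod_insert hk, Finset.prod_insert hk, Finset.sum_insert hk]
    set P := ∏ j ∈ s, φ j (X j)
    set Q := ∏ j ∈ s, φ j (T j)
    set H := ∑ j ∈ s, hardyKernel b g (X j) (T j)
    have hQ : 0 < Q := Finset.prod_pos fun j _ => hpos j _ (hT j)
    have hP : 0 < P := Finset.prod_pos fun j _ => hpos j _ (hX j)
    have hd0 : 0 ≤ d := (abs_nonneg _).trans (hd k)
    have hH : 0 ≤ H := Finset.sum_nonneg fun j _ => hardyKernel_nonneg _ _ (hX j).1.le (hT j).1.le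
    have hhk : 0 ≤ hardyKernel b g (X k) (T k) := hardyKernel_nonneg _ _ (hX k).1.le (hT k).1.le
    have hφX := hpos k _ (hX k)
    have hφT := hpos k _ (hT k)
    have hone : |φ k (X k) - φ k (T k)| ≤ C * φ k (T k) * (d * hardyKernel b g (X k) (T k)) :=
      (hCφ k _ (hX k) _ (hT k)).trans (by gcongr; exact hd k)
    have hsum1 : d * H ≤ d * (hardyKernel b g (X k) (T k) + H) := by gcongr; linarith
    have hsum2 : d * hardyKernel b g (X k) (T k) ≤ d * (hardyKernel b g (X k) (T k) + H) := by
      gcongr; linarith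
    set S := d * (hardyKernel b g (X k) (T k) + H)
    have hS : 0 ≤ S := by positivity
    -- The order of telescoping depends on which ratios are bounded: if factor k is far from 0, its
    -- value at X k is exchanged for that at T k; otherwise all the other factors are far and P is
    -- exchanged for Q.
    by_cases hfar : δ ≤ X k ∧ δ ≤ T k
    · have hr := hMφ k _ ⟨hfar.1, (hX k).2⟩ _ ⟨hfar.2, (hT k).2⟩
      calc |φ k (X k) * P - φ k (T k) * Q|
          = |φ k (X k) * (P - Q) + (φ k (X k) - φ k (T k)) * Q| := by ring_nf
        _ ≤ |φ k (X k) * (P - Q)| + |(φ k (X k) - φ k (T k)) * Q| := abs_add_le _ _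
        _ = φ k (X k) * |P - Q| + |φ k (X k) - φ k (T k)| * Q := by
            rw [abs_mul, abs_mul, abs_of_pos hφX, abs_of_pos hQ]
        _ ≤ (M * φ k (T k)) * (D * Q * (d * H)) +
              (C * φ k (T k) * (d * hardyKernel b g (X k) (T k))) * Q := by gcongr
        _ ≤ (M * φ k (T k)) * (D * Q * S) + (C * φ k (T k) * S) * Q := by gcongr
        _ = (D * M + 0 + C + 0) * (φ k (T k) * Q) * S := by ring
        _ ≤ _ := by gcongr; positivity
    · have hPQ : P ≤ M ^ s.card * Q := by
        calc P ≤ ∏ j ∈ s, M * φ j (T j) := by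
              refine Finset.prod_le_prod (fun j _ => (hpos j _ (hX j)).le) fun j hj => ?_
              have hjk : j ≠ k := fun h => hk (h ▸ hj)
              have := (hsep j k hjk).resolve_right hfar
              exact hMφ j _ ⟨this.1, (hX j).2⟩ _ ⟨this.2, (hT j).2⟩
          _ = _ := by rw [Finset.prod_mul_distrib, Finset.prod_const]
      calc |φ k (X k) * P - φ k (T k) * Q|
          = |φ k (T k) * (P - Q) + (φ k (X k) - φ k (T k)) * P| := by ring_nf
        _ ≤ |φ k (T k) * (P - Q)| + |(φ k (X k) - φ k (T k)) * P| := abs_add_le _ _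
        _ = φ k (T k) * |P - Q| + |φ k (X k) - φ k (T k)| * P := by
            rw [abs_mul, abs_mul, abs_of_pos hφT, abs_of_pos hP]
        _ ≤ φ k (T k) * (D * Q * (d * H)) +
              (C * φ k (T k) * (d * hardyKernel b g (X k) (T k))) * (M ^ s.card * Q) := by gcongr
        _ ≤ φ k (T k) * (D * Q * S) + (C * φ k (T k) * S) * (M ^ s.card * Q) := by gcongr
        _ = (0 + D + 0 + C * M ^ s.card) * (φ k (T k) * Q) * S := by ring
        _ ≤ _ := by gcongr; positivity

/-- At most one X k is below δ, and the remaining powers are bounded; the product of singularities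
is therefore dominated by their sum. -/
theorem prod_rpow_neg_le {ι : Type*} [Fintype ι] {s δ : ℝ} (hs : 0 ≤ s) (hδ : 0 < δ) :
    ∃ C : ℝ, 0 < C ∧ ∀ X : ι → ℝ, (∀ k, 0 < X k) → (∀ j k, j ≠ k → δ ≤ X j ∨ δ ≤ X k) →
      ∏ k, X k ^ (-s) ≤ C * (1 + ∑ k, X k ^ (-s)) := by
  classical
  set M := max 1 (δ ^ (-s)) with hM
  have hM1 : 1 ≤ M := le_max_left _ _
  have hfar : ∀ r : ℝ, δ ≤ r → r ^ (-s) ≤ M := fun r hr =>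
    (Real.rpow_le_rpow_of_nonpos hδ hr (by linarith)).trans (le_max_right _ _)
  refine ⟨M ^ Fintype.card ι, by positivity, fun X hX hsep => ?_⟩
  have hnn : ∀ k, 0 ≤ X k ^ (-s) := fun k => Real.rpow_nonneg (hX k).le _
  by_cases h : ∀ k, δ ≤ X k
  · calc ∏ k, X k ^ (-s) ≤ ∏ _k : ι, M := Finset.prod_le_prod (fun k _ => hnn k) fun k _ => hfar _ (h k)
      _ = M ^ Fintype.card ι * (1 + 0) := by rw [Finset.prod_const, Finset.card_univ]; ring
      _ ≤ _ := by
          gcongr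
          exact Finset.sum_nonneg fun k _ => hnn k
  · push Not at h
    obtain ⟨k, hk⟩ := h
    rw [← Finset.mul_prod_erase _ _ (Finset.mem_univ k)]
    calc X k ^ (-s) * ∏ j ∈ Finset.univ.erase k, X j ^ (-s)
        ≤ X k ^ (-s) * ∏ _j ∈ Finset.univ.erase k, M := by
          refine mul_le_mul_of_nonneg_left (Finset.prod_le_prod (fun k _ => hnn k) fun j hj => ?_) (hnn k)
          exact hfar _ ((hsep j k (Finset.ne_of_mem_erase hj)).resolve_right hk.not_ge)
      _ ≤ X k ^ (-s) * M ^ Fintype.card ι := by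
          rw [Finset.prod_const]
          refine mul_le_mul_of_nonneg_left (pow_le_pow_right₀ hM1 ?_) (hnn k)
          exact (Finset.card_le_univ _)
      _ ≤ (1 + ∑ k, X k ^ (-s)) * M ^ Fintype.card ι := by
          gcongr
          have := Finset.single_le_sum (f := fun k => X k ^ (-s)) (fun j _ => hnn j) (Finset.mem_univ k)
          linarith
      _ = _ := by ring

/-- For |y - t| < δ at most one node can be close to y or t, and the product estimate gives the
Hardy kernels. For |y - t| ≥ δ the Cauchy kernel is bounded, and ρ(y) and 1/ρ(t) are estimated
separately by sums of powers; this gives the product term. -/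
theorem exists_weight_kernel_bounds {ι : Type*} [Fintype ι] {l u b g : ℝ} (hlu : l < u) (hb : b ≤ 0)
    (hg : 0 ≤ g) {z : ι → ℝ} (hz : ∀ k, z k ∈ Icc l u) (hinj : Function.Injective z)
    {φ : ι → ℝ → ℝ} (hpos : ∀ k, ∀ x ∈ Ioc 0 (u - l), 0 < φ k x)
    (hU : ∀ k, PowerUpper (u - l) b (φ k)) (hLo : ∀ k, PowerLower (u - l) g (φ k))
    (hL : ∀ k, ∃ L : ℝ, 0 < L ∧ ∀ x ∈ Ioc 0 (u - l), ∀ y ∈ Ioc 0 (u - l), x / 2 ≤ y → y ≤ 2 * x →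
      |φ k x - φ k y| ≤ L * φ k y * (|x - y| / x)) :
    ∃ C : ℝ, 0 < C ∧
      (∀ t ∈ Icc l u, (∀ k, t ≠ z k) →
        1 ≤ C * (∏ k, φ k |t - z k|) * (1 + ∑ k, |t - z k| ^ (-g))) ∧
      ∀ y ∈ Icc l u, (∀ k, y ≠ z k) → ∀ t ∈ Icc l u, (∀ k, t ≠ z k) →
        |(∏ k, φ k (|y - z k|)) - ∏ k, φ k (|t - z k|)| ≤ C * (∏ k, φ k |t - z k|) * (|y - t| *
          (∑ k, hardyKernel b g |y - z k| |t - z k| +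
            (1 + ∑ k, |y - z k| ^ b) * (1 + ∑ k, |t - z k| ^ (-g)))) := by
  have hℓ : 0 < u - l := by linarith
  -- A third of the smallest distance between nodes: a point within δ of one node and another within
  -- δ of it near a second node would put the nodes at distance less than 3δ.
  obtain ⟨δ, hδ, hsep⟩ := exists_pos_le_of_finite (ι := {q : ι × ι // q.1 ≠ q.2})
    (fun q => |z q.1.1 - z q.1.2| / 3) fun q => by
      have : z q.1.1 - z q.1.2 ≠ 0 := sub_ne_zero.2 (hinj.ne q.2)
      positivity
  have hsep : ∀ j k, j ≠ k → 3 * δ ≤ |z j - z k| := fun j k h => by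
    have := hsep ⟨(j, k), h⟩
    simp only at this
    linarith
  choose L hL0 hL using hL
  choose C₁ hC₁ hCφ using fun k => abs_sub_le_hardyKernel hb hg (hpos k) (hU k) (hLo k) (hL0 k) (hL k)
  choose M₁ hM₁ hMφ using fun k => le_const_mul_of_ge hb hg hδ (hpos k) (hU k) (hLo k)
  obtain ⟨C, hC, hCle⟩ := exists_ge_of_finite C₁
  obtain ⟨M, hM, hMle⟩ := exists_ge_of_finite M₁
  obtain ⟨D, hD, hnear⟩ := abs_prod_sub_prod_le (δ := δ) hpos hC hM
    (fun k X hX T hT => (hCφ k X hX T hT).trans (by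
      have := hpos k T hT
      have := hardyKernel_nonneg b g hX.1.le hT.1.le
      gcongr
      exact hCle k))
    (fun k X hX T hT => (hMφ k X hX T hT).trans (by
      have := hpos k T ⟨hδ.trans_le hT.1, hT.2⟩
      gcongr
      exact hMle k)) Finset.univ
  have hrange : ∀ t ∈ Icc l u, (∀ k, t ≠ z k) → ∀ k, |t - z k| ∈ Ioc 0 (u - l) := fun t ht hne k =>
    ⟨abs_pos.2 (sub_ne_zero.2 (hne k)), by
      rw [abs_le]; constructor <;> linarith [ht.1, ht.2, (hz k).1, (hz k).2]⟩
  have hsep1 : ∀ t : ℝ, ∀ j k, j ≠ k → δ ≤ |t - z j| ∨ δ ≤ |t - z k| := fun t j k hjk => by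
    by_contra! h
    have h1 := hsep j k hjk
    have h2 := abs_sub_le (z j) t (z k)
    rw [abs_sub_comm (z j) t] at h2
    linarith [h.1, h.2]
  have hupper : ∃ A : ℝ, 0 < A ∧ ∀ y ∈ Icc l u, (∀ k, y ≠ z k) →
      ∏ k, φ k |y - z k| ≤ A * (1 + ∑ k, |y - z k| ^ b) := by
    choose E hE hU using hU
    obtain ⟨F, hF, hprod⟩ := prod_rpow_neg_le (ι := ι) (s := -b) (by linarith) hδ
    have hK : ∀ k, 0 < E k * (u - l) ^ (-b) * φ k (u - l) := fun k => by
      have := hpos k _ ⟨hℓ, le_rfl⟩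
      have := hE k
      positivity
    refine ⟨(∏ k, E k * (u - l) ^ (-b) * φ k (u - l)) * F,
      mul_pos (Finset.prod_pos fun k _ => hK k) hF, fun y hy hne => ?_⟩
    have hr := hrange y hy hne
    have hp := hprod (fun k => |y - z k|) (fun k => (hr k).1) (hsep1 y)
    rw [neg_neg] at hp
    calc ∏ k, φ k |y - z k|
        ≤ ∏ k, (E k * (u - l) ^ (-b) * φ k (u - l)) * |y - z k| ^ b := by
          refine Finset.prod_le_prod (fun k _ => (hpos k _ (hr k)).le) fun k _ => ?_
          refine (hU k _ _ (hr k).1 (hr k).2 le_rfl).trans_eq ?_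
          rw [Real.div_rpow (abs_nonneg _) hℓ.le, Real.rpow_neg hℓ.le]
          ring
      _ = (∏ k, E k * (u - l) ^ (-b) * φ k (u - l)) * ∏ k, |y - z k| ^ b := Finset.prod_mul_distrib
      _ ≤ (∏ k, E k * (u - l) ^ (-b) * φ k (u - l)) * (F * (1 + ∑ k, |y - z k| ^ b)) :=
          mul_le_mul_of_nonneg_left hp (Finset.prod_nonneg fun k _ => (hK k).le)
      _ = _ := by ring
  have hlower : ∃ A : ℝ, 0 < A ∧ ∀ t ∈ Icc l u, (∀ k, t ≠ z k) →
      1 ≤ A * (∏ k, φ k |t - z k|) * (1 + ∑ k, |t - z k| ^ (-g)) := by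
    choose E hE hLo using hLo
    obtain ⟨F, hF, hprod⟩ := prod_rpow_neg_le (ι := ι) (s := g) hg hδ
    have hK : ∀ k, 0 < E k * (u - l) ^ g / φ k (u - l) := fun k => by
      have := hpos k _ ⟨hℓ, le_rfl⟩
      have := hE k
      positivity
    refine ⟨(∏ k, E k * (u - l) ^ g / φ k (u - l)) * F,
      mul_pos (Finset.prod_pos fun k _ => hK k) hF, fun t ht hne => ?_⟩
    have hr := hrange t ht hne
    have hp := hprod (fun k => |t - z k|) (fun k => (hr k).1) (hsep1 t)
    have hρ : 0 < ∏ k, φ k |t - z k| := Finset.prod_pos fun k _ => hpos k _ (hr k)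
    calc (1 : ℝ) = ∏ _k : ι, (1 : ℝ) := by simp
      _ ≤ ∏ k, (E k * (u - l) ^ g / φ k (u - l)) * |t - z k| ^ (-g) * φ k |t - z k| := by
          refine Finset.prod_le_prod (fun k _ => zero_le_one) fun k _ => ?_
          have h0 := hpos k _ ⟨hℓ, le_rfl⟩
          have := hLo k _ _ (hr k).1 (hr k).2 le_rfl
          rw [Real.div_rpow hℓ.le (abs_nonneg _)] at this
          have h1 := (hr k).1
          rw [Real.rpow_neg (abs_nonneg _)]
          rw [show E k * (u - l) ^ g / φ k (u - l) * (|t - z k| ^ g)⁻¹ * φ k |t - z k| =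
            (E k * ((u - l) ^ g / |t - z k| ^ g) * φ k |t - z k|) / φ k (u - l) by ring]
          rwa [one_le_div h0]
      _ = (∏ k, E k * (u - l) ^ g / φ k (u - l)) * (∏ k, |t - z k| ^ (-g)) *
            ∏ k, φ k |t - z k| := by
          rw [Finset.prod_mul_distrib, Finset.prod_mul_distrib]
      _ ≤ (∏ k, E k * (u - l) ^ g / φ k (u - l)) * (F * (1 + ∑ k, |t - z k| ^ (-g))) *
            ∏ k, φ k |t - z k| := by
          refine mul_le_mul_of_nonneg_right (mul_le_mul_of_nonneg_left hp ?_) hρ.le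
          exact Finset.prod_nonneg fun k _ => (hK k).le
      _ = _ := by ring
  obtain ⟨A₁, hA₁, hupper⟩ := hupper
  obtain ⟨A₂, hA₂, hlower⟩ := hlower
  refine ⟨A₂ + D + (A₁ * A₂ + 1) / δ, by positivity, fun t ht hne => (hlower t ht hne).trans ?_,
    fun y hy hyne t ht htne => ?_⟩
  · have hρ : 0 < ∏ k, φ k |t - z k| := Finset.prod_pos fun k _ => hpos k _ (hrange t ht hne k)
    have : 0 ≤ ∑ k, |t - z k| ^ (-g) := Finset.sum_nonneg fun k _ => by positivity
    gcongr
    have : 0 < (A₁ * A₂ + 1) / δ := by positivity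
    linarith
  have hry := hrange y hy hyne
  have hrt := hrange t ht htne
  have hρt : 0 < ∏ k, φ k |t - z k| := Finset.prod_pos fun k _ => hpos k _ (hrt k)
  have hρy : 0 < ∏ k, φ k |y - z k| := Finset.prod_pos fun k _ => hpos k _ (hry k)
  have hup := hupper y hy hyne
  have hlo := hlower t ht htne
  have hA : 1 ≤ 1 + ∑ k, |y - z k| ^ b := by
    have : 0 ≤ ∑ k, |y - z k| ^ b := Finset.sum_nonneg fun k _ => by positivity
    linarith
  have hB : 1 ≤ 1 + ∑ k, |t - z k| ^ (-g) := by
    have : 0 ≤ ∑ k, |t - z k| ^ (-g) := Finset.sum_nonneg fun k _ => by positivity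
    linarith
  have hH : 0 ≤ ∑ k, hardyKernel b g |y - z k| |t - z k| :=
    Finset.sum_nonneg fun k _ => hardyKernel_nonneg _ _ (abs_nonneg _) (abs_nonneg _)
  have hnear := hnear (fun k => |y - z k|) (fun k => |t - z k|) hry hrt |y - t| (fun k => by
    have := abs_abs_sub_abs_le (y - z k) (t - z k)
    rwa [show y - z k - (t - z k) = y - t by ring] at this)
  set A := 1 + ∑ k, |y - z k| ^ b
  set B := 1 + ∑ k, |t - z k| ^ (-g)
  set H := ∑ k, hardyKernel b g |y - z k| |t - z k|
  set ρy := ∏ k, φ k |y - z k|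
  set ρt := ∏ k, φ k |t - z k|
  rcases lt_or_ge |y - t| δ with hyt | hyt
  · have := hnear fun j k hjk => by
      by_contra! h
      have h1 := hsep j k hjk
      have hj : |y - z j| < 2 * δ := by
        by_cases h3 : δ ≤ |y - z j|
        · have := h.1 h3
          have := abs_sub_le y t (z j)
          linarith
        · linarith [not_le.1 h3]
      by_cases h4 : δ ≤ |y - z k|
      · have h5 := h.2 h4
        have h6 : |t - z j| < 2 * δ := by
          by_cases h3 : δ ≤ |y - z j|
          · linarith [h.1 h3]
          · have := abs_sub_le t y (z j)
            rw [abs_sub_comm t y] at this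
            linarith [not_le.1 h3]
        have := abs_sub_le (z j) t (z k)
        rw [abs_sub_comm (z j) t] at this
        linarith
      · have := abs_sub_le (z j) y (z k)
        rw [abs_sub_comm (z j) y] at this
        linarith [not_le.1 h4]
    refine this.trans ?_
    have hAB : 0 ≤ A * B := by positivity
    have : 0 < (A₁ * A₂ + 1) / δ := by positivity
    gcongr
    · linarith
    · linarith
  · calc |ρy - ρt| ≤ ρy + ρt := by
          refine (abs_sub _ _).trans_eq ?_
          rw [abs_of_pos hρy, abs_of_pos hρt]
      _ ≤ (A₁ * A) * (A₂ * ρt * B) + ρt * (A * B) := by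
          have h1 : ρy ≤ (A₁ * A) * (A₂ * ρt * B) :=
            hup.trans (le_mul_of_one_le_right (by positivity) hlo)
          have h2 : ρt ≤ ρt * (A * B) := le_mul_of_one_le_right hρt.le (one_le_mul_of_one_le_of_one_le hA hB)
          linarith
      _ = (0 + 0 + (A₁ * A₂ + 1) / δ) * ρt * (δ * (0 + A * B)) := by field_simp; ring
      _ ≤ _ := by gcongr

/-! ### The dominating operator -/

theorem MorreyBound.lintegral_rpow_le {p lam a : ℝ} (hp : 1 < p) (hlam : lam ≤ 1)
    (ha : a < lam / p + (1 - 1 / p)) {l u : ℝ} (hlu : l < u) : ∃ C : ℝ≥0,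
    ∀ (v : ℝ → ℝ≥0∞) (G : ℝ≥0∞), AEMeasurable v → (∀ t ∉ Icc l u, v t = 0) → MorreyBound p lam v G →
      ∀ c ∈ Icc l u, ∫⁻ t, ENNReal.ofReal (|t - c| ^ (-a)) * v t ≤ C * G := by
  obtain ⟨C, hC⟩ := MorreyBound.lintegral_inner hp hlam ha
  refine ⟨C * Real.toNNReal ((u - l) ^ (lam / p + (1 - 1 / p) - a)), fun v G hv hsupp h c hc => ?_⟩
  have hm : Measurable fun t : ℝ => |t - c| := by fun_prop
  calc _ ≤ ∫⁻ t in {t | |t - c| ≤ u - l}, ENNReal.ofReal (|t - c| ^ (-a)) * v t := by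
        rw [← lintegral_indicator (measurableSet_le hm measurable_const)]
        refine lintegral_mono fun t => ?_
        by_cases ht : t ∈ Icc l u
        · rw [indicator_of_mem]
          change |t - c| ≤ u - l
          rw [abs_le]
          constructor <;> linarith [ht.1, ht.2, hc.1, hc.2]
        · simp [hsupp t ht]
    _ ≤ _ := hC v G hv h c (u - l) (by linarith)
    _ = _ := by
        push_cast
        simp only [ENNReal.ofReal]
        ring

theorem ofReal_one_add_sum {ι : Type*} [Fintype ι] {f : ι → ℝ} (hf : ∀ k, 0 ≤ f k) :
    ENNReal.ofReal (1 + ∑ k, f k) = 1 + ∑ k, ENNReal.ofReal (f k) := by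
  rw [ENNReal.ofReal_add zero_le_one (Finset.sum_nonneg fun k _ => hf k),
    ENNReal.ofReal_sum_of_nonneg fun k _ => hf k, ENNReal.ofReal_one]

/-- Serves twice: it bounds the linear functional in the product part of the kernel, and it shows
that functions of the weighted space are integrable. -/
theorem MorreyBound.lintegral_weight_le {p lam g : ℝ} (hp : 1 < p) (hlam0 : 0 ≤ lam) (hlam : lam ≤ 1)
    (hg : g < lam / p + (1 - 1 / p)) {l u : ℝ} (hlu : l < u) {ι : Type*} [Fintype ι] {z : ι → ℝ}
    (hz : ∀ k, z k ∈ Icc l u) : ∃ C : ℝ≥0,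
    ∀ (v : ℝ → ℝ≥0∞) (G : ℝ≥0∞), AEMeasurable v → (∀ t ∉ Icc l u, v t = 0) → MorreyBound p lam v G →
      ∫⁻ t, ENNReal.ofReal (1 + ∑ k, |t - z k| ^ (-g)) * v t ≤ C * G := by
  have hp1 : 1 / p < 1 := (div_lt_one (by linarith)).2 hp
  have hlp : 0 ≤ lam / p := by positivity
  obtain ⟨C₀, h0⟩ := MorreyBound.lintegral_rpow_le hp hlam (a := 0) (by linarith) hlu
  obtain ⟨C, hC⟩ := MorreyBound.lintegral_rpow_le hp hlam hg hlu
  refine ⟨C₀ + Fintype.card ι * C, fun v G hv hsupp h => ?_⟩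
  have hpt : ∀ t, ENNReal.ofReal (1 + ∑ k, |t - z k| ^ (-g)) * v t =
      ENNReal.ofReal (|t - l| ^ (-(0 : ℝ))) * v t + ∑ k, ENNReal.ofReal (|t - z k| ^ (-g)) * v t := by
    intro t
    rw [ofReal_one_add_sum fun k => by positivity, neg_zero, Real.rpow_zero, ENNReal.ofReal_one,
      add_mul, Finset.sum_mul]
  have hmeas : ∀ (c e : ℝ), AEMeasurable fun t : ℝ => ENNReal.ofReal (|t - c| ^ e) * v t :=
    fun c e => (Measurable.aemeasurable (by fun_prop)).mul hv
  simp_rw [hpt]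
  rw [lintegral_add_left' (hmeas _ _), lintegral_finsetSum' _ fun k _ => hmeas _ _]
  calc _ ≤ C₀ * G + ∑ _k : ι, C * G :=
        add_le_add (h0 v G hv hsupp h l ⟨le_rfl, hlu.le⟩)
          (Finset.sum_le_sum fun k _ => hC v G hv hsupp h _ (hz k))
    _ = _ := by
        rw [Finset.sum_const, Finset.card_univ, nsmul_eq_mul]
        push_cast
        ring

/-- The kernel dominating the commutator of the singular operator with a product weight. -/
def weightKernel {ι : Type*} [Fintype ι] (b g : ℝ) (z : ι → ℝ) (x t : ℝ) : ℝ :=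
  ∑ k, hardyKernel b g |x - z k| |t - z k| +
    (1 + ∑ k, |x - z k| ^ b) * (1 + ∑ k, |t - z k| ^ (-g))

theorem measurable_weightKernel {ι : Type*} [Fintype ι] (b g : ℝ) (z : ι → ℝ) :
    Measurable fun q : ℝ × ℝ => weightKernel b g z q.1 q.2 := by
  unfold weightKernel
  refine Measurable.add (Finset.measurable_fun_sum _ fun k _ => ?_) (by fun_prop)
  exact (measurable_hardyKernel b g).comp (by fun_prop : Measurable fun q : ℝ × ℝ =>
    (|q.1 - z k|, |q.2 - z k|))

/-- The Hardy part is bounded node by node. The product part maps v to a finite number J, at most C₂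
G, times a fixed function in the Morrey space of the interval. -/
theorem MorreyBound.weightKernel {p lam b g : ℝ} (hp : 1 < p) (hlam0 : 0 ≤ lam) (hlam1 : lam < 1)
    (hb : (lam - 1) / p < b) (hb0 : b ≤ 0) (hg : g < lam / p + (1 - 1 / p)) {l u : ℝ} (hlu : l < u)
    {ι : Type*} [Fintype ι] {z : ι → ℝ} (hz : ∀ k, z k ∈ Icc l u) : ∃ C : ℝ≥0,
    ∀ (v : ℝ → ℝ≥0∞) (G : ℝ≥0∞), G ≠ ∞ → AEMeasurable v → (∀ t ∉ Icc l u, v t = 0) →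
      MorreyBound p lam v G → MorreyBound p lam ((Icc l u).indicator fun x =>
        ∫⁻ t, ENNReal.ofReal (weightKernel b g z x t) * v t) (C * G) := by
  have hp0 : 0 < p := by linarith
  obtain ⟨C₁, h1⟩ := MorreyBound.hardy hp hb hg
  obtain ⟨C₂, h2⟩ := MorreyBound.lintegral_weight_le hp hlam0 hlam1.le hg hlu hz
  obtain ⟨C₃, h3⟩ := morreyBound_indicator_rpow hp hlam0 hb hb0 l u hlu
  -- The constant 1 is treated as a power with exponent 0, about an arbitrary point.
  obtain ⟨C₄, h4⟩ := morreyBound_indicator_rpow hp hlam0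
    (div_neg_of_neg_of_pos (by linarith) hp0 : (lam - 1) / p < 0) le_rfl l u hlu
  refine ⟨Fintype.card ι * C₁ + C₂ * (C₄ + Fintype.card ι * C₃), fun v G hG hv hsupp h => ?_⟩
  set J := ∫⁻ t, ENNReal.ofReal (1 + ∑ k, |t - z k| ^ (-g)) * v t with hJ
  have hJle : J ≤ C₂ * G := h2 v G hv hsupp h
  have hJt : J ≠ ∞ := ne_top_of_le_ne_top (ENNReal.mul_ne_top (by simp) hG) hJle
  have hvm : ∀ k, AEMeasurable (fun q : ℝ × ℝ =>
      ENNReal.ofReal (hardyKernel b g |q.1 - z k| |q.2 - z k|) * v q.2) (volume.prod volume) :=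
    fun k => ((measurable_hardyKernel b g).comp (by fun_prop : Measurable fun q : ℝ × ℝ =>
      (|q.1 - z k|, |q.2 - z k|))).ennreal_ofReal.aemeasurable.mul hv.comp_snd
  have hHm : ∀ k, AEMeasurable fun x => ∫⁻ t, ENNReal.ofReal (hardyKernel b g |x - z k| |t - z k|) * v t :=
    fun k => (hvm k).lintegral_prod_right'
  have hPm : ∀ c e : ℝ, AEMeasurable ((Icc l u).indicator fun y : ℝ => ENNReal.ofReal (|y - c| ^ e)) :=
    fun c e => (Measurable.indicator (by fun_prop) measurableSet_Icc).aemeasurable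
  have hA : MorreyBound p lam (fun x => ∑ k, ∫⁻ t, ENNReal.ofReal
      (hardyKernel b g |x - z k| |t - z k|) * v t) (∑ _k : ι, C₁ * G) :=
    MorreyBound.sum hp.le Finset.univ hHm fun k => h1 v G hv h (z k)
  have hB := ((h4 l).add hp.le (hPm _ _) (Finset.aemeasurable_fun_sum _ fun k _ => hPm _ _)
    (MorreyBound.sum hp.le Finset.univ (fun k => hPm (z k) b) fun k => h3 (z k))).const_mul hp0.le hJt
  have hAB := hA.add hp.le (Finset.aemeasurable_fun_sum _ fun k _ => hHm k)
    (AEMeasurable.const_mul ((hPm _ _).add (Finset.aemeasurable_fun_sum _ fun k _ => hPm _ _)) _) hB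
  refine (hAB.mono_ae hp0.le (Eventually.of_forall fun x => ?_)).mono_right hp0.le ?_
  · by_cases hx : x ∈ Icc l u
    swap
    · rw [indicator_of_notMem hx]; exact bot_le
    simp only [Pi.add_apply, indicator_of_mem hx, Real.rpow_zero, ENNReal.ofReal_one]
    have hpt : ∀ t, ENNReal.ofReal (WeightedMorrey.weightKernel b g z x t) * v t =
        (∑ k, ENNReal.ofReal (hardyKernel b g |x - z k| |t - z k|) * v t) +
        ENNReal.ofReal (1 + ∑ k, |x - z k| ^ b) *
          (ENNReal.ofReal (1 + ∑ k, |t - z k| ^ (-g)) * v t) := fun t => by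
      have hs : ∀ (y e : ℝ), 0 ≤ 1 + ∑ k, |y - z k| ^ e := fun y e =>
        add_nonneg zero_le_one (Finset.sum_nonneg fun k _ => by positivity)
      have hk : ∀ k, 0 ≤ hardyKernel b g |x - z k| |t - z k| := fun k =>
        hardyKernel_nonneg _ _ (abs_nonneg _) (abs_nonneg _)
      rw [WeightedMorrey.weightKernel, ENNReal.ofReal_add (Finset.sum_nonneg fun k _ => hk k)
        (mul_nonneg (hs _ _) (hs _ _)), ENNReal.ofReal_mul (hs _ _),
        ENNReal.ofReal_sum_of_nonneg fun k _ => hk k, add_mul, Finset.sum_mul, mul_assoc]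
    have hm : ∀ k, AEMeasurable fun t => ENNReal.ofReal (hardyKernel b g |x - z k| |t - z k|) * v t :=
      fun k => ((measurable_hardyKernel b g).comp (by fun_prop : Measurable fun t : ℝ =>
        (|x - z k|, |t - z k|))).ennreal_ofReal.aemeasurable.mul hv
    simp_rw [hpt]
    rw [lintegral_add_left' (Finset.aemeasurable_fun_sum _ fun k _ => hm k),
      lintegral_finsetSum' _ fun k _ => hm k, lintegral_const_mul' _ _ (by simp), ← hJ,
      ofReal_one_add_sum fun k => by positivity, mul_comm J]
  · rw [Finset.sum_const, Finset.sum_const, Finset.card_univ, nsmul_eq_mul, nsmul_eq_mul]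
    calc _ ≤ Fintype.card ι * (C₁ * G) + C₂ * G * (C₄ + Fintype.card ι * C₃) := by gcongr
      _ = _ := by
        push_cast
        ring

/-! ### Morrey norms on an interval and Morrey bounds -/

/-- The norm uses only centres in the interval. For another centre, projection onto the interval is
1-Lipschitz and fixes its points, so the ball about the projected centre contains the relevant part
of the original ball. -/
theorem morreyBound_morreyNorm {p lam l u : ℝ} (hp : 0 < p) (hlu : l ≤ u) (f : ℝ → ℂ) :
    MorreyBound p lam (fun t => ‖(Icc l u).indicator f t‖ₑ) (morreyNorm l u p lam f) := by
  intro x r hr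
  set x' : ℝ := (projIcc l u hlu x).1 with hx'
  have hx'm : x' ∈ Icc l u := (projIcc l u hlu x).2
  have hR0 : ENNReal.ofReal (r ^ lam) ≠ 0 := by
    rw [ne_eq, ENNReal.ofReal_eq_zero, not_le]; positivity
  have h1 : (∫⁻ y in Metric.ball x' r ∩ Icc l u, ‖f y‖ₑ ^ p) / ENNReal.ofReal (r ^ lam) ≤
      morreyNorm l u p lam f ^ p := by
    have : ((∫⁻ y in Metric.ball x' r ∩ Icc l u, ‖f y‖ₑ ^ p) / ENNReal.ofReal (r ^ lam)) ^ (1 / p) ≤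
        morreyNorm l u p lam f := le_iSup₂_of_le x' hx'm (le_iSup₂_of_le r hr le_rfl)
    have := ENNReal.rpow_le_rpow this hp.le
    rwa [← ENNReal.rpow_mul, one_div_mul_cancel hp.ne', ENNReal.rpow_one] at this
  rw [ENNReal.div_le_iff hR0 ENNReal.ofReal_ne_top] at h1
  refine le_trans ?_ h1
  rw [← lintegral_indicator Metric.isOpen_ball.measurableSet,
    ← lintegral_indicator (Metric.isOpen_ball.measurableSet.inter measurableSet_Icc)]
  refine lintegral_mono fun y => ?_
  beta_reduce
  by_cases hy : y ∈ Icc l u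
  · by_cases hb : y ∈ Metric.ball x r
    · have hyb : y ∈ Metric.ball x' r := by
        rw [Metric.mem_ball, dist_comm, Real.dist_eq] at hb ⊢
        have := abs_projIcc_sub_projIcc hlu (c := x) (d := y)
        rw [projIcc_of_mem hlu hy] at this
        exact this.trans_lt hb
      simp only [indicator_of_mem hb, indicator_of_mem hy,
        indicator_of_mem (show y ∈ Metric.ball x' r ∩ Icc l u from ⟨hyb, hy⟩), le_refl]
    · rw [indicator_of_notMem hb]; exact bot_le
  · refine le_trans (le_of_eq ?_) bot_le
    by_cases hb : y ∈ Metric.ball x r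
    · simp [indicator_of_mem hb, indicator_of_notMem hy, ENNReal.zero_rpow_of_pos hp]
    · rw [indicator_of_notMem hb]; rfl

theorem morreyNorm_le_of_morreyBound {p lam l u : ℝ} (hp : 0 < p) {f : ℝ → ℂ} {v : ℝ → ℝ≥0∞}
    {G : ℝ≥0∞} (h : MorreyBound p lam v G)
    (hfv : ∀ᵐ y ∂volume.restrict (Icc l u), ‖f y‖ₑ ≤ v y) : morreyNorm l u p lam f ≤ G := by
  refine iSup₂_le fun x _ => iSup₂_le fun r hr => ?_
  rw [mem_Ioi] at hr
  have hR0 : ENNReal.ofReal (r ^ lam) ≠ 0 := by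
    rw [ne_eq, ENNReal.ofReal_eq_zero, not_le]; positivity
  have h1 : (∫⁻ y in Metric.ball x r ∩ Icc l u, ‖f y‖ₑ ^ p) / ENNReal.ofReal (r ^ lam) ≤ G ^ p := by
    rw [ENNReal.div_le_iff hR0 ENNReal.ofReal_ne_top]
    refine le_trans ?_ (h x r hr)
    calc _ ≤ ∫⁻ y in Metric.ball x r ∩ Icc l u, v y ^ p := by
          refine lintegral_mono_ae ?_
          filter_upwards [ae_mono (Measure.restrict_mono inter_subset_right le_rfl) hfv] with y hy
          gcongr
      _ ≤ _ := lintegral_mono_set inter_subset_left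
  calc _ ≤ (G ^ p) ^ (1 / p) := by gcongr
    _ = G := by rw [← ENNReal.rpow_mul, mul_one_div_cancel hp.ne', ENNReal.rpow_one]

/-! ### Truncated integrals -/

theorem tendsto_setIntegral_diff_closedBall {s : Set ℝ} {F : ℝ → ℂ}
    (hF : IntegrableOn F s) (x : ℝ) :
    Tendsto (fun ε => ∫ t in s \ Metric.closedBall x ε, F t) (𝓝[>] 0) (𝓝 (∫ t in s, F t)) := by
  have e : ∀ ε, ∫ t in s \ Metric.closedBall x ε, F t =
      ∫ t in s, (Metric.closedBall x ε)ᶜ.indicator F t := fun ε => by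
    rw [setIntegral_indicator Metric.isClosed_closedBall.measurableSet.compl, sdiff_eq]
  simp_rw [e]
  refine tendsto_integral_filter_of_dominated_convergence (fun t => ‖F t‖) ?_ ?_ hF.norm ?_
  · exact Eventually.of_forall fun ε =>
      hF.1.indicator Metric.isClosed_closedBall.measurableSet.compl
  · exact Eventually.of_forall fun ε => Eventually.of_forall fun t => norm_indicator_le_norm_self _ _
  · have : ∀ᵐ t ∂volume.restrict s, t ≠ x :=
      ae_restrict_of_ae (by simp [ae_iff, measure_singleton])
    filter_upwards [this] with t ht
    refine tendsto_const_nhds.congr' ?_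
    have h0 : 0 < |t - x| := abs_pos.2 (sub_ne_zero.2 ht)
    filter_upwards [Ioo_mem_nhdsGT h0] with ε hε
    rw [indicator_of_mem]
    rw [mem_compl_iff, Metric.mem_closedBall, Real.dist_eq, not_le]
    exact hε.2

theorem aestronglyMeasurable_truncatedSingular {l u : ℝ} {f : ℝ → ℂ}
    (hf : AEStronglyMeasurable f (volume.restrict (Icc l u))) (ε : ℝ) (μ : Measure ℝ) :
    AEStronglyMeasurable (fun x => truncatedSingular l u f x ε) μ := by
  set q : ℝ → ℝ → ℂ := fun x t => if ε < |t - x| then hf.mk f t / ((t : ℂ) - (x : ℂ)) else 0 with hq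
  have hqm : StronglyMeasurable (Function.uncurry q) := by
    refine Measurable.stronglyMeasurable (Measurable.ite ?_ ?_ measurable_const)
    · exact measurableSet_lt measurable_const (by fun_prop)
    · have := hf.stronglyMeasurable_mk.measurable
      fun_prop
  have e : (fun x => truncatedSingular l u f x ε) =
      fun x => (1 / (Real.pi : ℂ)) * ∫ t in Icc l u, q x t := by
    ext x
    rw [truncatedSingular, sdiff_eq,
      ← setIntegral_indicator Metric.isClosed_closedBall.measurableSet.compl]
    congr 1
    refine integral_congr_ae ?_
    filter_upwards [hf.ae_eq_mk] with t ht
    by_cases h : ε < |t - x|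
    · rw [indicator_of_mem, hq]
      · simp only [if_pos h, ht]
      · rw [mem_compl_iff, Metric.mem_closedBall, Real.dist_eq, not_le]; exact h
    · rw [indicator_of_notMem, hq]
      · simp only [if_neg h]
      · rw [mem_compl_iff, Metric.mem_closedBall, Real.dist_eq, not_not]; exact not_lt.1 h
  rw [e]
  exact (hqm.integral_prod_right.const_mul _).aestronglyMeasurable

theorem aestronglyMeasurable_singularOp {l u : ℝ} {f : ℝ → ℂ}
    (hf : AEStronglyMeasurable f (volume.restrict (Icc l u)))
    (h : ∀ᵐ x ∂volume.restrict (Icc l u), SingularExistsAt l u f x) :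
    AEStronglyMeasurable (singularOp l u f) (volume.restrict (Icc l u)) := by
  have hσ : Tendsto (fun n : ℕ => 1 / ((n : ℝ) + 1)) atTop (𝓝[>] 0) :=
    tendsto_nhdsWithin_iff.2 ⟨tendsto_one_div_add_atTop_nhds_zero_nat,
      Eventually.of_forall fun n => by rw [mem_Ioi]; positivity⟩
  refine aestronglyMeasurable_of_tendsto_ae atTop
    (fun n : ℕ => aestronglyMeasurable_truncatedSingular hf (1 / ((n : ℝ) + 1)) _) ?_
  filter_upwards [h] with x hx
  exact hx.2.comp hσ

/-! ### Boundedness of the singular operator -/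

/-- The identity ρ(x) f(t) = ρ(t) f(t) + (ρ(x) - ρ(t)) f(t) splits the truncated integral: the first
part converges by hypothesis, the second by absolute integrability. -/
theorem singularExistsAt_of_tendsto {l u : ℝ} {ρ : ℝ → ℝ} {f : ℝ → ℂ} {x : ℝ} {L : ℂ}
    (hρ : ρ x ≠ 0) (hf : IntegrableOn f (Icc l u))
    (hg : Integrable ((Icc l u).indicator fun t => (ρ t : ℂ) * f t))
    (hL : Tendsto (fun ε => ∫ t in (Metric.closedBall x ε)ᶜ,
      (Icc l u).indicator (fun t => (ρ t : ℂ) * f t) t / ((t : ℂ) - (x : ℂ))) (𝓝[>] 0) (𝓝 L))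
    (hF : IntegrableOn (fun t => ((ρ x : ℂ) - ρ t) * f t / ((t : ℂ) - (x : ℂ))) (Icc l u)) :
    SingularExistsAt l u f x ∧ (ρ x : ℂ) * singularOp l u f x = 1 / (Real.pi : ℂ) *
      (L + ∫ t in Icc l u, ((ρ x : ℂ) - ρ t) * f t / ((t : ℂ) - (x : ℂ))) := by
  have hρ' : (ρ x : ℂ) ≠ 0 := by exact_mod_cast hρ
  have hBm : ∀ ε, MeasurableSet (Metric.closedBall x ε)ᶜ := fun ε =>
    Metric.isClosed_closedBall.measurableSet.compl
  have hint : ∀ ε > 0, IntegrableOn (fun t => f t / ((t : ℂ) - (x : ℂ)))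
      (Icc l u \ Metric.closedBall x ε) := fun ε hε => by
    have h := integrableOn_div_compl_closedBall
      ((integrable_indicator_iff measurableSet_Icc).2 hf) x hε
    have h2 := h.mono_set (s := Icc l u \ Metric.closedBall x ε) fun t ht => ht.2
    refine h2.congr_fun (fun t ht => ?_) (measurableSet_Icc.diff Metric.isClosed_closedBall.measurableSet)
    simp only [indicator_of_mem ht.1]
  set F : ℝ → ℂ := fun t => ((ρ x : ℂ) - ρ t) * f t / ((t : ℂ) - (x : ℂ)) with hFdef
  have hlim : Tendsto (truncatedSingular l u f x) (𝓝[>] 0)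
      (𝓝 (1 / (Real.pi : ℂ) * ((ρ x : ℂ)⁻¹ * (L + ∫ t in Icc l u, F t)))) := by
    refine (((hL.add (tendsto_setIntegral_diff_closedBall hF x)).const_mul
      (ρ x : ℂ)⁻¹).const_mul (1 / (Real.pi : ℂ))).congr' ?_
    filter_upwards [self_mem_nhdsWithin] with ε hε
    rw [truncatedSingular]
    congr 1
    have e1 : ∫ t in (Metric.closedBall x ε)ᶜ,
        (Icc l u).indicator (fun t => (ρ t : ℂ) * f t) t / ((t : ℂ) - (x : ℂ)) =
        ∫ t in Icc l u \ Metric.closedBall x ε, (ρ t : ℂ) * f t / ((t : ℂ) - (x : ℂ)) := by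
      rw [sdiff_eq, inter_comm, ← setIntegral_indicator measurableSet_Icc]
      refine integral_congr_ae (Eventually.of_forall fun t => ?_)
      by_cases ht : t ∈ Icc l u <;> simp [ht]
    have hi1 : IntegrableOn (fun t => (ρ t : ℂ) * f t / ((t : ℂ) - (x : ℂ)))
        (Icc l u \ Metric.closedBall x ε) := by
      have h2 := (integrableOn_div_compl_closedBall hg x hε).mono_set
        (s := Icc l u \ Metric.closedBall x ε) fun t ht => ht.2
      refine h2.congr_fun (fun t ht => ?_)
        (measurableSet_Icc.diff Metric.isClosed_closedBall.measurableSet)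
      simp only [indicator_of_mem ht.1]
    rw [e1, ← integral_add hi1 (hF.mono_set sdiff_subset), ← integral_const_mul]
    refine integral_congr_ae (Eventually.of_forall fun t => ?_)
    simp only [hFdef]
    field_simp
    ring
  have hop : singularOp l u f x = 1 / (Real.pi : ℂ) * ((ρ x : ℂ)⁻¹ * (L + ∫ t in Icc l u, F t)) :=
    hlim.limUnder_eq
  refine ⟨⟨hint, ?_⟩, ?_⟩
  · rw [hop]; exact hlim
  · rw [hop]; field_simp

/-- After multiplication by ρ, the operator is dominated by the principal value of w = ρf, extended
by zero, plus C times the positive operator K applied to |w|. -/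
theorem singularOpBounded_of_kernel {p lam b g : ℝ} (hp : 1 < p) (hlam0 : 0 ≤ lam) (hlam1 : lam < 1)
    (hb : (lam - 1) / p < b) (hb0 : b ≤ 0) (hg : g < lam / p + (1 - 1 / p)) {l u : ℝ} (hlu : l < u)
    {ι : Type*} [Fintype ι] {z : ι → ℝ} (hz : ∀ k, z k ∈ Icc l u) {ρ : ℝ → ℝ}
    (hρm : AEStronglyMeasurable ρ (volume.restrict (Icc l u)))
    (hρ : ∀ t ∈ Icc l u, (∀ k, t ≠ z k) → 0 < ρ t) {C : ℝ} (hC : 0 < C)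
    (hlow : ∀ t ∈ Icc l u, (∀ k, t ≠ z k) → 1 ≤ C * ρ t * (1 + ∑ k, |t - z k| ^ (-g)))
    (hker : ∀ y ∈ Icc l u, (∀ k, y ≠ z k) → ∀ t ∈ Icc l u, (∀ k, t ≠ z k) →
      |ρ y - ρ t| ≤ C * ρ t * (|y - t| * weightKernel b g z y t)) :
    SingularOpBounded l u p lam ρ := by
  have hp0 : 0 < p := by linarith
  obtain ⟨A₁, h1⟩ := hilbert_morrey hp hlam1
  obtain ⟨A₂, h2⟩ := MorreyBound.weightKernel hp hlam0 hlam1 hb hb0 hg hlu hz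
  obtain ⟨A₃, h3⟩ := MorreyBound.lintegral_weight_le hp hlam0 hlam1.le hg hlu hz
  refine ⟨A₁ + C.toNNReal * A₂, fun f ⟨hfm, hfG⟩ => ?_⟩
  set G := weightedMorreyNorm l u p lam ρ f with hG
  set w : ℝ → ℂ := (Icc l u).indicator fun t => (ρ t : ℂ) * f t with hw
  have hwM : MorreyBound p lam (fun t => ‖w t‖ₑ) G := morreyBound_morreyNorm hp0 hlu.le _
  have hρc : AEStronglyMeasurable (fun t => (ρ t : ℂ)) (volume.restrict (Icc l u)) :=
    Complex.continuous_ofReal.comp_aestronglyMeasurable hρm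
  have hwm : AEStronglyMeasurable w :=
    (aestronglyMeasurable_indicator_iff measurableSet_Icc).2 (hρc.mul hfm)
  have hw0 : ∀ t ∉ Icc l u, w t = 0 := fun t ht => indicator_of_notMem ht _
  have hwR : ∀ t, max |l| |u| < |t| → w t = 0 := fun t ht => hw0 t fun hmem =>
    ht.not_ge (abs_le_max_abs_abs hmem.1 hmem.2)
  have hw0' : ∀ t ∉ Icc l u, ‖w t‖ₑ = 0 := fun t ht => by rw [hw0 t ht, enorm_zero]
  have hwi : Integrable w := hwM.integrable hp hlam1.le hwm hwR hfG.ne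
  obtain ⟨h, hhm, hhlim, hhM⟩ := h1 w hwm ⟨_, hwR⟩ G hfG.ne hwM
  set K : ℝ → ℝ≥0∞ := fun x => ∫⁻ t, ENNReal.ofReal (weightKernel b g z x t) * ‖w t‖ₑ with hK
  have hKm : AEMeasurable K :=
    AEMeasurable.lintegral_prod_right' (f := fun q : ℝ × ℝ =>
      ENNReal.ofReal (weightKernel b g z q.1 q.2) * ‖w q.2‖ₑ)
      ((measurable_weightKernel b g z).ennreal_ofReal.aemeasurable.mul hwm.enorm.comp_snd)
  have hKM : MorreyBound p lam ((Icc l u).indicator K) (A₂ * G) :=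
    h2 _ G hfG.ne hwm.enorm hw0' hwM
  have hz0 : ∀ᵐ t ∂volume.restrict (Icc l u), ∀ k, t ≠ z k :=
    ae_restrict_of_ae (ae_all_iff.2 fun k => by simp [ae_iff, measure_singleton])
  have hmem : ∀ᵐ t ∂volume.restrict (Icc l u), t ∈ Icc l u := ae_restrict_mem measurableSet_Icc
  -- The Morrey bound on one ball containing the interval makes K finite almost everywhere; this is
  -- what makes the commutator integral absolutely convergent.
  have hKfin : ∀ᵐ x ∂volume.restrict (Icc l u), K x < ∞ := by
    have hb := (hKM l (2 * (u - l)) (by linarith)).trans_lt (ENNReal.mul_lt_top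
      (ENNReal.rpow_lt_top_of_nonneg hp0.le (ENNReal.mul_ne_top (by simp) hfG.ne)) (by simp))
    have hsub : Icc l u ⊆ Metric.ball l (2 * (u - l)) := fun t ht => by
      rw [Metric.mem_ball, Real.dist_eq, abs_of_nonneg (by linarith [ht.1])]
      linarith [ht.2]
    have := ae_lt_top' (((hKm.indicator measurableSet_Icc).pow_const p).restrict) hb.ne
    filter_upwards [ae_mono (Measure.restrict_mono hsub le_rfl) this, hmem] with x hx hxI
    rw [indicator_of_mem hxI] at hx
    by_contra hcon
    rw [not_lt, top_le_iff] at hcon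
    rw [hcon, ENNReal.top_rpow_of_pos hp0] at hx
    exact lt_irrefl _ hx
  -- The lower bound for ρ dominates |f| by a multiple of (1 + ∑ |t - z k|^(-g)) |w|.
  have hfi : IntegrableOn f (Icc l u) := by
    refine ⟨hfm, ?_⟩
    have hJ := (h3 _ G hwm.enorm hw0' hwM).trans_lt (ENNReal.mul_lt_top (by simp) hfG)
    refine lt_of_le_of_lt ?_ (ENNReal.mul_lt_top (ENNReal.ofReal_lt_top (r := C)) hJ)
    rw [← lintegral_const_mul' _ _ (by simp)]
    refine le_trans (lintegral_mono_ae ?_) (setLIntegral_le_lintegral (Icc l u) _)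
    filter_upwards [hz0, hmem] with t htz ht
    have hpos := hρ t ht htz
    have hs : 0 ≤ 1 + ∑ k, |t - z k| ^ (-g) :=
      add_nonneg zero_le_one (Finset.sum_nonneg fun k _ => by positivity)
    rw [← ofReal_norm, ← ofReal_norm, ← ENNReal.ofReal_mul hs, ← ENNReal.ofReal_mul hC.le, hw,
      indicator_of_mem ht, norm_mul, Complex.norm_real, Real.norm_of_nonneg hpos.le]
    refine ENNReal.ofReal_le_ofReal ?_
    calc ‖f t‖ = 1 * ‖f t‖ := (one_mul _).symm
      _ ≤ C * ρ t * (1 + ∑ k, |t - z k| ^ (-g)) * ‖f t‖ := by gcongr; exact hlow t ht htz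
      _ = _ := by ring
  have hFle : ∀ x ∈ Icc l u, (∀ k, x ≠ z k) →
      ∫⁻ t in Icc l u, ‖((ρ x : ℂ) - ρ t) * f t / ((t : ℂ) - (x : ℂ))‖ₑ ≤ ENNReal.ofReal C * K x := by
    intro x hx hxz
    rw [hK, ← lintegral_const_mul' _ _ (by simp)]
    refine le_trans (lintegral_mono_ae ?_) (setLIntegral_le_lintegral (Icc l u) _)
    have hne : ∀ᵐ t ∂volume.restrict (Icc l u), t ≠ x :=
      ae_restrict_of_ae (by simp [ae_iff, measure_singleton])
    filter_upwards [hz0, hmem, hne] with t htz ht htx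
    have hpos := hρ t ht htz
    have h0 : 0 < |t - x| := abs_pos.2 (sub_ne_zero.2 htx)
    have hk := hker x hx hxz t ht htz
    have hk0 : 0 ≤ weightKernel b g z x t := add_nonneg
      (Finset.sum_nonneg fun k _ => hardyKernel_nonneg _ _ (abs_nonneg _) (abs_nonneg _))
      (mul_nonneg (add_nonneg zero_le_one (Finset.sum_nonneg fun k _ => by positivity))
        (add_nonneg zero_le_one (Finset.sum_nonneg fun k _ => by positivity)))
    rw [← ofReal_norm, ← ofReal_norm, ← ENNReal.ofReal_mul hk0, ← ENNReal.ofReal_mul hC.le, hw,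
      indicator_of_mem ht, norm_mul, norm_div, norm_mul, ← Complex.ofReal_sub, ← Complex.ofReal_sub,
      Complex.norm_real, Complex.norm_real, Complex.norm_real, Real.norm_of_nonneg hpos.le,
      Real.norm_eq_abs, Real.norm_eq_abs]
    refine ENNReal.ofReal_le_ofReal ?_
    rw [div_le_iff₀ h0]
    rw [abs_sub_comm x t] at hk
    calc |ρ x - ρ t| * ‖f t‖ ≤ C * ρ t * (|t - x| * weightKernel b g z x t) * ‖f t‖ := by gcongr
      _ = _ := by ring
  have hmain : ∀ᵐ x ∂volume.restrict (Icc l u), SingularExistsAt l u f x ∧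
      ‖(ρ x : ℂ) * singularOp l u f x‖ₑ ≤ ‖h x‖ₑ + ENNReal.ofReal C * (Icc l u).indicator K x := by
    filter_upwards [hz0, hmem, hKfin, ae_restrict_of_ae hhlim] with x hxz hx hxK hxlim
    have hle := hFle x hx hxz
    have hF : IntegrableOn (fun t => ((ρ x : ℂ) - ρ t) * f t / ((t : ℂ) - (x : ℂ))) (Icc l u) := by
      refine ⟨?_, hle.trans_lt (ENNReal.mul_lt_top (by simp) hxK)⟩
      simp_rw [div_eq_mul_inv]
      exact ((aestronglyMeasurable_const.sub hρc).mul hfm).mul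
        (Measurable.aestronglyMeasurable (by fun_prop))
    obtain ⟨hex, heq⟩ := singularExistsAt_of_tendsto (hρ x hx hxz).ne' hfi hwi hxlim hF
    refine ⟨hex, ?_⟩
    rw [heq, indicator_of_mem hx, enorm_mul]
    have hpi : ‖(1 / (Real.pi : ℂ))‖ₑ ≤ 1 := by
      rw [← ofReal_norm, ENNReal.ofReal_le_one, norm_div, norm_one, Complex.norm_real,
        Real.norm_of_nonneg Real.pi_pos.le, div_le_one Real.pi_pos]
      linarith [Real.pi_gt_three]
    calc _ ≤ 1 * (‖h x‖ₑ + ENNReal.ofReal C * K x) := by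
          gcongr
          refine (enorm_add_le _ _).trans ?_
          gcongr
          exact (enorm_integral_le_lintegral_enorm _).trans hle
      _ = _ := one_mul _
  have hex : ∀ᵐ x ∂volume.restrict (Icc l u), SingularExistsAt l u f x := hmain.mono fun _ h => h.1
  have hbound : weightedMorreyNorm l u p lam ρ (singularOp l u f) ≤
      (A₁ + C.toNNReal * A₂ : ℝ≥0) * G := by
    refine morreyNorm_le_of_morreyBound hp0 ?_ (hmain.mono fun _ h => h.2)
    have := hhM.add hp.le hhm.enorm ((hKm.indicator measurableSet_Icc).const_mul _)
      (hKM.const_mul hp0.le (ENNReal.ofReal_ne_top (r := C)))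
    refine this.mono_right hp0.le (le_of_eq ?_)
    push_cast
    simp only [ENNReal.ofReal]
    ring
  exact ⟨hex, ⟨aestronglyMeasurable_singularOp hfm hex,
    hbound.trans_lt (ENNReal.mul_lt_top ENNReal.coe_lt_top hfG)⟩, hbound⟩

theorem aestronglyMeasurable_prod_weight {ι : Type*} [Fintype ι] {l u : ℝ} {z : ι → ℝ}
    (hz : ∀ k, z k ∈ Icc l u) {φ : ι → ℝ → ℝ} (hφ : ∀ k, ContinuousOn (φ k) (Ioc 0 (u - l))) :
    AEStronglyMeasurable (fun t => ∏ k, φ k |t - z k|) (volume.restrict (Icc l u)) := by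
  refine Finset.aestronglyMeasurable_fun_prod _ fun k _ => ?_
  have hc : ContinuousOn (fun t => φ k |t - z k|) (Icc l u \ {z k}) := by
    refine (hφ k).comp (Continuous.continuousOn (by fun_prop)) fun t ht => ?_
    refine ⟨abs_pos.2 (sub_ne_zero.2 ht.2), ?_⟩
    rw [abs_le]
    constructor <;> linarith [ht.1.1, ht.1.2, (hz k).1, (hz k).2]
  have h := hc.aestronglyMeasurable (μ := volume)
    (measurableSet_Icc.diff (measurableSet_singleton (z k)))
  rwa [Measure.restrict_congr_set (sdiff_null_ae_eq_self (measure_singleton (z k)))] at h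

theorem singularOpBounded_of_zygmund {ι : Type*} [Fintype ι] {p lam l u : ℝ} (hp : 1 < p)
    (hlam0 : 0 ≤ lam) (hlam1 : lam < 1) (hlu : l < u) {z : ι → ℝ} (hz : ∀ k, z k ∈ Icc l u)
    (hinj : Function.Injective z) {φ : ι → ℝ → ℝ} (hW : ∀ k, ClassWTilde (u - l) (φ k))
    (hV : ∀ k, ClassVpp (u - l) (φ k) ∨ ClassVmp (u - l) (φ k))
    (hZ : ∀ k, Zygmund (u - l) ((lam - 1) / p) (lam / p + (1 - 1 / p)) (φ k)) :
    SingularOpBounded l u p lam (fun t => ∏ k, φ k |t - z k|) := by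
  have hp0 : 0 < p := by linarith
  have hβ : (lam - 1) / p < 0 := div_neg_of_neg_of_pos (by linarith) hp0
  have hγ : 0 < lam / p + (1 - 1 / p) := by
    have : 1 / p < 1 := (div_lt_one hp0).2 hp
    have : 0 ≤ lam / p := by positivity
    linarith
  have hD := fun k => doubling_of_classV (hW k) (hV k)
  choose ε₁ hε₁ hU using fun k => (hZ k).1.powerUpper (hW k).1 (hD k)
  choose ε₂ hε₂ hLo using fun k => (hZ k).2.powerLower (sub_pos.2 hlu) (hW k).1 (hD k)
  obtain ⟨δ₁, hδ₁, h1⟩ := exists_pos_le_of_finite ε₁ hε₁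
  obtain ⟨δ₂, hδ₂, h2⟩ := exists_pos_le_of_finite ε₂ hε₂
  -- Common exponents for all nodes. Cutting at 0 gives the signs b ≤ 0 ≤ g needed for the kernel
  -- estimate and keeps b > β and g < γ, because β < 0 < γ.
  set b := min 0 ((lam - 1) / p + δ₁)
  set g := max 0 (lam / p + (1 - 1 / p) - δ₂)
  obtain ⟨C, hC, hlow, hker⟩ := exists_weight_kernel_bounds hlu (b := b) (g := g) (min_le_left _ _)
    (le_max_left _ _) hz hinj (fun k => (hW k).1.2)
    (fun k => (hU k).mono (hW k).1 ((min_le_right _ _).trans (by linarith [h1 k])))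
    (fun k => (hLo k).mono (hW k).1 (le_trans (by linarith [h2 k]) (le_max_right _ _)))
    (fun k => lipschitz_of_classV (hW k) (hV k))
  refine singularOpBounded_of_kernel hp hlam0 hlam1 (lt_min hβ (by linarith)) (min_le_left _ _)
    (max_lt hγ (by linarith)) hlu hz (aestronglyMeasurable_prod_weight hz fun k => (hW k).1.1)
    (fun t ht hne => Finset.prod_pos fun k _ => (hW k).1.2 _ ⟨abs_pos.2 (sub_ne_zero.2 (hne k)), ?_⟩)
    hC hlow hker
  rw [abs_le]
  constructor <;> linarith [ht.1, ht.2, (hz k).1, (hz k).2]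

end WeightedMorrey

end

theorem mainTheorem3 (a b : ℝ) (hab : a < b) (p lam : ℝ) (hp : 1 < p)
    (hlam0 : 0 ≤ lam) (hlam1 : lam < 1)
    (N : ℕ) (x : Fin N → ℝ) (hx : ∀ k, x k ∈ Icc a b) (hxinj : Function.Injective x)
    (φ : Fin N → ℝ → ℝ)
    (hφW : ∀ k, WeightedMorrey.ClassWTilde (b - a) (φ k))
    (hφV : ∀ k, WeightedMorrey.ClassVpp (b - a) (φ k) ∨ WeightedMorrey.ClassVmp (b - a) (φ k)) :
    (∀ k,
      WeightedMorrey.Zygmund (b - a) ((lam - 1) / p) (lam / p + (1 - 1 / p)) (φ k) ↔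
        (((lam - 1) / p : ℝ) : EReal) < WeightedMorrey.lowerIndex (φ k) ∧
        WeightedMorrey.lowerIndex (φ k) ≤ WeightedMorrey.upperIndex (φ k) ∧
        WeightedMorrey.upperIndex (φ k) < ((lam / p + (1 - 1 / p) : ℝ) : EReal)) ∧
    ((∀ k, WeightedMorrey.Zygmund (b - a) ((lam - 1) / p) (lam / p + (1 - 1 / p)) (φ k)) →
      WeightedMorrey.SingularOpBounded a b p lam (fun t => ∏ k, φ k |t - x k|)) := by
  have hℓ : 0 < b - a := sub_pos.2 hab
  refine ⟨fun k => ?_, fun hZ => ?_⟩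
  · exact WeightedMorrey.zygmund_iff_index _ _ hℓ (hφW k).1
      (WeightedMorrey.doubling_of_classV (hφW k) (hφV k))
  · exact WeightedMorrey.singularOpBounded_of_zygmund hp hlam0 hlam1 hab hx hxinj hφW hφV hZ
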